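/- Setup. Let $\mathcal R=(X,R,Y,R^\vee,\Delta)$ be a based root datum ($X,Y$ lattices in perfect duality, $R$ finite and reduced) with Weyl group $W$, let $q\in\mathbb R_{>1}$ and let $\lambda,\lambda^*:R\to\mathbb R$ be $W$-invariant functions with $\lambda^*(\alpha)=\lambda(\alpha)$ whenever $\alpha^\vee\notin 2Y$. The affine Hecke algebra $\mathcal H=\mathcal H(\mathcal R,\lambda,\lambda^*,q)$ is the $\mathbb C$-algebra generated by elements $N_w$ $(w\in W)$ and $\theta_x$ $(x\in X)$, where $N_e=\theta_0=1$, $\theta_x\theta_y=\theta_{x+y}$ and, for $\alpha\in\Delta$, $s=s_\alpha$, $c=q^{\lambda(\alpha)/2}-q^{-\lambda(\alpha)/2}$, $c^*=q^{\lambda^*(\alpha)/2}-q^{-\lambda^*(\alpha)/2}$: $N_wN_s=N_{ws}$ if $\ell(ws)>\ell(w)$, $N_wN_s=N_{ws}+cN_w$ if $\ell(ws)<\ell(w)$, and $$\theta_xN_s-N_s\theta_{s(x)}=(c+c^*\theta_{-\alpha})\,\frac{\theta_x-\theta_{s(x)}}{1-\theta_{-2\alpha}} .$$ For $P\subset\Delta$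 let $W_P=\langle s_\alpha:\alpha\in P\rangle$ with longest element $w_P$, let $\mathcal H^P\subset\mathcal H$ be the subalgebra generated by all $\theta_x$ and by the $N_w$ with $w\in W_P$, and put $P^{op}=w_\Delta(-P)\subset\Delta$. For a subalgebra $B$ of an algebra $A$, $\mathrm{Res}^A_B:\mathrm{Mod}(A)\to\mathrm{Mod}(B)$ is restriction and $\mathrm{ind}_B^A(V)=A\otimes_BV$. Theorem (second adjointness for affine Hecke algebras). Let $P\subset\Delta$. There is a (unique) algebra isomorphism $\psi_{\Delta P}:\mathcal H^P\to\mathcal H^{P^{op}}$ with $$\psi_{\Delta P}(N_w\theta_x)=N_{w_\Delta w_Pww_Pw_\Delta}\,\theta_{w_\Delta w_P(x)}\qquad (w\in W_P,\ x\in X),$$ and: (a) the functor $\pi\mapsto\mathrm{Res}^{\mathcal H}_{\mathcal H^{P^{op}}}(\pi)\circ\psi_{\Delta P}$ is left adjoint to $\mathrm{ind}_{\mathcal H^P}^{\mathcal H}$; (b) the functor $\rho\mapsto\mathrm{ind}_{\mathcal H^{P^{op}}}^{\mathcal H}(\rho\circ\psi_{\Delta P}^{-1})$ is right adjoint to $\mathrm{Res}^{\mathcal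 H}_{\mathcal H^P}$. Twisted extended version. Let a finite group $\Gamma$ act on $\mathcal R$, preserving $\Delta$, $\lambda$ and $\lambda^*$, and on $\mathcal H$ by algebra automorphisms with $\gamma(N_w)=N_{\gamma w\gamma^{-1}}$ and $\gamma(\theta_x)=z_\gamma(x)\theta_{\gamma(x)}$ for some $z_\gamma\in T=\mathrm{Hom}(X,\mathbb C^\times)$; $\Gamma$ acts on $T$, regarded as the set of characters of $\mathbb C[X]=\mathrm{span}\{\theta_x\}$, by $(\gamma t)(a)=t(\gamma^{-1}(a))$. Let $\natural:\Gamma^2\to\mathbb C^\times$ be a 2-cocycle, let $\mathbb C[\Gamma,\natural]$ be the twisted group algebra with basis $N_\gamma$ and $N_\gamma N_{\gamma'}=\natural(\gamma,\gamma')N_{\gamma\gamma'}$, and form the crossed product $\mathcal H\rtimes\mathbb C[\Gamma,\natural]$. Write $T^P=\mathrm{Hom}(X/(X\cap\mathbb QP),\mathbb C^\times)$, $T_P=\mathrm{Hom}(X/(P^\vee)^\perp,\mathbb C^\times)$, subgroups of $T$, where $(P^\vee)^\perp=\{x\in X:\langle x,\alpha^\vee\rangle=0\ \forall\alpha\in P\}$.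 Let $\Gamma_P\subset\Gamma$ $(P\subset\Delta)$ be subgroups such that: (i) $\Gamma_P\subset\Gamma_Q$ if $P\subset Q$; (ii) $\Gamma_P$ stabilizes $P$, $T_P$ and $T^P$; (iii) every element of $\Gamma_P$ acts on $T^P$ as multiplication by an element of $T_P\cap T^P$; (iv) if $g\in W\rtimes\Gamma$, $P\subset\Delta$ and $g(P)\subset\Delta$, then $g\Gamma_Pg^{-1}=\Gamma_{g(P)}$; (v) $\natural=1$ on $\Gamma_\emptyset^2$. Put $N_{w\gamma}=N_wN_\gamma$ for $w\in W,\gamma\in\Gamma$. Then, for all $P\subset\Delta$, there is a (unique) algebra isomorphism $$\psi_{\Delta P}:\mathcal H^P\rtimes\mathbb C[\Gamma_P,\natural]\to\mathcal H^{P^{op}}\rtimes\mathbb C[\Gamma_{P^{op}},\natural],\quad N_g\theta_x\mapsto N_{w_\Delta w_Pgw_Pw_\Delta}\,\theta_{w_\Delta w_P(x)}\quad(g\in W_P\rtimes\Gamma_P,\ x\in X),$$ and (a) and (b) hold with $\mathcal H$, $\mathcal H^P$, $\mathcal H^{P^{op}}$ replaced by $\mathcal H\rtimes\mathbb C[\Gamma,\natural]$,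 $\mathcal H^P\rtimes\mathbb C[\Gamma_P,\natural]$, $\mathcal H^{P^{op}}\rtimes\mathbb C[\Gamma_{P^{op}},\natural]$. -/

import Mathlib

open CategoryTheory TensorProduct

universe u v

noncomputable section

namespace SecondAdj

/-! ### Weyl group, length, longest elements, parabolic subgroups -/

section Weyl

variable {ι X Y : Type u} [AddCommGroup X] [AddCommGroup Y] {D : RootPairing ι ℤ X Y}

/-- The Weyl group is normalized by all automorphisms of the root datum. -/
instance weylGroup_normal (D : RootPairing ι ℤ X Y) : (D.weylGroup).Normal := by
  refine ⟨fun w hw g => ?_⟩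
  induction hw using RootPairing.weylGroup.induction with
  | mem i =>
    have h : g * RootPairing.Equiv.reflection D i * g⁻¹
        = RootPairing.Equiv.reflection D (g • i) := by
      rw [mul_inv_eq_iff_eq_mul]
      apply RootPairing.Equiv.weightHom_injective D
      ext x
      change g • (RootPairing.Equiv.reflection D i • x)
        = RootPairing.Equiv.reflection D (g • i) • (g • x)
      have hr : D.root (g • i) = g • D.root i := RootPairing.Equiv.root_indexEquiv_eq_smul D i g
      have hc : D.toLinearMap (g • x) (D.coroot (g • i)) = D.toLinearMap x (D.coroot i) := by
        have h1 : D.coroot i = g.toHom.coweightMap (D.coroot (g • i)) := by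
          have := congr_fun g.toHom.coroot_coweightMap (g • i)
          simp only [Function.comp_apply] at this
          rw [this]
          congr 1
          exact (g.toHom.indexEquiv.symm_apply_apply i).symm
        rw [h1]
        have h2 := LinearMap.ext_iff₂.mp g.toHom.weight_coweight_transpose
          (D.coroot (g • i)) x
        exact (by simpa using h2.symm :
          D.toLinearMap x (g.toHom.coweightMap (D.coroot (g • i)))
            = D.toLinearMap (g.toHom.weightMap x) (D.coroot (g • i))).symm
      simp only [RootPairing.Equiv.reflection_smul, RootPairing.reflection_apply]
      rw [smul_sub, hr]
      congr 1
      have hz : ∀ (n : ℤ) (y : X), g • (n • y) = n • (g • y) := fun n y => smul_comm g n y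
      rw [hz]
      congr 1
      exact hc.symm
    rw [h]
    exact D.reflection_mem_weylGroup _
  | one => simp
  | mul x y _ _ hx hy =>
    have : g * (x * y) * g⁻¹ = (g * x * g⁻¹) * (g * y * g⁻¹) := by group
    rw [this]
    exact mul_mem hx hy

/-- The simple reflection (or any reflection) `s_i`, as an element of the Weyl group. -/
abbrev refl (D : RootPairing ι ℤ X Y) (i : ι) : D.weylGroup := RootPairing.weylGroup.ofIdx D i

/-- The length of a Weyl group element: the number of positive roots that it makes negative. -/
def len (b : D.Base) (w : D.weylGroup) : ℕ := Set.ncard {i : ι | b.IsPos i ∧ ¬ b.IsPos (w • i)}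

/-- The standard parabolic subgroup `W_P`, generated by the reflections in the elements of `P`. -/
def parabolicWeyl (D : RootPairing ι ℤ X Y) (P : Set ι) : Subgroup D.weylGroup :=
  Subgroup.closure (refl D '' P)

theorem exists_longest [Finite ι] (b : D.Base) (P : Set ι) :
    ∃ w : D.weylGroup, w ∈ parabolicWeyl D P ∧ ∀ v ∈ parabolicWeyl D P, len b v ≤ len b w := by
  have hfin : Set.Finite (len b '' (parabolicWeyl D P : Set D.weylGroup)) := by
    refine (Set.finite_le_nat (Nat.card ι)).subset ?_
    rintro _ ⟨w, -, rfl⟩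
    exact Set.ncard_le_card _
  obtain ⟨_, ⟨w, hw, rfl⟩, hmax⟩ := hfin.exists_maximalFor id _
    ⟨_, Set.mem_image_of_mem _ (one_mem (parabolicWeyl D P))⟩
  refine ⟨w, hw, fun v hv => ?_⟩
  rcases le_total (len b v) (len b w) with h | h
  · exact h
  · exact hmax ⟨v, hv, rfl⟩ h

/-- The longest element `w_P` of `W_P`. For `P = Δ` this is `w_Δ`. -/
def longest [Finite ι] (b : D.Base) (P : Set ι) : D.weylGroup :=
  Classical.choose (exists_longest b P)

/-- The set `P^op = w_Δ (-P)` (as a set of indices of roots). -/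
def opp [Finite ι] (b : D.Base) (P : Set ι) : Set ι :=
  {i | ∃ j ∈ P, D.root i = longest b b.support • (-D.root j)}

end Weyl

/-! ### The affine Hecke algebra -/

/-- Parameters of an affine Hecke algebra: `q > 1` and label functions `λ, λ* : R → ℝ`. -/
structure Labels {ι X Y : Type u} [AddCommGroup X] [AddCommGroup Y]
    (D : RootPairing ι ℤ X Y) where
  q : ℝ
  one_lt_q : 1 < q
  lam : ι → ℝ
  lamStar : ι → ℝ
  lam_weyl : ∀ (w : D.weylGroup) (i : ι), lam (w • i) = lam i
  lamStar_weyl : ∀ (w : D.weylGroup) (i : ι), lamStar (w • i) = lamStar i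
  lamStar_eq : ∀ i : ι, (¬ ∃ y : Y, D.coroot i = (2 : ℤ) • y) → lamStar i = lam i

section Hecke

variable {ι X Y : Type u} [AddCommGroup X] [AddCommGroup Y] {D : RootPairing ι ℤ X Y}

/-- `q_{s_i}^{1/2} - q_{s_i}^{-1/2}`, where `q_{s_i} = q^{λ(i)}`. -/
def Labels.c (κ : Labels D) (i : ι) : ℂ :=
  ((κ.q ^ (κ.lam i / 2) - κ.q ^ (-(κ.lam i / 2)) : ℝ) : ℂ)

/-- `q_{s'_i}^{1/2} - q_{s'_i}^{-1/2}`, where `q_{s'_i} = q^{λ*(i)}`. -/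
def Labels.cStar (κ : Labels D) (i : ι) : ℂ :=
  ((κ.q ^ (κ.lamStar i / 2) - κ.q ^ (-(κ.lamStar i / 2)) : ℝ) : ℂ)

/-- The basis element `θ_x` of the group algebra `ℂ[X]`. -/
def lat (x : X) : AddMonoidAlgebra ℂ X := AddMonoidAlgebra.single x 1

/-- The generator `N_w` of the free algebra. -/
def freeN (w : D.weylGroup) : FreeAlgebra ℂ (D.weylGroup ⊕ X) := FreeAlgebra.ι ℂ (Sum.inl w)

/-- The generator `θ_x` of the free algebra. -/
def freeTheta (D : RootPairing ι ℤ X Y) (x : X) : FreeAlgebra ℂ (D.weylGroup ⊕ X) :=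
  FreeAlgebra.ι ℂ (Sum.inr x)

/-- The linear extension of `freeTheta` to `ℂ[X]`. -/
def freeLift (D : RootPairing ι ℤ X Y) (f : AddMonoidAlgebra ℂ X) :
    FreeAlgebra ℂ (D.weylGroup ⊕ X) :=
  f.coeff.sum fun x a => a • freeTheta D x

/-- The defining relations of the affine Hecke algebra (Bernstein presentation): the `N_w` multiply
as in the Iwahori--Hecke algebra of `W`, the `θ_x` multiply as in `ℂ[X]`, and for a simple root `α`
`θ_x N_s - N_s θ_{s(x)} = (c + θ_{-α} c*) (θ_x - θ_{s(x)}) / (1 - θ_{-2α})`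
with `s = s_α`. The fraction is the (unique) element of `ℂ[X]` that gives the numerator upon
multiplication with `1 - θ_{-2α}`. -/
inductive Rel (b : D.Base) (κ : Labels D) :
    FreeAlgebra ℂ (D.weylGroup ⊕ X) → FreeAlgebra ℂ (D.weylGroup ⊕ X) → Prop
  | N_one : Rel b κ (freeN 1) 1
  | N_up (w : D.weylGroup) (i : ι) (hi : i ∈ b.support)
      (h : len b (w * refl D i) = len b w + 1) :
      Rel b κ (freeN w * freeN (refl D i)) (freeN (w * refl D i))
  | N_down (w : D.weylGroup) (i : ι) (hi : i ∈ b.support)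
      (h : len b (w * refl D i) + 1 = len b w) :
      Rel b κ (freeN w * freeN (refl D i)) (freeN (w * refl D i) + κ.c i • freeN w)
  | theta_zero : Rel b κ (freeTheta D 0) 1
  | theta_add (x y : X) : Rel b κ (freeTheta D x * freeTheta D y) (freeTheta D (x + y))
  | cross (i : ι) (hi : i ∈ b.support) (x : X) (f : AddMonoidAlgebra ℂ X)
      (hf : f * (1 - lat (-((2 : ℤ) • D.root i)))
        = (κ.c i • 1 + κ.cStar i • lat (-D.root i)) * (lat x - lat (refl D i • x))) :
      Rel b κ (freeTheta D x * freeN (refl D i))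
        (freeN (refl D i) * freeTheta D (refl D i • x) + freeLift D f)

/-- The affine Hecke algebra `𝓗 = 𝓗(𝓡, λ, λ*, q)`. -/
abbrev Hecke (b : D.Base) (κ : Labels D) : Type u := RingQuot (Rel b κ)

variable (b : D.Base) (κ : Labels D)

/-- The element `N_w` of `𝓗`, for `w ∈ W`. -/
def N (w : D.weylGroup) : Hecke b κ := RingQuot.mkAlgHom ℂ (Rel b κ) (freeN w)

/-- The element `θ_x` of `𝓗`, for `x ∈ X`. -/
def theta (x : X) : Hecke b κ := RingQuot.mkAlgHom ℂ (Rel b κ) (freeTheta D x)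

/-- The parabolic subalgebra `𝓗^P`, generated by the `θ_x` with `x ∈ X` and the `N_w` with
`w ∈ W_P`. -/
def parabolic (P : Set ι) : Subalgebra ℂ (Hecke b κ) :=
  Algebra.adjoin ℂ (Set.range (theta b κ) ∪ N b κ '' parabolicWeyl D P)

theorem N_mul_theta_mem {P : Set ι} {w : D.weylGroup} (hw : w ∈ parabolicWeyl D P) (x : X) :
    N b κ w * theta b κ x ∈ parabolic b κ P :=
  mul_mem (Algebra.subset_adjoin (Or.inr ⟨w, hw, rfl⟩))
    (Algebra.subset_adjoin (Or.inl ⟨x, rfl⟩))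

end Hecke

/-! ### Twisted crossed products -/

/-- A 2-cocycle `Γ × Γ → ℂˣ` (for the trivial action of `Γ` on `ℂˣ`). -/
structure Cocycle (Γ : Type u) [Group Γ] where
  val : Γ → Γ → ℂˣ
  cocycle : ∀ a b c : Γ, val a b * val (a * b) c = val b c * val a (b * c)

/-- The underlying space of the crossed product `A ⋊ ℂ[Γ, ♮]`: the function `f` represents
`∑ γ, f γ N_γ`. -/
@[ext] structure Crossed {A Γ : Type u} [Ring A] [Algebra ℂ A] [Group Γ]
    (act : Γ →* (A ≃ₐ[ℂ] A)) (κ : Cocycle Γ) where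
  coeff : Γ → A

namespace Crossed

variable {A Γ : Type u} [Ring A] [Algebra ℂ A] [Group Γ]
  {act : Γ →* (A ≃ₐ[ℂ] A)} {κ : Cocycle Γ}

theorem _root_.SecondAdj.Cocycle.one_left (κ : Cocycle Γ) (c : Γ) : κ.val 1 c = κ.val 1 1 := by
  have h := κ.cocycle 1 1 c
  simp only [one_mul] at h
  exact (mul_right_cancel h).symm

theorem _root_.SecondAdj.Cocycle.one_right (κ : Cocycle Γ) (a : Γ) : κ.val a 1 = κ.val 1 1 := by
  have h := κ.cocycle a 1 1
  simp only [mul_one] at h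
  exact mul_right_cancel h

instance : Zero (Crossed act κ) := ⟨⟨0⟩⟩
instance : Add (Crossed act κ) := ⟨fun f g => ⟨f.coeff + g.coeff⟩⟩
instance : Neg (Crossed act κ) := ⟨fun f => ⟨-f.coeff⟩⟩
instance : Sub (Crossed act κ) := ⟨fun f g => ⟨f.coeff - g.coeff⟩⟩
instance : SMul ℕ (Crossed act κ) := ⟨fun n f => ⟨n • f.coeff⟩⟩
instance : SMul ℤ (Crossed act κ) := ⟨fun n f => ⟨n • f.coeff⟩⟩
instance : SMul ℂ (Crossed act κ) := ⟨fun z f => ⟨z • f.coeff⟩⟩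

instance : AddCommGroup (Crossed act κ) :=
  Function.Injective.addCommGroup (M₂ := Γ → A) Crossed.coeff (fun _ _ h => Crossed.ext h)
    rfl (fun _ _ => rfl) (fun _ => rfl) (fun _ _ => rfl) (fun _ _ => rfl) (fun _ _ => rfl)

@[simp] theorem coeff_zero : (0 : Crossed act κ).coeff = 0 := rfl
@[simp] theorem coeff_add (f g : Crossed act κ) : (f + g).coeff = f.coeff + g.coeff := rfl
@[simp] theorem coeff_smul (z : ℂ) (f : Crossed act κ) : (z • f).coeff = z • f.coeff := rfl

/-- The element `a N_γ`. -/
def single (act : Γ →* (A ≃ₐ[ℂ] A)) (κ : Cocycle Γ) (γ : Γ) (a : A) : Crossed act κ :=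
  open Classical in ⟨Pi.single γ a⟩

/-- The element `N_γ`. -/
def Ngamma (act : Γ →* (A ≃ₐ[ℂ] A)) (κ : Cocycle Γ) (γ : Γ) : Crossed act κ := single act κ γ 1

/-- The inclusion of `A`. Note that the unit of `ℂ[Γ, ♮]` is `♮(1,1)⁻¹ N_1`. -/
def incl (act : Γ →* (A ≃ₐ[ℂ] A)) (κ : Cocycle Γ) (a : A) : Crossed act κ :=
  single act κ 1 (((κ.val 1 1)⁻¹ : ℂˣ).val • a)

instance : One (Crossed act κ) := ⟨incl act κ 1⟩

theorem one_def : (1 : Crossed act κ) = incl act κ 1 := rfl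

instance : Module ℂ (Crossed act κ) where
  one_smul f := by ext; simp
  mul_smul a b f := by ext; simp [mul_smul]
  smul_zero a := by ext; simp
  smul_add a f g := by ext; simp
  add_smul a b f := by ext; simp [add_smul]
  zero_smul f := by ext; simp

variable [Fintype Γ]

/-- The product that satisfies `a N_γ * a' N_γ' = a γ(a') ♮(γ, γ') N_(γ γ')`. -/
instance : Mul (Crossed act κ) :=
  ⟨fun f g => ⟨fun γ => ∑ δ : Γ, (κ.val δ (δ⁻¹ * γ)).val • (f.coeff δ * act δ (g.coeff (δ⁻¹ * γ)))⟩⟩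

theorem coeff_mul (f g : Crossed act κ) (γ : Γ) : (f * g).coeff γ =
    ∑ δ : Γ, (κ.val δ (δ⁻¹ * γ)).val • (f.coeff δ * act δ (g.coeff (δ⁻¹ * γ))) := rfl

theorem one_mul' (f : Crossed act κ) : 1 * f = f := by
  classical
  ext γ
  rw [coeff_mul, Finset.sum_eq_single 1]
  · simp [one_def, incl, single, Cocycle.one_left κ γ, smul_smul]
  · intro δ _ hδ
    simp [one_def, incl, single, hδ]
  · simp

theorem mul_one' (f : Crossed act κ) : f * 1 = f := by
  classical
  ext γ
  rw [coeff_mul, Finset.sum_eq_single γ]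
  · simp [one_def, incl, single, Cocycle.one_right κ γ, smul_smul]
  · intro δ _ hδ
    have : δ⁻¹ * γ ≠ 1 := fun h => hδ (inv_mul_eq_one.mp h)
    simp [one_def, incl, single, this]
  · simp

theorem mul_assoc' (f g h : Crossed act κ) : f * g * h = f * (g * h) := by
  ext γ
  simp only [coeff_mul, Finset.sum_mul, map_sum, Finset.mul_sum, Finset.smul_sum]
  rw [Finset.sum_comm]
  refine Finset.sum_congr rfl fun δ _ => ?_
  rw [← Equiv.sum_comp (Equiv.mulLeft δ)]
  refine Finset.sum_congr rfl fun η _ => ?_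
  have h1 : δ⁻¹ * (δ * η) = η := by group
  have h2 : η⁻¹ * (δ⁻¹ * γ) = (δ * η)⁻¹ * γ := by group
  have h3 : η * ((δ * η)⁻¹ * γ) = δ⁻¹ * γ := by group
  have hc := κ.cocycle δ η ((δ * η)⁻¹ * γ)
  rw [h3] at hc
  simp only [Equiv.coe_mulLeft, h1, h2, map_mul, map_smul, smul_mul_assoc, mul_smul_comm, smul_smul,
    AlgEquiv.mul_apply, mul_assoc]
  congr 1
  rw [← Units.val_mul, ← Units.val_mul, mul_comm (κ.val (δ * η) _), hc, mul_comm]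

instance : Ring (Crossed act κ) where
  __ := (inferInstance : AddCommGroup (Crossed act κ))
  one_mul := one_mul'
  mul_one := mul_one'
  mul_assoc := mul_assoc'
  left_distrib f g h := by
    ext γ
    simp [coeff_mul, mul_add, Finset.sum_add_distrib]
  right_distrib f g h := by
    ext γ
    simp [coeff_mul, add_mul, Finset.sum_add_distrib]
  zero_mul f := by
    ext γ
    simp [coeff_mul]
  mul_zero f := by
    ext γ
    simp [coeff_mul]

instance : Algebra ℂ (Crossed act κ) :=
  Algebra.ofModule
    (fun z f g => by
      ext γ
      simp only [coeff_mul, coeff_smul, Pi.smul_apply, Finset.smul_sum, smul_mul_assoc]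
      exact Finset.sum_congr rfl fun δ _ => smul_comm _ _ _)
    (fun z f g => by
      ext γ
      simp only [coeff_mul, coeff_smul, Pi.smul_apply, Finset.smul_sum, mul_smul_comm, map_smul]
      exact Finset.sum_congr rfl fun δ _ => smul_comm _ _ _)

end Crossed

/-! ### Finite groups acting on an affine Hecke algebra -/

section Extended

variable {ι X Y : Type u} [AddCommGroup X] [AddCommGroup Y] {D : RootPairing ι ℤ X Y}

/-- The torus `T = Hom(X, ℂˣ)`. -/
abbrev Torus (X : Type u) [AddCommGroup X] : Type u := Multiplicative X →* ℂˣ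

/-- An action of a finite group `Γ` on an affine Hecke algebra that preserves all the structure:
`Γ` acts on the based root datum and on `𝓗`, by algebra automorphisms with
`γ(N_w) = N_{γ(w)}` and `γ(θ_x) = z_γ(x) θ_{γ(x)}`, where `z_γ ∈ T`. -/
structure Extension (b : D.Base) (κ : Labels D) (Γ : Type u) [Group Γ] where
  toAut : Γ →* D.Aut
  map_base : ∀ (γ : Γ), ∀ i ∈ b.support, toAut γ • i ∈ b.support
  lam_inv : ∀ (γ : Γ) (i : ι), κ.lam (toAut γ • i) = κ.lam i
  lamStar_inv : ∀ (γ : Γ) (i : ι), κ.lamStar (toAut γ • i) = κ.lamStar i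
  z : Γ → Torus X
  act : Γ →* (Hecke b κ ≃ₐ[ℂ] Hecke b κ)
  act_N : ∀ (γ : Γ) (w : D.weylGroup),
    act γ (N b κ w) = N b κ (MulAut.conjNormal (toAut γ) w)
  act_theta : ∀ (γ : Γ) (x : X),
    act γ (theta b κ x) = (z γ (Multiplicative.ofAdd x)).val • theta b κ (toAut γ • x)

variable {b : D.Base} {κ : Labels D} {Γ : Type u} [Group Γ]

/-- The conjugation action of `Γ` on `W`. -/
def Extension.conj (E : Extension b κ Γ) : Γ →* MulAut D.weylGroup :=
  MulAut.conjNormal.comp E.toAut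

/-- The group `W ⋊ Γ`. -/
abbrev Extension.WGamma (E : Extension b κ Γ) : Type u := D.weylGroup ⋊[E.conj] Γ

/-- The action of `W ⋊ Γ` on the root datum. -/
def Extension.aut (E : Extension b κ Γ) (g : E.WGamma) : D.Aut := g.left.val * E.toAut g.right

/-- The action of `Γ` on `T`, regarded as the space of characters of `ℂ[X]`:
`(γ t)(θ_x) = t(γ⁻¹(θ_x))`. -/
def Extension.torusAct (E : Extension b κ Γ) (γ : Γ) (t : Torus X) : Torus X :=
  E.z γ⁻¹ * t.comp
    (AddMonoidHom.toMultiplicative (DistribSMul.toAddMonoidHom X (E.toAut γ⁻¹)))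

/-- The subtorus `T^P = Hom(X / X ∩ ℚP, ℂˣ)` of `T`. -/
def torusUpper (D : RootPairing ι ℤ X Y) (P : Set ι) : Set (Torus X) :=
  {t | ∀ x : X, (∃ n : ℤ, n ≠ 0 ∧ n • x ∈ AddSubgroup.closure (D.root '' P)) →
    t (Multiplicative.ofAdd x) = 1}

/-- The subtorus `T_P = Hom(X / (P^∨)^⊥, ℂˣ)` of `T`. -/
def torusLower (D : RootPairing ι ℤ X Y) (P : Set ι) : Set (Torus X) :=
  {t | ∀ x : X, (∀ i ∈ P, D.toLinearMap x (D.coroot i) = 0) → t (Multiplicative.ofAdd x) = 1}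

/-- A family of subgroups `Γ_P ⊆ Γ`, for `P ⊆ Δ`, suitable for parabolic subalgebras of
`𝓗 ⋊ ℂ[Γ, ♮]`. -/
structure ParabolicFamily (E : Extension b κ Γ) (c : Cocycle Γ) where
  sub : Set ι → Subgroup Γ
  mono : ∀ P Q : Set ι, P ⊆ Q → Q ⊆ b.support → sub P ≤ sub Q
  stab : ∀ P : Set ι, P ⊆ b.support → ∀ γ ∈ sub P,
    (fun i => E.toAut γ • i) '' P = P ∧
    E.torusAct γ '' torusLower D P = torusLower D P ∧
    E.torusAct γ '' torusUpper D P = torusUpper D P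
  torus : ∀ P : Set ι, P ⊆ b.support → ∀ γ ∈ sub P,
    ∃ s ∈ torusLower D P ∩ torusUpper D P, ∀ t ∈ torusUpper D P, E.torusAct γ t = s * t
  conj : ∀ (g : E.WGamma) (P : Set ι), P ⊆ b.support →
    (fun i => E.aut g • i) '' P ⊆ b.support →
    ((sub P).map (SemidirectProduct.inr : Γ →* E.WGamma)).map (MulAut.conj g).toMonoidHom
      = (sub ((fun i => E.aut g • i) '' P)).map (SemidirectProduct.inr : Γ →* E.WGamma)
  trivial : ∀ γ ∈ sub ∅, ∀ γ' ∈ sub ∅, c.val γ γ' = 1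

variable [Fintype Γ]

/-- The twisted affine Hecke algebra `𝓗 ⋊ ℂ[Γ, ♮]`. -/
abbrev THecke (E : Extension b κ Γ) (c : Cocycle Γ) : Type u := Crossed E.act c

/-- The element `N_g` of `𝓗 ⋊ ℂ[Γ, ♮]` for `g ∈ W ⋊ Γ`, so `N_(w γ) = N_w N_γ`. -/
def tN (E : Extension b κ Γ) (c : Cocycle Γ) (g : E.WGamma) : THecke E c :=
  Crossed.incl E.act c (N b κ g.left) * Crossed.Ngamma E.act c g.right

/-- The element `θ_x` of `𝓗 ⋊ ℂ[Γ, ♮]`. -/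
def ttheta (E : Extension b κ Γ) (c : Cocycle Γ) (x : X) : THecke E c :=
  Crossed.incl E.act c (theta b κ x)

/-- The parabolic subalgebra `𝓗^P ⋊ ℂ[Γ_P, ♮]`, generated by `𝓗^P` and the `N_γ` with
`γ ∈ Γ_P`. -/
def tparabolic (E : Extension b κ Γ) {c : Cocycle Γ} (F : ParabolicFamily E c) (P : Set ι) :
    Subalgebra ℂ (THecke E c) :=
  Algebra.adjoin ℂ (Crossed.incl E.act c '' (parabolic b κ P) ∪
    Crossed.Ngamma E.act c '' (F.sub P))

theorem tN_mul_ttheta_mem (E : Extension b κ Γ) {c : Cocycle Γ} (F : ParabolicFamily E c)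
    {P : Set ι} {g : E.WGamma} (hw : g.left ∈ parabolicWeyl D P) (hγ : g.right ∈ F.sub P) (x : X) :
    tN E c g * ttheta E c x ∈ tparabolic E F P :=
  mul_mem
    (mul_mem
      (Algebra.subset_adjoin (Or.inl ⟨_, Algebra.subset_adjoin (Or.inr ⟨_, hw, rfl⟩), rfl⟩))
      (Algebra.subset_adjoin (Or.inr ⟨_, hγ, rfl⟩)))
    (Algebra.subset_adjoin (Or.inl ⟨_, Algebra.subset_adjoin (Or.inl ⟨x, rfl⟩), rfl⟩))

end Extended

/-! ### Restriction and induction -/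

section Induction

variable {A : Type u} [Ring A] [Algebra ℂ A]

/-- Restriction of modules from `A` to a subalgebra `B`. -/
abbrev Res (B : Subalgebra ℂ A) : ModuleCat.{max u v} A ⥤ ModuleCat.{max u v} B :=
  ModuleCat.restrictScalars (B.val : B →+* A)

/-- The pullback functor `ψ^* : ρ ↦ ρ ∘ ψ` along an isomorphism between subalgebras. -/
abbrev pull {B C : Subalgebra ℂ A} (ψ : B ≃ₐ[ℂ] C) :
    ModuleCat.{max u v} C ⥤ ModuleCat.{max u v} B :=
  ModuleCat.restrictScalars (ψ : B →+* C)

/-- The `A`-submodule of `A ⊗_ℤ V` generated by the elements `a b ⊗ m - a ⊗ b m`. -/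
def balanced (B : Subalgebra ℂ A) (V : Type (max u v)) [AddCommGroup V] [Module B V] :
    Submodule A (A ⊗[ℤ] V) :=
  Submodule.span A {t | ∃ (a : A) (x : B) (m : V), t = (a * (x : A)) ⊗ₜ[ℤ] m - a ⊗ₜ[ℤ] (x • m)}

/-- The `A`-module `A ⊗_B V`. -/
abbrev IndObj (B : Subalgebra ℂ A) (V : Type (max u v)) [AddCommGroup V] [Module B V] :
    Type (max u v) := (A ⊗[ℤ] V) ⧸ balanced.{u, v} B V

/-- The map `A ⊗_B V → A ⊗_B V'`, `a ⊗ m ↦ a ⊗ f m`. -/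
def indMap (B : Subalgebra ℂ A) {V V' : Type (max u v)} [AddCommGroup V] [Module B V]
    [AddCommGroup V'] [Module B V'] (f : V →ₗ[B] V') :
    IndObj.{u, v} B V →ₗ[A] IndObj.{u, v} B V' :=
  Submodule.mapQ _ _
    (TensorProduct.AlgebraTensorModule.map LinearMap.id (f.toAddMonoidHom.toIntLinearMap)) (by
      refine Submodule.span_le.mpr ?_
      rintro _ ⟨a, x, m, rfl⟩
      refine Submodule.subset_span ⟨a, x, f m, ?_⟩
      simp)

theorem indMap_id (B : Subalgebra ℂ A) (V : Type (max u v)) [AddCommGroup V] [Module B V] :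
    indMap.{u, v} B (LinearMap.id : V →ₗ[B] V) = LinearMap.id := by
  refine LinearMap.ext fun t => ?_
  induction t using Submodule.Quotient.induction_on with
  | _ t =>
    induction t using TensorProduct.induction_on with
    | zero => simp
    | tmul a m => rfl
    | add s t hs ht => simp only [Submodule.Quotient.mk_add, map_add, hs, ht]

theorem indMap_comp (B : Subalgebra ℂ A) {V V' V'' : Type (max u v)} [AddCommGroup V] [Module B V]
    [AddCommGroup V'] [Module B V'] [AddCommGroup V''] [Module B V'']
    (f : V →ₗ[B] V') (g : V' →ₗ[B] V'') :
    indMap.{u, v} B (g ∘ₗ f) = indMap.{u, v} B g ∘ₗ indMap.{u, v} B f := by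
  refine LinearMap.ext fun t => ?_
  induction t using Submodule.Quotient.induction_on with
  | _ t =>
    induction t using TensorProduct.induction_on with
    | zero => simp
    | tmul a m => rfl
    | add s t hs ht => simp only [Submodule.Quotient.mk_add, map_add, hs, ht]

/-- The induction functor `ind_B^A : V ↦ A ⊗_B V`. -/
def Induce (B : Subalgebra ℂ A) : ModuleCat.{max u v} B ⥤ ModuleCat.{max u v} A where
  obj V := ModuleCat.of A (IndObj.{u, v} B V)
  map f := ModuleCat.ofHom (indMap.{u, v} B f.hom)
  map_id V := by
    rw [← ModuleCat.ofHom_id]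
    congr 1
    exact indMap_id B V
  map_comp f g := by
    rw [← ModuleCat.ofHom_comp]
    congr 1
    exact indMap_comp B f.hom g.hom

end Induction

end SecondAdj

end

open SecondAdj

noncomputable section

namespace SecondAdj

set_option linter.unusedSectionVars false

/-! ### Action of the Weyl group on roots, heights and positivity -/

section WeylCombinatorics

variable {ι X Y : Type u} [AddCommGroup X] [AddCommGroup Y] {D : RootPairing ι ℤ X Y}

/-! Let `d = w_P w_Δ`, the longest of the minimal length representatives of `W_P \ W`. Its inverse
maps `P` bijectively to `P^op`. As a left `𝓗^P`-module, `𝓗` has as basis the `N_v` with `v` of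
minimal length in `W_P v`. Let `E : 𝓗 → 𝓗^P` (`topCoeff`) take the coefficient of `N_d`. It is left
`𝓗^P`-linear (`topCoeff_mul_left`). Because `d` is the longest representative, the correction terms
that arise when a basis element is moved past `θ_x` are too short to be seen by `E`; and `d s_j =
s_{d j} d` for `j ∈ P^op`. Hence `E` is also right linear over `𝓗^{P^op}`, up to transport: `E(a c)
= E(a) E(N_d c)` (`topCoeff_mul_right`). The map `c ↦ E(N_d c)` is the inverse of `ψ`, so the
isomorphism is a by-product.

The form `(a, a') ↦ E(a a')` is perfect. Since `N_v N_u` equals `N_{vu}` up to shorter terms, the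
matrix of the `E(N_v N_{e⁻¹d})` is unitriangular for the length (`topCoeff_gram_self`,
`topCoeff_gram_eq_zero`), and its inverse provides dual families `x_i`, `y_i` (`exists_dual_basis`).
So `𝓗` is a Frobenius extension twisted by `ψ` (`FrobeniusData`). From there the adjunction (b) is
formal: the counit is `a ⊗ w ↦ E(a) w`, the unit is `m ↦ ∑ x_i ⊗ y_i m`, and the triangle identities
are the two dual basis identities. Statement (a) is (b) for the opposite pair, composed with the
equivalence of categories induced by `ψ`.

All of this needs the `θ_x N_w` to be a basis of `𝓗`, which the presentation does not provide.
Independence is obtained by letting `𝓗` act on the free `ℂ[X]`-module with basis `W` (`exists_rep`).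
The hard point is that the operators of the `N_s` satisfy the braid relations. This is checked in
each rank two type (`leftOp_braid`); then the theorem of Matsumoto defines the operators of all
`N_w`.

For the twisted version, `Γ_P = Γ_{P^op}` fixes `d`, so `E` and `ψ` commute with `Γ_P` and extend
coefficientwise to the crossed products. The dual families are multiplied by the `N_γ` and averaged
(`FrobeniusData.crossed`). -/

theorem root_smul (w : D.weylGroup) (i : ι) : D.root (w • i) = w • D.root i :=
  RootPairing.Equiv.root_indexEquiv_eq_smul D i w.val

theorem smul_zsmul' (w : D.weylGroup) (n : ℤ) (x : X) : w • (n • x) = n • (w • x) :=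
  smul_comm w.val n x

theorem refl_smul (i : ι) (x : X) :
    refl D i • x = x - D.toLinearMap x (D.coroot i) • D.root i := by
  change RootPairing.Equiv.reflection D i • x = _
  rw [RootPairing.Equiv.reflection_smul, RootPairing.reflection_apply]; rfl

theorem weyl_ext {w w' : D.weylGroup} (h : ∀ x : X, w • x = w' • x) : w = w' := by
  apply Subtype.ext
  apply RootPairing.Equiv.weightHom_injective D
  ext x
  exact h x

theorem refl_mul_self (i : ι) : refl D i * refl D i = 1 := by
  apply weyl_ext
  intro x
  rw [mul_smul, one_smul, refl_smul, refl_smul]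
  simp only [map_sub, LinearMap.sub_apply, map_smul, LinearMap.smul_apply,
    RootPairing.root_coroot_two, smul_eq_mul]
  module

theorem refl_inv (i : ι) : (refl D i)⁻¹ = refl D i :=
  inv_eq_of_mul_eq_one_left (refl_mul_self i)

theorem refl_smul_smul {S : Type*} [MulAction D.weylGroup S] (i : ι) (x : S) :
    refl D i • refl D i • x = x := by
  rw [← mul_smul, refl_mul_self, one_smul]

theorem mul_refl_mul_refl (w : D.weylGroup) (i : ι) : w * refl D i * refl D i = w := by
  rw [mul_assoc, refl_mul_self, mul_one]

theorem refl_mul_refl_mul (w : D.weylGroup) (i : ι) : refl D i * (refl D i * w) = w := by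
  rw [← mul_assoc, refl_mul_self, one_mul]

theorem pairing_aut_smul (g : D.Aut) (x : X) (i : ι) :
    D.toLinearMap (g • x) (D.coroot (g • i)) = D.toLinearMap x (D.coroot i) := by
  have h1 : D.coroot i = g.toHom.coweightMap (D.coroot (g • i)) := by
    have := congr_fun g.toHom.coroot_coweightMap (g • i)
    simp only [Function.comp_apply] at this
    rw [this]
    congr 1
    exact (g.toHom.indexEquiv.symm_apply_apply i).symm
  rw [h1]
  have h2 := LinearMap.ext_iff₂.mp g.toHom.weight_coweight_transpose (D.coroot (g • i)) x
  exact (by simpa using h2.symm :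
    D.toLinearMap x (g.toHom.coweightMap (D.coroot (g • i)))
      = D.toLinearMap (g.toHom.weightMap x) (D.coroot (g • i))).symm

theorem pairing_smul_smul (w : D.weylGroup) (x : X) (i : ι) :
    D.toLinearMap (w • x) (D.coroot (w • i)) = D.toLinearMap x (D.coroot i) :=
  pairing_aut_smul w.val x i

theorem refl_conj (w : D.weylGroup) (i : ι) : w * refl D i * w⁻¹ = refl D (w • i) := by
  rw [mul_inv_eq_iff_eq_mul]
  apply weyl_ext
  intro x
  rw [mul_smul, mul_smul, refl_smul, refl_smul, pairing_smul_smul, root_smul, smul_sub,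
    smul_zsmul']

theorem mul_refl_eq (w : D.weylGroup) (i : ι) : w * refl D i = refl D (w • i) * w := by
  rw [← refl_conj, inv_mul_cancel_right]

theorem refl_smul_self (i : ι) : D.root (refl D i • i) = -D.root i := by
  rw [root_smul, refl_smul, RootPairing.root_coroot_two]; module

theorem root_injective : Function.Injective D.root := D.root.injective

theorem refl_eq_of_root_neg {i j : ι} (h : D.root i = -D.root j) : refl D i = refl D j := by
  have : i = refl D j • j := root_injective (by rw [h, refl_smul_self])
  subst this
  rw [← refl_conj, mul_inv_cancel_right]

variable (b : D.Base)

/-- Expanding every root in simple roots shows that the height respects integral linear relations.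
Questions about positivity of roots thereby become inequalities between integers. -/
theorem height_eq_linear {k : ι} (s : Finset ι) (f : ι → ℤ) (g : ι → ι)
    (h : D.root k = ∑ j ∈ s, f j • D.root (g j)) :
    b.height k = ∑ j ∈ s, f j * b.height (g j) := by
  classical
  choose c hc0 hc1 hc2 using b.exists_root_eq_sum_int
  have : D.root k = ∑ l ∈ b.support, (∑ j ∈ s, f j * c (g j) l) • D.root l := by
    rw [h]
    simp_rw [Finset.sum_smul]
    rw [Finset.sum_comm]
    refine Finset.sum_congr rfl fun j _ => ?_
    rw [hc2 (g j)]
    simp_rw [Finset.smul_sum, mul_smul]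
  rw [RootPairing.Base.height_eq_sum this, Finset.sum_comm]
  refine Finset.sum_congr rfl fun j _ => ?_
  rw [RootPairing.Base.height_eq_sum (hc2 (g j)), Finset.mul_sum]

theorem height_comb {i j k : ι} (m n : ℤ) (h : D.root k = m • D.root i + n • D.root j) :
    b.height k = m * b.height i + n * b.height j := by
  classical
  by_cases hij : i = j
  · subst hij
    have := height_eq_linear b {i} (fun _ => m + n) id (by rw [h]; simp; module)
    rw [this]; simp; ring
  · have := height_eq_linear b {i, j} (fun l => if l = i then m else n) id
      (by rw [h, Finset.sum_pair hij]; simp [Ne.symm hij])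
    rw [this, Finset.sum_pair hij]; simp [Ne.symm hij]

variable {b}

theorem isPos_comb {i j k : ι} (hi : b.IsPos i) (hj : b.IsPos j) {m n : ℤ} (hm : 0 ≤ m)
    (hn : 0 ≤ n) (h : D.root k = m • D.root i + n • D.root j) : b.IsPos k := by
  rw [RootPairing.Base.isPos_iff', height_comb b m n h]
  rw [RootPairing.Base.isPos_iff] at hi hj
  positivity

theorem isPos_neg_iff {i j : ι} (h : D.root i = -D.root j) : b.IsPos i ↔ ¬ b.IsPos j := by
  have := height_comb b (i := j) (j := j) (-1) 0 (k := i) (by rw [h]; module)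
  have h2 := b.height_ne_zero j
  rw [RootPairing.Base.isPos_iff, RootPairing.Base.isPos_iff, this]
  omega

theorem isPos_smul_neg_iff (w : D.weylGroup) {i j : ι} (h : D.root i = -D.root j) :
    b.IsPos (w • i) ↔ ¬ b.IsPos (w • j) :=
  isPos_neg_iff (by rw [root_smul, root_smul, h, smul_neg])

/-- The index of the negative of a root. -/
def negIdx (i : ι) : ι := refl D i • i

theorem root_negIdx (i : ι) : D.root (negIdx (D := D) i) = -D.root i := refl_smul_self i

theorem eq_negIdx {i j : ι} (h : D.root i = -D.root j) : i = negIdx (D := D) j :=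
  root_injective (by rw [h, root_negIdx])

theorem negIdx_negIdx (i : ι) : negIdx (D := D) (negIdx (D := D) i) = i :=
  root_injective (by rw [root_negIdx, root_negIdx, neg_neg])

theorem negIdx_smul (w : D.weylGroup) (i : ι) :
    w • negIdx (D := D) i = negIdx (D := D) (w • i) :=
  eq_negIdx (by rw [root_smul, root_smul, root_negIdx, smul_neg])

theorem isPos_negIdx {i : ι} : b.IsPos (negIdx (D := D) i) ↔ ¬ b.IsPos i :=
  isPos_neg_iff (root_negIdx i)

theorem isPos_of_mem {i : ι} (hi : i ∈ b.support) : b.IsPos i :=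
  RootPairing.Base.isPos_of_mem_support hi

theorem len_one : len b (1 : D.weylGroup) = 0 := by
  simp [len]

theorem len_inv (w : D.weylGroup) : len b w⁻¹ = len b w := by
  unfold len
  -- `i ↦ -(w i)` is a bijection from the inversions of `w` to those of `w⁻¹`.
  have : {i : ι | b.IsPos i ∧ ¬ b.IsPos (w⁻¹ • i)}
      = (fun i => negIdx (D := D) (w • i)) '' {i : ι | b.IsPos i ∧ ¬ b.IsPos (w • i)} := by
    ext j
    constructor
    · rintro ⟨h1, h2⟩
      refine ⟨negIdx (D := D) (w⁻¹ • j), ⟨isPos_negIdx.mpr h2, ?_⟩, ?_⟩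
      · rw [negIdx_smul, smul_inv_smul, isPos_negIdx]; simpa using h1
      · simp only [negIdx_smul, smul_inv_smul, negIdx_negIdx]
    · rintro ⟨i, ⟨h1, h2⟩, rfl⟩
      refine ⟨isPos_negIdx.mpr h2, ?_⟩
      rw [negIdx_smul, inv_smul_smul, isPos_negIdx]; simpa using h1
  rw [this, Set.ncard_image_of_injective]
  intro i j h
  have := congrArg (negIdx (D := D)) h
  simp only [negIdx_negIdx] at this
  exact MulAction.injective w this

theorem isPos_mul_refl_smul {w : D.weylGroup} {i : ι} :
    b.IsPos ((w * refl D i) • i) ↔ ¬ b.IsPos (w • i) := by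
  rw [mul_smul, isPos_smul_neg_iff w (refl_smul_self i)]

/-- The product of the reflections in a list of roots. -/
def wd (D : RootPairing ι ℤ X Y) (l : List ι) : D.weylGroup := (l.map (refl D)).prod

@[simp] theorem wd_nil : wd D [] = 1 := rfl

@[simp] theorem wd_cons (i : ι) (l : List ι) : wd D (i :: l) = refl D i * wd D l := by
  simp [wd]

@[simp] theorem wd_append (l l' : List ι) : wd D (l ++ l') = wd D l * wd D l' := by
  simp [wd]

theorem refl_mem_parabolic {P : Set ι} {i : ι} (hi : i ∈ P) : refl D i ∈ parabolicWeyl D P :=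
  Subgroup.subset_closure ⟨i, hi, rfl⟩

theorem parabolic_smul_sub_mem {P : Set ι} {w : D.weylGroup}
    (hw : w ∈ parabolicWeyl D P) (x : X) : w • x - x ∈ Submodule.span ℤ (D.root '' P) := by
  induction hw using Subgroup.closure_induction_left generalizing x with
  | one => simp
  | mul_left w hw v hv ih =>
    obtain ⟨i, hi, rfl⟩ := hw
    rw [mul_smul, refl_smul, sub_right_comm]
    exact sub_mem (ih x) (Submodule.smul_mem _ _ (Submodule.subset_span ⟨i, hi, rfl⟩))
  | inv_mul_cancel w hw v hv ih =>
    obtain ⟨i, hi, rfl⟩ := hw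
    rw [refl_inv, mul_smul, refl_smul, sub_right_comm]
    exact sub_mem (ih x) (Submodule.smul_mem _ _ (Submodule.subset_span ⟨i, hi, rfl⟩))

theorem parabolic_smul_root_mem {P : Set ι} {w : D.weylGroup}
    (hw : w ∈ parabolicWeyl D P) {i : ι} (hi : i ∈ P) :
    D.root (w • i) ∈ Submodule.span ℤ (D.root '' P) := by
  have := add_mem (parabolic_smul_sub_mem hw (D.root i))
    (Submodule.subset_span (R := ℤ) (Set.mem_image_of_mem D.root hi))
  rwa [sub_add_cancel, ← root_smul] at this

/-! ### Lengths, reduced words and parabolic subgroups -/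

variable [Finite ι] [D.IsReduced]

theorem isPos_refl_smul {i j : ι} (hi : i ∈ b.support) (hj : b.IsPos j)
    (hne : j ≠ i) : b.IsPos (refl D i • j) := hj.reflectionPerm hi hne

/-- `s_i` permutes the positive roots other than `α_i`. So the inversions of `w s_i` are the
`s_i`-images of those of `w`, and `α_i` itself. -/
theorem len_mul_refl_of_pos {w : D.weylGroup} {i : ι} (hi : i ∈ b.support)
    (h : b.IsPos (w • i)) : len b (w * refl D i) = len b w + 1 := by
  unfold len
  have : {j : ι | b.IsPos j ∧ ¬ b.IsPos ((w * refl D i) • j)}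
      = insert i ((fun j => refl D i • j) '' {j : ι | b.IsPos j ∧ ¬ b.IsPos (w • j)}) := by
    ext j
    simp only [Set.mem_ofPred_eq, Set.mem_insert_iff, Set.mem_image]
    constructor
    · rintro ⟨h1, h2⟩
      by_cases hj : j = i
      · exact Or.inl hj
      · refine Or.inr ⟨refl D i • j, ⟨isPos_refl_smul hi h1 hj, ?_⟩, refl_smul_smul _ _⟩
        rwa [mul_smul] at h2
    · rintro (rfl | ⟨k, ⟨h1, h2⟩, rfl⟩)
      · refine ⟨isPos_of_mem hi, ?_⟩
        rw [mul_smul, isPos_smul_neg_iff w (refl_smul_self j)]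
        simpa using h
      · refine ⟨isPos_refl_smul hi h1 (by rintro rfl; exact h2 h), ?_⟩
        rwa [mul_smul, refl_smul_smul]
  rw [this, Set.ncard_insert_of_notMem, Set.ncard_image_of_injective _ (MulAction.injective _)]
  rintro ⟨k, ⟨h1, h2⟩, h3⟩
  have h3' : k = refl D i • i := by rw [← refl_smul_smul (D := D) i k]; exact congrArg _ h3
  rw [h3', isPos_neg_iff (refl_smul_self i)] at h1
  exact h1 (isPos_of_mem hi)

theorem len_mul_refl_of_neg {w : D.weylGroup} {i : ι} (hi : i ∈ b.support)
    (h : ¬ b.IsPos (w • i)) : len b (w * refl D i) + 1 = len b w := by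
  have := len_mul_refl_of_pos (w := w * refl D i) hi (isPos_mul_refl_smul.mpr h)
  rw [mul_refl_mul_refl] at this
  exact this.symm

theorem len_refl_mul_of_pos {w : D.weylGroup} {i : ι} (hi : i ∈ b.support)
    (h : b.IsPos (w⁻¹ • i)) : len b (refl D i * w) = len b w + 1 := by
  rw [← len_inv, mul_inv_rev, refl_inv, len_mul_refl_of_pos hi h, len_inv]

theorem len_refl_mul_of_neg {w : D.weylGroup} {i : ι} (hi : i ∈ b.support)
    (h : ¬ b.IsPos (w⁻¹ • i)) : len b (refl D i * w) + 1 = len b w := by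
  rw [← len_inv, mul_inv_rev, refl_inv, len_mul_refl_of_neg hi h, len_inv]

theorem len_mul_refl_le {w : D.weylGroup} {i : ι} (hi : i ∈ b.support) :
    len b (w * refl D i) ≤ len b w + 1 := by
  by_cases h : b.IsPos (w • i)
  · exact (len_mul_refl_of_pos hi h).le
  · have := len_mul_refl_of_neg hi h; omega

theorem len_wd_le (l : List ι) (hl : ∀ k ∈ l, k ∈ b.support) : len b (wd D l) ≤ l.length := by
  induction l using List.reverseRecOn with
  | nil => simp [len_one]
  | append_singleton l i ih =>
    have h1 := ih fun k hk => hl k (by simp [hk])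
    have h2 : len b (wd D l * refl D i) ≤ _ := len_mul_refl_le (hl i (by simp))
    simp only [wd_append, wd_cons, wd_nil, mul_one, List.length_append, List.length_singleton]
    omega

/-- The exchange condition. As the letters act one after the other, the positive root `α_i` becomes
negative at some letter `k`, and `s_k` can do this only to `α_k`. If `u` is the part of the word
after that letter, then `u α_i = α_k`, so `s_k u = u s_i`, and deleting the letter amounts to right
multiplication by `s_i`. -/
theorem exists_exchange {i : ι} (hi : i ∈ b.support) (l : List ι)
    (hl : ∀ k ∈ l, k ∈ b.support) (h : ¬ b.IsPos (wd D l • i)) :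
    ∃ l', l'.Sublist l ∧ l'.length + 1 = l.length ∧ wd D l' = wd D l * refl D i := by
  induction l with
  | nil => exact absurd (isPos_of_mem hi) (by simpa using h)
  | cons k l ih =>
    by_cases h' : b.IsPos (wd D l • i)
    · by_cases hk : wd D l • i = k
      · refine ⟨l, List.sublist_cons_self _ _, by simp, ?_⟩
        rw [wd_cons, mul_assoc, mul_refl_eq, hk, refl_mul_refl_mul]
      · exfalso
        rw [wd_cons, mul_smul] at h
        exact h (isPos_refl_smul (hl k (by simp)) h' hk)
    · obtain ⟨l', h1, h2, h3⟩ := ih (fun j hj => hl j (by simp [hj])) h'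
      refine ⟨k :: l', h1.cons_cons k, by simp [h2], ?_⟩
      rw [wd_cons, h3, wd_cons, mul_assoc]

/-- Words are only extended by letters of `P` or shortened by an exchange, so no letter outside `P`
ever enters. Hence the length in `W` is attained by words in `P`. -/
theorem exists_reduced {P : Set ι} (hP : P ⊆ b.support) {w : D.weylGroup}
    (hw : w ∈ parabolicWeyl D P) :
    ∃ l : List ι, (∀ k ∈ l, k ∈ P) ∧ wd D l = w ∧ l.length = len b w := by
  have key : ∀ (w : D.weylGroup) (i : ι), i ∈ P →
      (∃ l : List ι, (∀ k ∈ l, k ∈ P) ∧ wd D l = w ∧ l.length = len b w) →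
      (∃ l : List ι, (∀ k ∈ l, k ∈ P) ∧ wd D l = w * refl D i ∧
        l.length = len b (w * refl D i)) := by
    rintro w i hi ⟨l, h1, rfl, h3⟩
    by_cases h : b.IsPos (wd D l • i)
    · refine ⟨l ++ [i], ?_, by simp, ?_⟩
      · intro k hk
        rcases List.mem_append.mp hk with hk | hk
        · exact h1 k hk
        · rw [List.mem_singleton.mp hk]; exact hi
      · rw [len_mul_refl_of_pos (hP hi) h, ← h3]; simp
    · obtain ⟨l', h4, h5, h6⟩ := exists_exchange (hP hi) l (fun k hk => hP (h1 k hk)) h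
      refine ⟨l', fun k hk => h1 k (h4.subset hk), h6, ?_⟩
      have := len_mul_refl_of_neg (hP hi) h
      omega
  induction hw using Subgroup.closure_induction_right with
  | one => exact ⟨[], by simp, rfl, by simp [len_one]⟩
  | mul_right x hx y hy ih =>
    obtain ⟨i, hi, rfl⟩ := hy
    exact key x i hi ih
  | mul_inv_cancel x hx y hy ih =>
    obtain ⟨i, hi, rfl⟩ := hy
    rw [refl_inv]
    exact key x i hi ih

/-- Every root is reached from the simple ones by simple reflections, and `s_{w i} = w s_i w⁻¹`. -/
theorem parabolicWeyl_support (b : D.Base) : parabolicWeyl D (b.support : Set ι) = ⊤ := by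
  have h : ∀ i, refl D i ∈ parabolicWeyl D (b.support : Set ι) := by
    intro i
    refine b.induction_reflect i (p := fun i => refl D i ∈ parabolicWeyl D (b.support : Set ι))
      ?_ (fun i hi => refl_mem_parabolic hi) ?_
    · intro i hi
      have : refl D (D.reflectionPerm i i) = refl D i := refl_eq_of_root_neg (refl_smul_self i)
      rwa [this]
    · intro i j hi hj
      change refl D (refl D j • i) ∈ _
      rw [← refl_conj]
      exact mul_mem (mul_mem (refl_mem_parabolic hj) hi) (inv_mem (refl_mem_parabolic hj))
  rw [eq_top_iff]
  rintro ⟨w, hw⟩ -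
  induction hw using RootPairing.weylGroup.induction with
  | mem i => exact h i
  | one => exact one_mem _
  | mul x y hx hy h1 h2 => exact mul_mem h1 h2

theorem mem_parabolicWeyl_support (w : D.weylGroup) :
    w ∈ parabolicWeyl D (b.support : Set ι) := by
  rw [parabolicWeyl_support b]; trivial

theorem eq_one_of_len {w : D.weylGroup} (h : len b w = 0) : w = 1 := by
  obtain ⟨l, -, rfl, h3⟩ := exists_reduced (b := b) subset_rfl (mem_parabolicWeyl_support w)
  rw [h] at h3
  rw [List.length_eq_zero_iff.mp h3, wd_nil]

theorem exists_refl_of_len {P : Set ι} (hP : P ⊆ b.support) {w : D.weylGroup}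
    (hw : w ∈ parabolicWeyl D P) (h : len b w = 1) : ∃ i ∈ P, w = refl D i := by
  obtain ⟨l, h1, rfl, h3⟩ := exists_reduced hP hw
  rw [h] at h3
  obtain ⟨i, rfl⟩ := List.length_eq_one_iff.mp h3
  exact ⟨i, h1 i (by simp), by simp⟩

-- Building `w` along a reduced word ensures that each step raises the length, which is the
-- situation in which `N_w N_s = N_{ws}`.
@[elab_as_elim]
theorem parabolic_induction_right {P : Set ι} (hP : P ⊆ b.support)
    {p : (w : D.weylGroup) → w ∈ parabolicWeyl D P → Prop} (one : p 1 (one_mem _))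
    (mul : ∀ (w : D.weylGroup) (hw : w ∈ parabolicWeyl D P) (i : ι) (hi : i ∈ P),
      b.IsPos (w • i) → p w hw → p (w * refl D i) (mul_mem hw (refl_mem_parabolic hi)))
    {w : D.weylGroup} (hw : w ∈ parabolicWeyl D P) : p w hw := by
  obtain ⟨l, h1, h2, h3⟩ := exists_reduced hP hw
  induction l using List.reverseRecOn generalizing w with
  | nil => obtain rfl : w = 1 := by rw [← h2, wd_nil]
           exact one
  | append_singleton l i ih =>
    simp only [wd_append, wd_cons, wd_nil, mul_one, List.length_append,
      List.length_singleton] at h2 h3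
    subst h2
    have hl : ∀ k ∈ l, k ∈ P := fun k hk => h1 k (by simp [hk])
    have hi : i ∈ P := h1 i (by simp)
    have hw' : wd D l ∈ parabolicWeyl D P := by
      have := mul_mem hw (refl_mem_parabolic (D := D) hi)
      rwa [mul_refl_mul_refl] at this
    have hle := len_wd_le (b := b) l fun k hk => hP (hl k hk)
    have hpos : b.IsPos (wd D l • i) := by
      by_contra h
      have := len_mul_refl_of_neg (hP hi) h
      omega
    have := len_mul_refl_of_pos (hP hi) hpos
    exact mul _ hw' i hi hpos (ih hw' hl rfl (by omega))

@[elab_as_elim]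
theorem parabolic_induction_left {P : Set ι} (hP : P ⊆ b.support)
    {p : (w : D.weylGroup) → w ∈ parabolicWeyl D P → Prop} (one : p 1 (one_mem _))
    (mul : ∀ (w : D.weylGroup) (hw : w ∈ parabolicWeyl D P) (i : ι) (hi : i ∈ P),
      b.IsPos (w⁻¹ • i) → p w hw → p (refl D i * w) (mul_mem (refl_mem_parabolic hi) hw))
    {w : D.weylGroup} (hw : w ∈ parabolicWeyl D P) : p w hw := by
  have : ∀ (v : D.weylGroup) (hv : v ∈ parabolicWeyl D P), p v⁻¹ (inv_mem hv) := by
    intro v hv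
    induction hv using parabolic_induction_right hP with
    | one => simpa using one
    | mul w hw i hi h ih =>
      have := mul w⁻¹ (inv_mem hw) i hi (by simpa using h) ih
      simpa only [mul_inv_rev, refl_inv] using this
  simpa using this w⁻¹ (inv_mem hw)

/-- Induction over all of `W` along right multiplication by length-increasing simple
reflections. -/
theorem weyl_induction_right (b : D.Base) {p : D.weylGroup → Prop} (one : p 1)
    (mul : ∀ (w : D.weylGroup) (i : ι), i ∈ b.support → b.IsPos (w • i) → p w →
      p (w * refl D i)) (w : D.weylGroup) : p w := by
  have hw := mem_parabolicWeyl_support (b := b) w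
  induction hw using parabolic_induction_right (b := b) subset_rfl with
  | one => exact one
  | mul w hw i hi h ih => exact mul w i hi h ih

theorem weyl_induction_left (b : D.Base) {p : D.weylGroup → Prop} (one : p 1)
    (mul : ∀ (w : D.weylGroup) (i : ι), i ∈ b.support → b.IsPos (w⁻¹ • i) → p w →
      p (refl D i * w)) (w : D.weylGroup) : p w := by
  have hw := mem_parabolicWeyl_support (b := b) w
  induction hw using parabolic_induction_left (b := b) subset_rfl with
  | one => exact one
  | mul w hw i hi h ih => exact mul w i hi h ih

/-- By linear independence of the base, an expression of a root in terms of `P` coincides with its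
expansion in simple roots, and the coefficients of the latter have one sign. -/
theorem exists_nonneg_sum {P : Set ι} (hP : P ⊆ b.support) {j : ι} (hj : b.IsPos j)
    (hspan : D.root j ∈ Submodule.span ℤ (D.root '' P)) :
    ∃ f : ι → ℤ, 0 ≤ f ∧ (∀ k ∈ b.support, k ∉ P → f k = 0) ∧
      D.root j = ∑ k ∈ b.support, f k • D.root k := by
  classical
  obtain ⟨f, hf0, hf1, hf2⟩ := b.exists_root_eq_sum_int j
  have hf1 : 0 ≤ f := by
    rcases hf1 with h | h
    · exact h.le
    · exfalso
      rw [RootPairing.Base.isPos_iff, RootPairing.Base.height_eq_sum hf2] at hj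
      exact absurd hj (not_lt.mpr (Finset.sum_nonpos fun i _ => h.le i))
  refine ⟨f, hf1, ?_, hf2⟩
  intro k hk hkP
  rw [Finsupp.mem_span_image_iff_linearCombination] at hspan
  obtain ⟨g, hg, hg2⟩ := hspan
  let f' : ι →₀ ℤ := Finsupp.onFinset b.support f fun a ha => hf0 ha
  have hf' : f' ∈ Finsupp.supported ℤ ℤ (b.support : Set ι) := by
    intro a ha
    exact Finset.mem_coe.mpr (Finsupp.support_onFinset_subset ha)
  have hg' : g ∈ Finsupp.supported ℤ ℤ (b.support : Set ι) := Finsupp.supported_mono hP hg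
  have heq : f' = g := by
    rw [← sub_eq_zero]
    refine linearIndepOn_iff.mp b.linearIndepOn_root _ (sub_mem hf' hg') ?_
    rw [map_sub, hg2, hf2, Finsupp.linearCombination_apply, sub_eq_zero]
    exact Finsupp.onFinset_sum (g := fun a c => c • D.root a) _ (by simp)
  have : g k = 0 := by
    by_contra h
    exact hkP (hg (Finsupp.mem_support_iff.mpr h))
  rw [← heq] at this
  exact this

theorem height_smul_eq {j : ι} (v : D.weylGroup) {f : ι → ℤ}
    (h : D.root j = ∑ k ∈ b.support, f k • D.root k) :
    b.height (v • j) = ∑ k ∈ b.support, f k * b.height (v • k) := by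
  refine height_eq_linear b _ f (fun k => v • k) ?_
  rw [root_smul, h, Finset.smul_sum]
  exact Finset.sum_congr rfl fun k _ => by rw [smul_zsmul', root_smul]

/-- A Weyl group element which makes the simple roots in `P` positive makes the positive roots in
the span of `P` positive. -/
theorem isPos_smul_of_mem_span {P : Set ι} (hP : P ⊆ b.support) {v : D.weylGroup}
    (hv : ∀ i ∈ P, b.IsPos (v • i)) {j : ι} (hj : b.IsPos j)
    (hspan : D.root j ∈ Submodule.span ℤ (D.root '' P)) : b.IsPos (v • j) := by
  obtain ⟨f, hf1, hfP, hf2⟩ := exists_nonneg_sum hP hj hspan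
  rw [RootPairing.Base.isPos_iff', height_smul_eq v hf2]
  refine Finset.sum_nonneg fun k hk => ?_
  by_cases hkP : k ∈ P
  · exact mul_nonneg (hf1 k) ((RootPairing.Base.isPos_iff' _).mp (hv k hkP))
  · rw [hfP k hk hkP, zero_mul]

theorem not_isPos_smul_of_mem_span {P : Set ι} (hP : P ⊆ b.support) {v : D.weylGroup}
    (hv : ∀ i ∈ P, ¬ b.IsPos (v • i)) {j : ι} (hj : b.IsPos j)
    (hspan : D.root j ∈ Submodule.span ℤ (D.root '' P)) : ¬ b.IsPos (v • j) := by
  obtain ⟨f, hf1, hfP, hf2⟩ := exists_nonneg_sum hP hj hspan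
  rw [RootPairing.Base.isPos_iff, height_smul_eq v hf2, not_lt]
  refine Finset.sum_nonpos fun k hk => ?_
  by_cases hkP : k ∈ P
  · have := hv k hkP
    rw [RootPairing.Base.isPos_iff, not_lt] at this
    exact mul_nonpos_of_nonneg_of_nonpos (hf1 k) this
  · rw [hfP k hk hkP, zero_mul]

/-- If `v` makes `P` positive, it keeps positive every `p i` with `p ∈ W_P`, `i ∈ P`, `p i > 0`. -/
theorem isPos_smul_smul {P : Set ι} (hP : P ⊆ b.support) {v p : D.weylGroup}
    (hv : ∀ i ∈ P, b.IsPos (v • i)) (hp : p ∈ parabolicWeyl D P) {i : ι} (hi : i ∈ P)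
    (h : b.IsPos (p • i)) : b.IsPos (v • p • i) :=
  isPos_smul_of_mem_span hP hv h (parabolic_smul_root_mem hp hi)

theorem not_isPos_smul_smul {P : Set ι} (hP : P ⊆ b.support) {v p : D.weylGroup}
    (hv : ∀ i ∈ P, b.IsPos (v • i)) (hp : p ∈ parabolicWeyl D P) {i : ι} (hi : i ∈ P)
    (h : ¬ b.IsPos (p • i)) : ¬ b.IsPos (v • p • i) := by
  rw [← isPos_negIdx, ← negIdx_smul]
  refine isPos_smul_of_mem_span hP hv (isPos_negIdx.mpr h) ?_
  rw [root_negIdx]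
  exact neg_mem (parabolic_smul_root_mem hp hi)

/-- Along a reduced word of `p`, each new letter corresponds to a positive root in the span of `P`.
As `v` keeps that root positive, the letter also lengthens the product with `v`. -/
theorem len_mul_parabolic {P : Set ι} (hP : P ⊆ b.support) {v p : D.weylGroup}
    (hv : ∀ i ∈ P, b.IsPos (v • i)) (hp : p ∈ parabolicWeyl D P) :
    len b (v * p) = len b v + len b p := by
  induction hp using parabolic_induction_right hP with
  | one => simp [len_one]
  | mul w hw i hi h ih =>
    rw [← mul_assoc, len_mul_refl_of_pos (hP hi), ih, len_mul_refl_of_pos (hP hi) h, add_assoc]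
    rw [mul_smul]
    exact isPos_smul_smul hP hv hw hi h

theorem len_parabolic_mul {P : Set ι} (hP : P ⊆ b.support) {v p : D.weylGroup}
    (hv : ∀ i ∈ P, b.IsPos (v⁻¹ • i)) (hp : p ∈ parabolicWeyl D P) :
    len b (p * v) = len b p + len b v := by
  rw [← len_inv, mul_inv_rev, len_mul_parabolic hP hv (inv_mem hp), len_inv, len_inv, add_comm]

theorem len_add_len_of_neg {P : Set ι} (hP : P ⊆ b.support) {w p : D.weylGroup}
    (hw : ∀ i ∈ P, ¬ b.IsPos (w • i)) (hp : p ∈ parabolicWeyl D P) :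
    len b (w * p) + len b p = len b w := by
  induction hp using parabolic_induction_right hP with
  | one => simp [len_one]
  | mul p hp i hi h ih =>
    have h1 := len_mul_refl_of_pos (hP hi) h
    have h2 : ¬ b.IsPos ((w * p) • i) := by
      rw [mul_smul]
      exact not_isPos_smul_of_mem_span hP hw h (parabolic_smul_root_mem hp hi)
    have h3 := len_mul_refl_of_neg (hP hi) h2
    rw [← mul_assoc]
    omega

/-! ### Longest elements -/

theorem longest_mem (P : Set ι) : longest b P ∈ parabolicWeyl D P :=
  (Classical.choose_spec (exists_longest b P)).1

theorem len_le_longest {P : Set ι} {v : D.weylGroup} (hv : v ∈ parabolicWeyl D P) :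
    len b v ≤ len b (longest b P) :=
  (Classical.choose_spec (exists_longest b P)).2 v hv

theorem not_isPos_longest_smul {P : Set ι} (hP : P ⊆ b.support) {i : ι} (hi : i ∈ P) :
    ¬ b.IsPos (longest b P • i) := by
  intro h
  have h1 := len_mul_refl_of_pos (hP hi) h
  have h2 := len_le_longest (b := b) (mul_mem (longest_mem (b := b) P)
    (refl_mem_parabolic (D := D) hi))
  omega

theorem eq_longest {P : Set ι} (hP : P ⊆ b.support) {w : D.weylGroup}
    (hw : w ∈ parabolicWeyl D P) (h : ∀ i ∈ P, ¬ b.IsPos (w • i)) : w = longest b P := by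
  have h1 := len_add_len_of_neg hP h (mul_mem (inv_mem hw) (longest_mem (b := b) P))
  -- With `p = w⁻¹ w_P` this reads `ℓ(w_P) + ℓ(w⁻¹ w_P) = ℓ(w)`, while `ℓ(w) ≤ ℓ(w_P)`.
  rw [mul_inv_cancel_left] at h1
  have h2 := len_le_longest (b := b) hw
  have h3 : len b (w⁻¹ * longest b P) = 0 := by omega
  exact inv_mul_eq_one.mp (eq_one_of_len h3)

theorem eq_longest_of_len {P : Set ι} (hP : P ⊆ b.support) {w : D.weylGroup}
    (hw : w ∈ parabolicWeyl D P) (h : len b (longest b P) ≤ len b w) : w = longest b P := by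
  refine eq_longest hP hw fun i hi hpos => ?_
  have h1 := len_mul_refl_of_pos (hP hi) hpos
  have h2 := len_le_longest (b := b) (mul_mem hw (refl_mem_parabolic (D := D) hi))
  omega

theorem longest_inv {P : Set ι} (hP : P ⊆ b.support) : (longest b P)⁻¹ = longest b P :=
  eq_longest_of_len hP (inv_mem (longest_mem P)) (by rw [len_inv])

theorem longest_mul_self {P : Set ι} (hP : P ⊆ b.support) : longest b P * longest b P = 1 := by
  nth_rewrite 1 [← longest_inv hP]
  exact inv_mul_cancel _

theorem len_longest_mul {P : Set ι} (hP : P ⊆ b.support) {p : D.weylGroup}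
    (hp : p ∈ parabolicWeyl D P) : len b (longest b P * p) + len b p = len b (longest b P) :=
  len_add_len_of_neg hP (fun _ hi => not_isPos_longest_smul hP hi) hp

theorem len_mul_longest {P : Set ι} (hP : P ⊆ b.support) {p : D.weylGroup}
    (hp : p ∈ parabolicWeyl D P) : len b (p * longest b P) + len b p = len b (longest b P) := by
  rw [← len_inv, mul_inv_rev, longest_inv hP, ← len_inv p]
  exact len_longest_mul hP (inv_mem hp)

/-- Evaluating `s_i = s_j` at `α_i` gives `2 α_i = ⟨α_i, α_j^∨⟩ α_j`, whereas in a reduced system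
two roots that are neither equal nor opposite are independent. -/
theorem eq_or_eq_negIdx_of_refl_eq {i j : ι} (h : refl D i = refl D j) :
    i = j ∨ i = negIdx (D := D) j := by
  have h1 : refl D i • D.root i = refl D j • D.root i := by rw [h]
  rw [refl_smul, refl_smul, RootPairing.root_coroot_two] at h1
  rw [or_iff_not_imp_left]
  intro hne
  by_contra hcon
  have hli := RootPairing.IsReduced.linearIndependent D hne
    fun h => hcon (eq_negIdx h)
  rw [LinearIndependent.pair_iff] at hli
  have := hli 2 (-D.toLinearMap (D.root i) (D.coroot j)) (by
    have := sub_eq_zero.mpr h1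
    rw [← neg_eq_zero, ← this]; module)
  exact absurd this.1 (by norm_num)

/-- The longest element of `W_P` maps `P` to `-P`. -/
theorem exists_neg_longest {P : Set ι} (hP : P ⊆ b.support) {j : ι} (hj : j ∈ P) :
    ∃ k ∈ P, D.root k = -(longest b P • D.root j) := by
  have hm := longest_mem (b := b) P
  have hs : refl D j ∈ parabolicWeyl D P := refl_mem_parabolic hj
  have h1 := len_longest_mul hP (mul_mem hs hm)
  have h2 := len_mul_longest hP hs
  have h3 : len b (refl D j) = 1 := by
    have := len_mul_refl_of_pos (b := b) (w := 1) (hP hj) (by simpa using isPos_of_mem (hP hj))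
    simpa [len_one] using this
  -- `w_P s_j w_P` has length `ℓ(w_P) - (ℓ(w_P) - 1) = 1`.
  obtain ⟨k, hk, h4⟩ := exists_refl_of_len hP (mul_mem hm (mul_mem hs hm)) (by omega)
  refine ⟨k, hk, ?_⟩
  have h5 : refl D (longest b P • j) = refl D k := by
    rw [← refl_conj, longest_inv hP, ← h4, mul_assoc]
  rw [← root_smul]
  rcases eq_or_eq_negIdx_of_refl_eq h5 with h | h
  · exfalso
    have := not_isPos_longest_smul hP hj
    rw [h] at this
    exact this (isPos_of_mem (hP hk))
  · rw [h, root_negIdx, neg_neg]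

/-! ### Opposite parabolic subgroups -/

/-- `Opposite b P Q d`: the sets `P` and `Q` of simple roots are opposite, and `d = w_P w_Δ` is the
longest of the minimal length representatives of `W_P \ W`. -/
structure Opposite (b : D.Base) (P Q : Set ι) (d : D.weylGroup) : Prop where
  left_subset : P ⊆ b.support
  right_subset : Q ⊆ b.support
  longest_left : longest b P * d = longest b b.support
  longest_right : longest b Q * d⁻¹ = longest b b.support
  map_right : ∀ i ∈ Q, d • i ∈ P
  map_left : ∀ i ∈ P, d⁻¹ • i ∈ Q

theorem Opposite.symm {P Q : Set ι} {d : D.weylGroup} (h : Opposite b P Q d) :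
    Opposite b Q P d⁻¹ where
  left_subset := h.right_subset
  right_subset := h.left_subset
  longest_left := h.longest_right
  longest_right := by rw [inv_inv]; exact h.longest_left
  map_right := h.map_left
  map_left := by rw [inv_inv]; exact h.map_right

theorem opp_subset {P : Set ι} (hP : P ⊆ b.support) : opp b P ⊆ b.support := by
  rintro i ⟨j, hj, h⟩
  obtain ⟨k, hk, hk2⟩ := exists_neg_longest (b := b) subset_rfl (hP hj)
  rwa [root_injective (h.trans ((smul_neg _ _).trans hk2.symm))]

theorem conj_mem_parabolic {P Q : Set ι} {d : D.weylGroup} (h : ∀ i ∈ P, d • i ∈ Q)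
    {w : D.weylGroup} (hw : w ∈ parabolicWeyl D P) : d * w * d⁻¹ ∈ parabolicWeyl D Q := by
  have : parabolicWeyl D P ≤ (parabolicWeyl D Q).comap (MulAut.conj d).toMonoidHom := by
    refine (Subgroup.closure_le _).mpr ?_
    rintro _ ⟨i, hi, rfl⟩
    change d * refl D i * d⁻¹ ∈ parabolicWeyl D Q
    rw [refl_conj]
    exact refl_mem_parabolic (h i hi)
  exact this hw

/-- Conjugation by `w_Δ` turns the reflections in `P` into those in `P^op`, so `w_Δ w_P w_Δ` is the
longest element of `W_{P^op}`. Both `w_P` and `w_Δ` send simple roots to negatives of simple roots;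
the two signs cancel in `d`. -/
theorem opposite_opp {P : Set ι} (hP : P ⊆ b.support) :
    Opposite b P (opp b P) (longest b P * longest b b.support) := by
  have hQ := opp_subset hP
  have hinv : (longest b P * longest b (b.support : Set ι))⁻¹
      = longest b b.support * longest b P := by
    rw [mul_inv_rev, longest_inv hP, longest_inv subset_rfl]
  have hΔ : longest b (b.support : Set ι) * longest b b.support = 1 := longest_mul_self subset_rfl
  have hconj : ∀ i ∈ P, negIdx (D := D) (longest b b.support • i) ∈ opp b P := by
    intro i hi
    exact ⟨i, hi, by rw [root_negIdx, root_smul, smul_neg]⟩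
  have hlong : longest b b.support * longest b P * longest b b.support
      = longest b (opp b P) := by
    refine eq_longest hQ ?_ ?_
    · have hle : parabolicWeyl D P ≤ (parabolicWeyl D (opp b P)).comap
          (MulAut.conj (longest b b.support)).toMonoidHom := by
        refine (Subgroup.closure_le _).mpr ?_
        rintro _ ⟨i, hi, rfl⟩
        change longest b b.support * refl D i * (longest b b.support)⁻¹ ∈ parabolicWeyl D (opp b P)
        rw [refl_conj, ← refl_eq_of_root_neg (root_negIdx _)]
        exact refl_mem_parabolic (hconj i hi)
      have := hle (longest_mem (b := b) P)
      change longest b b.support * longest b P * (longest b b.support)⁻¹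
        ∈ parabolicWeyl D (opp b P) at this
      rwa [longest_inv subset_rfl] at this
    · rintro i ⟨j, hj, h⟩
      obtain ⟨k, hk, hk2⟩ := exists_neg_longest hP hj
      have h2 : (longest b b.support * longest b P * longest b b.support) • i
          = longest b b.support • k := by
        refine root_injective (D := D) ?_
        rw [root_smul, root_smul, h, mul_smul, ← mul_smul (longest b _) (longest b _) (-_), hΔ,
          one_smul, mul_smul, smul_neg, hk2]
      rw [h2]
      exact not_isPos_longest_smul subset_rfl (hP hk)
  refine ⟨hP, hQ, ?_, ?_, ?_, ?_⟩
  · rw [← mul_assoc, longest_mul_self hP, one_mul]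
  · rw [hinv, ← hlong, mul_assoc, ← mul_assoc _ _ (longest b P), hΔ, one_mul, mul_assoc,
      longest_mul_self hP, mul_one]
  · rintro i ⟨j, hj, h⟩
    obtain ⟨k, hk, hk2⟩ := exists_neg_longest hP hj
    have : (longest b P * longest b b.support) • i = k := by
      refine root_injective (D := D) ?_
      rw [root_smul, h, ← mul_smul, mul_assoc, hΔ, mul_one, smul_neg, hk2]
    rwa [this]
  · intro i hi
    obtain ⟨k, hk, hk2⟩ := exists_neg_longest hP hi
    have : (longest b P * longest b b.support)⁻¹ • i = negIdx (D := D) (longest b b.support • k) := by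
      refine root_injective (D := D) ?_
      rw [hinv, root_negIdx, root_smul, root_smul, hk2, mul_smul, smul_neg, neg_neg]
    rw [this]
    exact hconj k hk

namespace Opposite

variable {P Q : Set ι} {d : D.weylGroup} (h : Opposite b P Q d)
include h

theorem isPos_inv_smul {i : ι} (hi : i ∈ P) : b.IsPos (d⁻¹ • i) :=
  isPos_of_mem (h.right_subset (h.map_left i hi))

theorem isPos_smul {i : ι} (hi : i ∈ Q) : b.IsPos (d • i) :=
  isPos_of_mem (h.left_subset (h.map_right i hi))

theorem len_longest_add : len b (longest b P) + len b d = len b (longest b b.support) := by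
  rw [← len_parabolic_mul h.left_subset (fun i hi => h.isPos_inv_smul hi) (longest_mem P),
    h.longest_left]

theorem len_le {v : D.weylGroup} (hv : ∀ i ∈ P, b.IsPos (v⁻¹ • i)) : len b v ≤ len b d := by
  have h1 := len_parabolic_mul h.left_subset hv (longest_mem (b := b) P)
  have h2 := len_le_longest (b := b) (mem_parabolicWeyl_support (b := b) (longest b P * v))
  have h3 := h.len_longest_add
  omega

theorem eq_of_len {v : D.weylGroup} (hv : ∀ i ∈ P, b.IsPos (v⁻¹ • i)) (hl : len b d ≤ len b v) :
    v = d := by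
  have h1 := len_parabolic_mul h.left_subset hv (longest_mem (b := b) P)
  have h3 := h.len_longest_add
  have h4 := eq_longest_of_len (b := b) subset_rfl (mem_parabolicWeyl_support (longest b P * v))
    (by omega)
  rw [← h.longest_left] at h4
  exact mul_left_cancel h4

/-- `v⁻¹ d = (w_P v)⁻¹ w_Δ` is a complement of `w_P v` in `w_Δ`, and `ℓ(w_P v) = ℓ(w_P) + ℓ(v)`.
This equality yields the diagonal of the Gram matrix below. -/
theorem len_inv_mul {v : D.weylGroup} (hv : ∀ i ∈ P, b.IsPos (v⁻¹ • i)) :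
    len b v + len b (v⁻¹ * d) = len b d := by
  have h1 := len_parabolic_mul h.left_subset hv (longest_mem (b := b) P)
  have h2 := len_mul_longest (b := b) subset_rfl
    (mem_parabolicWeyl_support ((longest b P * v)⁻¹))
  have h3 := h.len_longest_add
  have h4 : (longest b P * v)⁻¹ * longest b b.support = v⁻¹ * d := by
    rw [← h.longest_left, mul_inv_rev, longest_inv h.left_subset, mul_assoc,
      ← mul_assoc _ _ d, longest_mul_self h.left_subset, one_mul]
  rw [h4, len_inv] at h2
  omega

end Opposite

/-- Left descents in `P` are stripped off until none is left. -/
theorem exists_min_coset_rep {P : Set ι} (hP : P ⊆ b.support) (w : D.weylGroup) :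
    ∃ p ∈ parabolicWeyl D P, ∃ v : D.weylGroup, (∀ i ∈ P, b.IsPos (v⁻¹ • i)) ∧ w = p * v := by
  induction hn : len b w using Nat.strong_induction_on generalizing w with
  | _ n ih =>
    by_cases h : ∀ i ∈ P, b.IsPos (w⁻¹ • i)
    · exact ⟨1, one_mem _, w, h, (one_mul w).symm⟩
    · push Not at h
      obtain ⟨i, hi, h⟩ := h
      have hl := len_refl_mul_of_neg (hP hi) h
      obtain ⟨p, hp, v, hv, h2⟩ := ih _ (by omega) (refl D i * w) rfl
      refine ⟨refl D i * p, mul_mem (refl_mem_parabolic hi) hp, v, hv, ?_⟩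
      rw [mul_assoc, ← h2, refl_mul_refl_mul]

end WeylCombinatorics

/-! ### Demazure operators -/

section Lattice

variable {X : Type u} [AddCommGroup X]

/-- This makes `ℂ[X]` a domain, so that the denominators `1 - θ_{-2α}` can be cancelled. -/
instance uniqueSums_lattice [Module.Free ℤ X] [Module.Finite ℤ X] : UniqueSums X :=
  let e := (Module.Free.chooseBasis ℤ X).repr
  UniqueSums.of_injective_addHom (e.toAddEquiv.toAddHom : X →ₙ+ _) e.injective inferInstance

theorem lat_mul (x y : X) : lat x * lat y = lat (x + y) := by
  simp [lat, AddMonoidAlgebra.single_mul_single]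

theorem lat_zero : lat (0 : X) = 1 := rfl

@[elab_as_elim]
theorem lat_induction {p : AddMonoidAlgebra ℂ X → Prop} (f : AddMonoidAlgebra ℂ X)
    (of : ∀ x, p (lat x)) (add : ∀ f g, p f → p g → p (f + g))
    (smul : ∀ (z : ℂ) (f), p f → p (z • f)) : p f :=
  AddMonoidAlgebra.induction_on f of add smul

theorem lat_linear_ext {V : Type*} [AddCommGroup V] [Module ℂ V]
    {φ φ' : AddMonoidAlgebra ℂ X →ₗ[ℂ] V} (h : ∀ x, φ (lat x) = φ' (lat x)) : φ = φ' := by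
  refine LinearMap.ext fun f => ?_
  induction f using lat_induction with
  | of x => exact h x
  | add f g hf hg => rw [map_add, map_add, hf, hg]
  | smul z f hf => rw [map_smul, map_smul, hf]

theorem lat_pow (x : X) (n : ℕ) : lat x ^ n = lat (n • x) := by
  induction n with
  | zero => simp [lat_zero]
  | succ n ih => rw [pow_succ, ih, lat_mul, succ_nsmul]

theorem lat_injective : Function.Injective (lat : X → AddMonoidAlgebra ℂ X) :=
  AddMonoidAlgebra.single_left_injective one_ne_zero

end Lattice

section Demazure

variable {ι X Y : Type u} [AddCommGroup X] [AddCommGroup Y] {D : RootPairing ι ℤ X Y}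

/-- The pairing of a lattice element with a coroot. -/
def cpair (D : RootPairing ι ℤ X Y) (x : X) (i : ι) : ℤ := D.toLinearMap x (D.coroot i)

theorem cpair_add (x y : X) (i : ι) : cpair D (x + y) i = cpair D x i + cpair D y i := by
  simp [cpair]

theorem cpair_neg (x : X) (i : ι) : cpair D (-x) i = -cpair D x i := by
  simp [cpair]

theorem cpair_zsmul (n : ℤ) (x : X) (i : ι) : cpair D (n • x) i = n * cpair D x i := by
  simp [cpair]

theorem cpair_self (i : ι) : cpair D (D.root i) i = 2 := D.root_coroot_two i

theorem refl_smul' (i : ι) (x : X) : refl D i • x = x - cpair D x i • D.root i := refl_smul i x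

/-- The action of the Weyl group on `ℂ[X]`. -/
def wAct (w : D.weylGroup) : AddMonoidAlgebra ℂ X →ₐ[ℂ] AddMonoidAlgebra ℂ X :=
  AddMonoidAlgebra.mapDomainAlgHom ℂ ℂ (DistribSMul.toAddMonoidHom X w)

theorem wAct_lat (w : D.weylGroup) (x : X) : wAct w (lat x) = lat (w • x) := by
  simp [wAct, lat]

theorem wAct_mul (w w' : D.weylGroup) (f : AddMonoidAlgebra ℂ X) :
    wAct (w * w') f = wAct w (wAct w' f) := by
  refine DFunLike.congr_fun (lat_linear_ext (φ := (wAct (w * w')).toLinearMap)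
    (φ' := (wAct w).toLinearMap ∘ₗ (wAct w').toLinearMap) fun x => ?_) f
  simp [wAct_lat, mul_smul]

theorem wAct_one (f : AddMonoidAlgebra ℂ X) : wAct (1 : D.weylGroup) f = f := by
  refine DFunLike.congr_fun (lat_linear_ext (φ := (wAct (1 : D.weylGroup)).toLinearMap)
    (φ' := LinearMap.id) fun x => ?_) f
  simp [wAct_lat]

theorem wAct_refl_refl (i : ι) (f : AddMonoidAlgebra ℂ X) :
    wAct (refl D i) (wAct (refl D i) f) = f := by
  rw [← wAct_mul, refl_mul_self, wAct_one]

variable (κ : Labels D)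

/-- The numerator `c + c* θ_{-α}`. -/
def Labels.num (i : ι) : AddMonoidAlgebra ℂ X := κ.c i • 1 + κ.cStar i • lat (-D.root i)

theorem Labels.cStar_eq {i : ι} (h : ¬ ∃ y : Y, D.coroot i = (2 : ℤ) • y) :
    κ.cStar i = κ.c i := by
  simp [Labels.c, Labels.cStar, κ.lamStar_eq i h]

theorem Labels.cStar_eq_of_odd {i : ι} {x : X} (h : Odd (cpair D x i)) :
    κ.cStar i = κ.c i := by
  refine κ.cStar_eq ?_
  rintro ⟨y, hy⟩
  rw [cpair, hy, map_smul, smul_eq_mul] at h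
  exact (Int.not_odd_iff_even.mpr (even_two_mul _)) h

theorem Labels.c_smul (w : D.weylGroup) (i : ι) : κ.c (w • i) = κ.c i := by
  simp [Labels.c, κ.lam_weyl]

theorem Labels.cStar_smul (w : D.weylGroup) (i : ι) : κ.cStar (w • i) = κ.cStar i := by
  simp [Labels.cStar, κ.lamStar_weyl]

/-- The denominator `1 - θ_{-2α}`. -/
def den (D : RootPairing ι ℤ X Y) (i : ι) : AddMonoidAlgebra ℂ X := 1 - lat (-((2 : ℤ) • D.root i))

theorem den_eq (i : ι) : den D i = 1 - lat (-D.root i) ^ 2 := by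
  rw [den, lat_pow]; congr 2; module

/-- With `a = θ_{-α}` one has `θ_x - θ_{s(x)} = θ_x (1 - a^n)`. For even `n` this is divisible by `1
- a²`. For odd `n` it only provides the factor `1 - a`, but then `α^∨ ∉ 2Y`, hence `c* = c`, and the
numerator `c (1 + a)` supplies the other factor. -/
theorem den_dvd_of_nonneg (i : ι) (x : X) (n : ℕ) (hn : cpair D x i = n) :
    den D i ∣ κ.num i * (lat x - lat (refl D i • x)) := by
  have hx : lat (refl D i • x) = lat x * lat (-D.root i) ^ n := by
    rw [lat_pow, lat_mul, refl_smul', hn]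
    congr 1
    simp [sub_eq_add_neg]
  rw [hx, den_eq]
  set a := lat (-D.root i)
  rcases Nat.even_or_odd n with ⟨m, rfl⟩ | hodd
  · have h := sub_dvd_pow_sub_pow 1 (a ^ 2) m
    rw [one_pow, ← pow_mul, two_mul] at h
    obtain ⟨g, hg⟩ := h
    refine ⟨κ.num i * lat x * g, ?_⟩
    linear_combination κ.num i * lat x * hg
  · have hc : κ.cStar i = κ.c i := κ.cStar_eq_of_odd (x := x) (by rw [hn]; exact_mod_cast hodd)
    have hnum : κ.num i = κ.c i • (1 + a) := by rw [Labels.num, hc, smul_add]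
    obtain ⟨g, hg⟩ := sub_dvd_pow_sub_pow 1 a n
    rw [one_pow] at hg
    refine ⟨κ.c i • (lat x * g), ?_⟩
    rw [hnum]
    simp only [smul_mul_assoc, mul_smul_comm]
    congr 1
    linear_combination (1 + a) * lat x * hg

theorem den_dvd (i : ι) (f : AddMonoidAlgebra ℂ X) :
    den D i ∣ κ.num i * (f - wAct (refl D i) f) := by
  induction f using lat_induction with
  | of x =>
    rw [wAct_lat]
    rcases le_total 0 (cpair D x i) with h | h
    · exact den_dvd_of_nonneg κ i x _ (Int.toNat_of_nonneg h).symm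
    · have h2 : cpair D (refl D i • x) i = ((-cpair D x i).toNat : ℤ) := by
        rw [Int.toNat_of_nonneg (by omega), refl_smul', sub_eq_add_neg, ← neg_smul, cpair_add,
          cpair_zsmul, cpair_self]
        ring
      have := den_dvd_of_nonneg κ i (refl D i • x) _ h2
      rw [refl_smul_smul] at this
      rw [← dvd_neg, ← mul_neg, neg_sub]
      exact this
  | add f g hf hg =>
    rw [map_add, add_sub_add_comm, mul_add]
    exact dvd_add hf hg
  | smul z f hf =>
    rw [map_smul, ← smul_sub, mul_smul_comm]
    exact dvd_smul_of_dvd _ hf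

variable [Module.Free ℤ X] [Module.Finite ℤ X]

theorem den_ne_zero (i : ι) : den D i ≠ 0 := by
  intro h
  rw [den, sub_eq_zero, ← lat_zero] at h
  have h0 : D.root i = 0 := by
    have h1 := lat_injective h
    rw [eq_comm, neg_eq_zero] at h1
    have h2 := congrArg (fun x => cpair D x i) h1
    simp only [cpair_zsmul, cpair_self] at h2
    simp [cpair] at h2
  exact D.ne_zero i h0

theorem exists_demazure (i : ι) : ∃ δ : AddMonoidAlgebra ℂ X → AddMonoidAlgebra ℂ X,
    ∀ f, den D i * δ f = κ.num i * (f - wAct (refl D i) f) :=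
  ⟨fun f => (den_dvd κ i f).choose, fun f => (den_dvd κ i f).choose_spec.symm⟩

/-- The Demazure-type operator `f ↦ (c + c* θ_{-α}) (f - s f) / (1 - θ_{-2α})`. -/
def demazure (i : ι) : AddMonoidAlgebra ℂ X →ₗ[ℂ] AddMonoidAlgebra ℂ X where
  toFun := (exists_demazure κ i).choose
  map_add' f g := by
    refine mul_left_cancel₀ (den_ne_zero (D := D) i) ?_
    rw [mul_add]
    simp only [(exists_demazure κ i).choose_spec, map_add]
    ring
  map_smul' z f := by
    refine mul_left_cancel₀ (den_ne_zero (D := D) i) ?_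
    rw [RingHom.id_apply, mul_smul_comm]
    simp only [(exists_demazure κ i).choose_spec, map_smul, ← smul_sub, mul_smul_comm]

theorem den_mul_demazure (i : ι) (f : AddMonoidAlgebra ℂ X) :
    den D i * demazure κ i f = κ.num i * (f - wAct (refl D i) f) :=
  (exists_demazure κ i).choose_spec f

variable {κ}

theorem eq_demazure {i : ι} {f g : AddMonoidAlgebra ℂ X}
    (h : den D i * g = κ.num i * (f - wAct (refl D i) f)) : g = demazure κ i f := by
  refine mul_left_cancel₀ (den_ne_zero (D := D) i) ?_
  rw [h, den_mul_demazure]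

/-- Twisted Leibniz rule: the cross relation for a product follows from the cross relations for the
factors. -/
theorem demazure_mul (i : ι) (f g : AddMonoidAlgebra ℂ X) :
    demazure κ i (f * g) = demazure κ i f * g + wAct (refl D i) f * demazure κ i g := by
  refine (eq_demazure ?_).symm
  rw [map_mul, mul_add, ← mul_assoc, den_mul_demazure, mul_left_comm, den_mul_demazure]
  ring

theorem demazure_wAct (i : ι) (f : AddMonoidAlgebra ℂ X) :
    demazure κ i (wAct (refl D i) f) = -demazure κ i f := by
  refine (eq_demazure ?_).symm
  rw [wAct_refl_refl, mul_neg, den_mul_demazure]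
  ring

/-- This identity makes the cross relation compatible with the quadratic relation of `N_s`. -/
theorem wAct_demazure (i : ι) (f : AddMonoidAlgebra ℂ X) :
    wAct (refl D i) (demazure κ i f)
      = demazure κ i f + κ.c i • (wAct (refl D i) f - f) := by
  refine mul_left_cancel₀ (den_ne_zero (D := D) i) ?_
  set a := lat (-D.root i) with ha
  set a' := lat (D.root i) with ha'
  have haa : a * a' = 1 := by rw [ha, ha', lat_mul, neg_add_cancel, lat_zero]
  have hs : wAct (refl D i) a = a' := by
    rw [ha, wAct_lat, smul_neg, ← root_smul, refl_smul_self, neg_neg]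
  have h1 := den_mul_demazure κ i f
  have h2 := congrArg (wAct (refl D i)) h1
  have hn : κ.num i = κ.c i • 1 + κ.cStar i • a := rfl
  rw [den_eq, ← ha] at h1 ⊢
  rw [den_eq, hn] at h2
  simp only [map_mul, map_sub, map_one, map_pow, map_add, wAct_refl_refl, hs,
    Algebra.smul_def, ← ha, AlgHom.commutes] at h2
  rw [hn] at h1
  simp only [Algebra.smul_def] at h1 ⊢
  set C := algebraMap ℂ (AddMonoidAlgebra ℂ X) (κ.c i)
  set C' := algebraMap ℂ (AddMonoidAlgebra ℂ X) (κ.cStar i)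
  set sf := wAct (refl D i) f
  set d := demazure κ i f
  set sd := wAct (refl D i) d
  -- The reflected defining equation has denominator `1 - a'²`, and `-a² (1 - a'²) = 1 - a²` because
  -- `a a' = 1`.
  linear_combination (-a ^ 2) * h2 - h1 + (-sd * (a * a' + 1) - C' * (sf - f) * a) * haa

theorem demazure_demazure (i : ι) (f : AddMonoidAlgebra ℂ X) :
    demazure κ i (demazure κ i f) = κ.c i • demazure κ i f := by
  refine (eq_demazure ?_).symm
  rw [wAct_demazure, mul_smul_comm, den_mul_demazure, sub_add_cancel_left, ← smul_neg, neg_sub,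
    mul_smul_comm]

theorem demazure_of_cpair_zero {i : ι} {x : X} (h : cpair D x i = 0) :
    demazure κ i (lat x) = 0 := by
  refine (eq_demazure ?_).symm
  rw [wAct_lat, refl_smul', h]
  simp

theorem demazure_of_cpair_neg_one {i : ι} {x : X} (h : cpair D x i = -1) :
    demazure κ i (lat x) = -κ.c i • lat (refl D i • x) := by
  have hc : κ.cStar i = κ.c i := κ.cStar_eq_of_odd (x := x) (by rw [h]; decide)
  refine (eq_demazure ?_).symm
  have hx : lat x = lat (refl D i • x) * lat (-D.root i) := by
    rw [lat_mul, refl_smul', h]; congr 1; module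
  rw [wAct_lat, den_eq, Labels.num, hc, hx]
  simp only [Algebra.smul_def, map_neg]
  ring

theorem demazure_neg_root (i : ι) : demazure κ i (lat (-D.root i))
    = -κ.c i • lat (D.root i) - κ.cStar i • 1 := by
  refine (eq_demazure ?_).symm
  have haa : lat (-D.root i) * lat (D.root i) = 1 := by rw [lat_mul, neg_add_cancel, lat_zero]
  rw [wAct_lat, smul_neg, ← root_smul, refl_smul_self, neg_neg, den_eq, Labels.num]
  simp only [Algebra.smul_def, map_neg]
  linear_combination (algebraMap ℂ (AddMonoidAlgebra ℂ X) (κ.cStar i) +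
    algebraMap ℂ (AddMonoidAlgebra ℂ X) (κ.c i) * lat (-D.root i)) * haa

end Demazure

/-! ### The module with basis `θ_x N_w` -/

section Standard

variable {ι X Y : Type u} [AddCommGroup X] [AddCommGroup Y] {D : RootPairing ι ℤ X Y}
  [Module.Free ℤ X] [Module.Finite ℤ X]

/-- Operators on a `ℂ[X]`-module which satisfy the quadratic relations and the cross relations of
the generators `N_s`, for `s` simple. -/
structure BernsteinOps (b : D.Base) (κ : Labels D) {V : Type*} [AddCommGroup V] [Module ℂ V]
    [Module (AddMonoidAlgebra ℂ X) V] (T : ι → Module.End ℂ V) : Prop where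
  quad : ∀ i ∈ b.support, ∀ v, T i (T i v) = κ.c i • T i v + v
  cross : ∀ i ∈ b.support, ∀ (f : AddMonoidAlgebra ℂ X) (v : V),
    T i (f • v) = wAct (refl D i) f • T i v + demazure κ i f • v

/-- The free `ℂ[X]`-module with basis `W`. -/
abbrev Std (D : RootPairing ι ℤ X Y) : Type u := D.weylGroup →₀ AddMonoidAlgebra ℂ X

variable (b : D.Base) (κ : Labels D)

open Classical in
/-- The coefficient of `N_w` in `N_{s_i} N_w`. -/
def leftC (i : ι) (w : D.weylGroup) : ℂ := if b.IsPos (w⁻¹ • i) then 0 else κ.c i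

open Classical in
/-- The coefficient of `N_w` in `N_w N_{s_i}`. -/
def rightC (i : ι) (w : D.weylGroup) : ℂ := if b.IsPos (w • i) then 0 else κ.c i

/-- Left multiplication by `N_{s_i}`. -/
def leftOp (i : ι) : Module.End ℂ (Std D) :=
  Finsupp.lsum ℂ fun w =>
    Finsupp.lsingle (refl D i * w) ∘ₗ (wAct (refl D i)).toLinearMap
      + leftC b κ i w • (Finsupp.lsingle w ∘ₗ (wAct (refl D i)).toLinearMap)
      + Finsupp.lsingle w ∘ₗ demazure κ i

/-- Right multiplication by `N_{s_i}`. -/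
def rightOp (i : ι) : Module.End ℂ (Std D) :=
  Finsupp.lsum ℂ fun w =>
    Finsupp.lsingle (w * refl D i) + rightC b κ i w • Finsupp.lsingle w

theorem leftOp_single (i : ι) (w : D.weylGroup) (f : AddMonoidAlgebra ℂ X) :
    leftOp b κ i (Finsupp.single w f) = Finsupp.single (refl D i * w) (wAct (refl D i) f)
      + leftC b κ i w • Finsupp.single w (wAct (refl D i) f)
      + Finsupp.single w (demazure κ i f) := by
  simp [leftOp]

theorem rightOp_single (i : ι) (w : D.weylGroup) (f : AddMonoidAlgebra ℂ X) :
    rightOp b κ i (Finsupp.single w f) = Finsupp.single (w * refl D i) f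
      + rightC b κ i w • Finsupp.single w f := by
  simp [rightOp]

variable {b κ} [Finite ι] [D.IsReduced]

theorem leftC_of_pos {i : ι} {w : D.weylGroup} (h : b.IsPos (w⁻¹ • i)) : leftC b κ i w = 0 :=
  if_pos h

theorem leftC_of_neg {i : ι} {w : D.weylGroup} (h : ¬ b.IsPos (w⁻¹ • i)) :
    leftC b κ i w = κ.c i := if_neg h

theorem rightC_of_pos {i : ι} {w : D.weylGroup} (h : b.IsPos (w • i)) : rightC b κ i w = 0 :=
  if_pos h

theorem rightC_of_neg {i : ι} {w : D.weylGroup} (h : ¬ b.IsPos (w • i)) :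
    rightC b κ i w = κ.c i := if_neg h

theorem leftC_congr {i : ι} {w w' : D.weylGroup}
    (h : b.IsPos (w⁻¹ • i) ↔ b.IsPos (w'⁻¹ • i)) : leftC b κ i w = leftC b κ i w' := by
  by_cases h' : b.IsPos (w'⁻¹ • i)
  · rw [leftC_of_pos h', leftC_of_pos (h.mpr h')]
  · rw [leftC_of_neg h', leftC_of_neg (mt h.mp h')]

theorem rightC_congr {i : ι} {w w' : D.weylGroup}
    (h : b.IsPos (w • i) ↔ b.IsPos (w' • i)) : rightC b κ i w = rightC b κ i w' := by
  by_cases h' : b.IsPos (w' • i)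
  · rw [rightC_of_pos h', rightC_of_pos (h.mpr h')]
  · rw [rightC_of_neg h', rightC_of_neg (mt h.mp h')]

theorem leftC_refl_mul (i : ι) (w : D.weylGroup) :
    leftC b κ i (refl D i * w) + leftC b κ i w = κ.c i := by
  have : b.IsPos ((refl D i * w)⁻¹ • i) ↔ ¬ b.IsPos (w⁻¹ • i) := by
    rw [mul_inv_rev, refl_inv, isPos_mul_refl_smul]
  by_cases h : b.IsPos (w⁻¹ • i)
  · rw [leftC_of_neg (fun h' => this.mp h' h), leftC_of_pos h, add_zero]
  · rw [leftC_of_pos (this.mpr h), leftC_of_neg h, zero_add]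

theorem leftC_mul_self (i : ι) (w : D.weylGroup) :
    leftC b κ i w * leftC b κ i w = κ.c i * leftC b κ i w := by
  unfold leftC
  split_ifs <;> simp

theorem std_linear_ext {V : Type*} [AddCommGroup V] [Module ℂ V] {φ φ' : Std D →ₗ[ℂ] V}
    (h : ∀ w f, φ (Finsupp.single w f) = φ' (Finsupp.single w f)) : φ = φ' := by
  refine Finsupp.lhom_ext h

theorem leftOp_bernstein : BernsteinOps b κ (leftOp (X := X) b κ) where
  quad i hi v := by
    refine DFunLike.congr_fun (std_linear_ext (φ := leftOp b κ i ∘ₗ leftOp b κ i)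
      (φ' := κ.c i • leftOp b κ i + LinearMap.id) fun w f => ?_) v
    simp only [LinearMap.comp_apply, LinearMap.add_apply, LinearMap.smul_apply, LinearMap.id_apply,
      leftOp_single, map_add, map_smul, refl_mul_refl_mul, wAct_refl_refl, demazure_wAct,
      demazure_demazure, wAct_demazure, Finsupp.single_add, Finsupp.single_neg,
      smul_sub, Finsupp.single_sub, smul_add, ← Finsupp.smul_single]
    have h1 := leftC_refl_mul (b := b) (κ := κ) i w
    have h2 := leftC_mul_self (b := b) (κ := κ) i w
    have h3 : leftC b κ i (refl D i * w) = κ.c i - leftC b κ i w := by rw [← h1]; ring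
    rw [h3]
    simp only [smul_smul, h2]
    module
  cross i hi g v := by
    refine DFunLike.congr_fun (std_linear_ext
      (φ := leftOp b κ i ∘ₗ (LinearMap.lsmul (AddMonoidAlgebra ℂ X) (Std D) g).restrictScalars ℂ)
      (φ' := (LinearMap.lsmul (AddMonoidAlgebra ℂ X) (Std D)
          (wAct (refl D i) g)).restrictScalars ℂ ∘ₗ leftOp b κ i
        + (LinearMap.lsmul (AddMonoidAlgebra ℂ X) (Std D)
          (demazure κ i g)).restrictScalars ℂ) fun w f => ?_) v
    simp only [LinearMap.comp_apply, LinearMap.add_apply, LinearMap.coe_restrictScalars,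
      LinearMap.lsmul_apply, Finsupp.smul_single, smul_eq_mul, leftOp_single, map_mul,
      demazure_mul, Finsupp.single_add, smul_add, mul_smul_comm]
    abel

/-- Associativity of `𝓗` cannot be invoked here, as the module is not yet known to be `𝓗`. If `w α_j
= ±α_i`, then `w s_j = s_i w` and the terms match by `W`-invariance of the labels. Otherwise,
multiplication by one reflection does not change the sign of the root that governs the coefficient
for the other. -/
theorem leftOp_rightOp_comm {i j : ι} (hi : i ∈ b.support) (hj : j ∈ b.support) (v : Std D) :
    leftOp b κ i (rightOp b κ j v) = rightOp b κ j (leftOp b κ i v) := by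
  refine DFunLike.congr_fun (std_linear_ext (φ := leftOp b κ i ∘ₗ rightOp b κ j)
    (φ' := rightOp b κ j ∘ₗ leftOp b κ i) fun w f => ?_) v
  simp only [LinearMap.comp_apply, leftOp_single, rightOp_single, map_add, map_smul, smul_add,
    mul_assoc]
  suffices h : leftC b κ i (w * refl D j) • Finsupp.single (w * refl D j) (wAct (refl D i) f)
      + rightC b κ j w • Finsupp.single (refl D i * w) (wAct (refl D i) f)
      = rightC b κ j (refl D i * w) • Finsupp.single (refl D i * w) (wAct (refl D i) f)
      + leftC b κ i w • Finsupp.single (w * refl D j) (wAct (refl D i) f) by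
    have h2 : rightC b κ j w • leftC b κ i w • Finsupp.single w (wAct (refl D i) f)
      = leftC b κ i w • rightC b κ j w • Finsupp.single w (wAct (refl D i) f) := smul_comm _ _ _
    rw [h2]
    have h3 := congrArg (fun z => z + (Finsupp.single (refl D i * (w * refl D j))
        (wAct (refl D i) f) + Finsupp.single (w * refl D j) (demazure κ i f)
        + leftC b κ i w • rightC b κ j w • Finsupp.single w (wAct (refl D i) f)
        + rightC b κ j w • Finsupp.single w (demazure κ i f))) h
    convert! h3 using 1 <;> abel
  by_cases h1 : w • j = i
  · have h2 : w * refl D j = refl D i * w := by rw [mul_refl_eq, h1]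
    have h3 : w⁻¹ • i = j := by rw [← h1, inv_smul_smul]
    have hc : κ.c i = κ.c j := by rw [← h1, κ.c_smul]
    have hp := isPos_of_mem hi
    have hp' := isPos_of_mem hj
    have h4 : b.IsPos ((w * refl D j)⁻¹ • i) ↔ ¬ b.IsPos j := by
      rw [mul_inv_rev, refl_inv, mul_smul, h3, isPos_neg_iff (refl_smul_self j)]
    have h5 : b.IsPos ((refl D i * w) • j) ↔ ¬ b.IsPos i := by
      rw [mul_smul, h1, isPos_neg_iff (refl_smul_self i)]
    rw [leftC_of_neg (fun h => h4.mp h hp'), rightC_of_pos (h1 ▸ hp),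
      rightC_of_neg (fun h => h5.mp h hp), leftC_of_pos (h3 ▸ hp'), hc, h2]
  by_cases h1' : w • j = negIdx (D := D) i
  · have h2 : w * refl D j = refl D i * w := by
      rw [mul_refl_eq, h1', refl_eq_of_root_neg (root_negIdx i)]
    have h3 : w⁻¹ • i = negIdx (D := D) j := by
      rw [← negIdx_negIdx (D := D) i, ← h1', ← negIdx_smul, inv_smul_smul]
    have hc : κ.c i = κ.c j := by
      rw [← κ.c_smul w j, h1', negIdx, κ.c_smul]
    have hp := isPos_of_mem hi
    have hp' := isPos_of_mem hj
    have h4 : b.IsPos ((w * refl D j)⁻¹ • i) ↔ b.IsPos j := by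
      rw [mul_inv_rev, refl_inv, mul_smul, h3, negIdx_smul, isPos_negIdx,
        isPos_neg_iff (refl_smul_self j), not_not]
    have h5 : b.IsPos ((refl D i * w) • j) ↔ b.IsPos i := by
      rw [mul_smul, h1', negIdx_smul, isPos_negIdx, isPos_neg_iff (refl_smul_self i), not_not]
    rw [leftC_of_pos (h4.mpr hp'), rightC_of_neg (h1' ▸ fun h => isPos_negIdx.mp h hp),
      rightC_of_pos (h5.mpr hp), leftC_of_neg (h3 ▸ fun h => isPos_negIdx.mp h hp'), hc, h2]
  · have key : ∀ {i : ι} (_ : i ∈ b.support) (k : ι), k ≠ i → k ≠ negIdx (D := D) i →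
        (b.IsPos (refl D i • k) ↔ b.IsPos k) := by
      intro i hi k hk hk'
      constructor
      · intro h
        have := isPos_refl_smul hi h (by
          intro h
          apply hk'
          rw [← refl_smul_smul (D := D) i k, h, negIdx])
        rwa [refl_smul_smul] at this
      · exact fun h => isPos_refl_smul hi h hk
    have h4 : b.IsPos ((w * refl D j)⁻¹ • i) ↔ b.IsPos (w⁻¹ • i) := by
      rw [mul_inv_rev, refl_inv, mul_smul]
      refine key hj _ ?_ ?_
      · intro h; exact h1 (by rw [← h, smul_inv_smul])
      · intro h; exact h1' (by
          rw [inv_smul_eq_iff, negIdx_smul] at h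
          rw [h, negIdx_negIdx])
    have h5 : b.IsPos ((refl D i * w) • j) ↔ b.IsPos (w • j) := by
      rw [mul_smul]
      exact key hi _ h1 h1'
    rw [leftC_congr h4, rightC_congr h5, add_comm]

end Standard

/-! ### Braid relations -/

/-- The alternating word `a b a ...` with `n` letters. -/
def alt {M : Type*} [Monoid M] (a b : M) : ℕ → M
  | 0 => 1
  | n + 1 => a * alt b a n

section InverseWords

variable {V : Type*} {a a' b b' : V → V} {S : Set V}

theorem inverse_braid_three (ha : ∀ v, a (a' v) = v) (ha' : ∀ v, a' (a v) = v)
    (hb : ∀ v, b (b' v) = v) (hb' : ∀ v, b' (b v) = v)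
    (hS : ∀ v ∈ S, a (b (a v)) = b (a (b v))) (hSa : ∀ v ∈ S, a' v ∈ S)
    (hSb : ∀ v ∈ S, b' v ∈ S) {v : V} (hv : v ∈ S) : a' (b' (a' v)) = b' (a' (b' v)) := by
  have h := hS _ (hSa _ (hSb _ (hSa _ hv)))
  rw [ha, hb, ha] at h
  have h2 := congrArg (fun z => b' (a' (b' z))) h
  simp only [hb', ha'] at h2
  exact h2.symm

theorem inverse_braid_four (ha : ∀ v, a (a' v) = v) (ha' : ∀ v, a' (a v) = v)
    (hb : ∀ v, b (b' v) = v) (hb' : ∀ v, b' (b v) = v)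
    (hS : ∀ v ∈ S, a (b (a (b v))) = b (a (b (a v)))) (hSa : ∀ v ∈ S, a' v ∈ S)
    (hSb : ∀ v ∈ S, b' v ∈ S) {v : V} (hv : v ∈ S) :
    a' (b' (a' (b' v))) = b' (a' (b' (a' v))) := by
  have h := hS _ (hSb _ (hSa _ (hSb _ (hSa _ hv))))
  rw [hb, ha, hb, ha] at h
  have h2 := congrArg (fun z => a' (b' (a' (b' z)))) h
  simp only [hb', ha'] at h2
  exact h2

theorem inverse_braid_six (ha : ∀ v, a (a' v) = v) (ha' : ∀ v, a' (a v) = v)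
    (hb : ∀ v, b (b' v) = v) (hb' : ∀ v, b' (b v) = v)
    (hS : ∀ v ∈ S, a (b (a (b (a (b v))))) = b (a (b (a (b (a v))))))
    (hSa : ∀ v ∈ S, a' v ∈ S) (hSb : ∀ v ∈ S, b' v ∈ S) {v : V} (hv : v ∈ S) :
    a' (b' (a' (b' (a' (b' v))))) = b' (a' (b' (a' (b' (a' v))))) := by
  have h := hS _ (hSb _ (hSa _ (hSb _ (hSa _ (hSb _ (hSa _ hv))))))
  rw [hb, ha, hb, ha, hb, ha] at h
  have h2 := congrArg (fun z => a' (b' (a' (b' (a' (b' z)))))) h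
  simp only [hb', ha'] at h2
  exact h2

end InverseWords

/-! ### Stability of the braid relations under multiplication by `θ_x` -/

section RankTwo

variable {ι X Y : Type u} [AddCommGroup X] [AddCommGroup Y] {D : RootPairing ι ℤ X Y}
  [Module.Free ℤ X] [Module.Finite ℤ X] {b : D.Base} {κ : Labels D}
  {V : Type*} [AddCommGroup V] [Module ℂ V] [Module (AddMonoidAlgebra ℂ X) V]
  [IsScalarTower ℂ (AddMonoidAlgebra ℂ X) V] {T : ι → Module.End ℂ V}

namespace BernsteinOps

/-- The inverse of `T i`. -/
def inv (κ : Labels D) (T : ι → Module.End ℂ V) (i : ι) : Module.End ℂ V :=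
  T i - κ.c i • LinearMap.id

theorem inv_apply (i : ι) (v : V) : inv κ T i v = T i v - κ.c i • v := rfl

variable (hT : BernsteinOps b κ T) {i j : ι} (hi : i ∈ b.support) (hj : j ∈ b.support)

include hT hi

theorem apply_inv (v : V) : T i (inv κ T i v) = v := by
  rw [inv_apply, map_sub, map_smul, hT.quad i hi]; abel

theorem inv_apply_self (v : V) : inv κ T i (T i v) = v := by
  rw [inv_apply, hT.quad i hi]; abel

theorem apply_of_zero {x : X} (h : cpair D x i = 0) (v : V) :
    T i (lat x • v) = lat x • T i v := by
  rw [hT.cross i hi, demazure_of_cpair_zero h, wAct_lat, refl_smul', h]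
  simp

/-- Pairing `-1` forces `c* = c`, and the whole correction term is absorbed by replacing `T i` with
its inverse. The rank two computations therefore work with lattice elements of pairing `0` or `-1`
wherever possible, and reduce to braid relations between inverses. -/
theorem apply_of_neg_one {x : X} (h : cpair D x i = -1) (v : V) :
    T i (lat x • v) = lat (x + D.root i) • inv κ T i v := by
  have hx : refl D i • x = x + D.root i := by rw [refl_smul', h]; module
  rw [hT.cross i hi, demazure_of_cpair_neg_one h, wAct_lat, hx, inv_apply, smul_sub,
    smul_assoc, neg_smul, smul_comm (κ.c i), sub_eq_add_neg]

theorem apply_neg_root (v : V) :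
    T i (lat (-D.root i) • v) = lat (D.root i) • inv κ T i v - κ.cStar i • v := by
  have hx : refl D i • (-D.root i) = D.root i := by
    rw [smul_neg, ← root_smul, refl_smul_self, neg_neg]
  rw [hT.cross i hi, demazure_neg_root, wAct_lat, hx, inv_apply, smul_sub, sub_smul,
    smul_assoc, smul_assoc, one_smul, neg_smul, smul_comm (κ.c i)]
  abel

end BernsteinOps

/-- A set of vectors is stable under the operators `T i`, `T j` and contains a reflected lattice
translate with each translate by a weight on which the reflection acts by `-1`. -/
structure StableSet (κ : Labels D) (T : ι → Module.End ℂ V) (i j : ι) (S : Set V) : Prop where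
  add_mem : ∀ v ∈ S, ∀ w ∈ S, v + w ∈ S
  smul_mem : ∀ (z : ℂ), ∀ v ∈ S, z • v ∈ S
  left : ∀ v ∈ S, T i v ∈ S
  right : ∀ v ∈ S, T j v ∈ S

namespace StableSet

variable {i j : ι} {S : Set V} (hS : StableSet κ T i j S)
include hS

theorem sub_mem {v w : V} (hv : v ∈ S) (hw : w ∈ S) : v - w ∈ S := by
  have := hS.add_mem v hv _ (hS.smul_mem (-1) w hw)
  rwa [neg_one_smul, ← sub_eq_add_neg] at this

theorem left_inv {v : V} (hv : v ∈ S) : BernsteinOps.inv κ T i v ∈ S :=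
  hS.sub_mem (hS.left v hv) (hS.smul_mem _ v hv)

theorem right_inv {v : V} (hv : v ∈ S) : BernsteinOps.inv κ T j v ∈ S :=
  hS.sub_mem (hS.right v hv) (hS.smul_mem _ v hv)

theorem symm : StableSet κ T j i S := ⟨hS.add_mem, hS.smul_mem, hS.right, hS.left⟩

end StableSet

/-- Multiplication by `θ_x` preserves `S`. -/
def LatStable (S : Set V) (x : X) : Prop := ∀ v ∈ S, lat x • v ∈ S

theorem LatStable.zero {S : Set V} : LatStable S (0 : X) := fun v hv => by
  rwa [lat_zero, one_smul]

theorem LatStable.add {S : Set V} {x y : X} (hx : LatStable S x) (hy : LatStable S y) :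
    LatStable S (x + y) := fun v hv => by
  rw [← lat_mul, mul_smul]; exact hx _ (hy _ hv)

theorem LatStable.zsmul {S : Set V} {x : X} (hx : LatStable S x) (hx' : LatStable S (-x))
    (n : ℤ) : LatStable S (n • x) := by
  have key : ∀ {y : X}, LatStable S y → ∀ n : ℕ, LatStable S (n • y) := by
    intro y hy n
    induction n with
    | zero => rw [zero_nsmul]; exact LatStable.zero
    | succ n ih => rw [succ_nsmul]; exact ih.add hy
  rcases Int.eq_nat_or_neg n with ⟨n, rfl | rfl⟩
  · rw [natCast_zsmul]; exact key hx n
  · rw [neg_smul, natCast_zsmul, ← smul_neg]; exact key hx' n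

variable {i j : ι} {S : Set V}

/-- Reflecting a weight whose pairing is `-1`. -/
theorem LatStable.reflect (hT : BernsteinOps b κ T) (hi : i ∈ b.support)
    (hS : StableSet κ T i j S) {x : X} (h : cpair D x i = -1) (hx : LatStable S x) :
    LatStable S (x + D.root i) := fun v hv => by
  have h1 := hT.apply_of_neg_one hi h (T i v)
  rw [hT.inv_apply_self hi] at h1
  rw [← h1]
  exact hS.left _ (hx _ (hS.left _ hv))

theorem LatStable.root (hT : BernsteinOps b κ T) (hi : i ∈ b.support)
    (hS : StableSet κ T i j S) (hx : LatStable S (-D.root i)) :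
    LatStable S (D.root i) := fun v hv => by
  have h1 := hT.apply_neg_root hi (T i v)
  rw [hT.inv_apply_self hi] at h1
  rw [← sub_add_cancel (lat (D.root i) • v) (κ.cStar i • T i v), ← h1]
  exact hS.add_mem _ (hS.left _ (hx _ (hS.left _ hv))) _ (hS.smul_mem _ _ (hS.left _ hv))

/-- The vectors on which the braid relation of length `m` holds. -/
def braidSet (T : ι → Module.End ℂ V) (i j : ι) (m : ℕ) : Set V :=
  {v | alt (T i) (T j) m v = alt (T j) (T i) m v}

theorem mem_braidSet {m : ℕ} {v : V} :
    v ∈ braidSet T i j m ↔ alt (T i) (T j) m v = alt (T j) (T i) m v := Iff.rfl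

theorem braidSet_comm {m : ℕ} : braidSet T i j m = braidSet T j i m := by
  ext v; exact eq_comm

/-- At `T i v`, one braid word ends in a square of `T i`, and the relation at `v` brings a square to
the front of the other word. Both are expanded by the quadratic relation. For even braid length both
are squares of the same operator. -/
theorem stableSet_braidSet_two (hT : BernsteinOps b κ T) (hi : i ∈ b.support)
    (hj : j ∈ b.support) : StableSet κ T i j (braidSet T i j 2) where
  add_mem v hv w hw := by
    rw [mem_braidSet] at hv hw ⊢; rw [map_add, map_add, hv, hw]
  smul_mem z v hv := by
    rw [mem_braidSet] at hv ⊢; rw [map_smul, map_smul, hv]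
  left v hv := by
    simp only [mem_braidSet, alt, Module.End.mul_apply, Module.End.one_apply] at hv ⊢
    rw [← hv, hT.quad i hi, hT.quad i hi, map_add, map_smul, hv]
  right v hv := by
    simp only [mem_braidSet, alt, Module.End.mul_apply, Module.End.one_apply] at hv ⊢
    rw [hv, hT.quad j hj, hT.quad j hj, map_add, map_smul, ← hv]

/-- For odd braid length one square is of `T i` and the other of `T j`, whence the condition on the
labels. -/
theorem stableSet_braidSet_three (hT : BernsteinOps b κ T) (hi : i ∈ b.support)
    (hj : j ∈ b.support) (hc : κ.c i = κ.c j) : StableSet κ T i j (braidSet T i j 3) where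
  add_mem v hv w hw := by
    rw [mem_braidSet] at hv hw ⊢; rw [map_add, map_add, hv, hw]
  smul_mem z v hv := by
    rw [mem_braidSet] at hv ⊢; rw [map_smul, map_smul, hv]
  left v hv := by
    simp only [mem_braidSet, alt, Module.End.mul_apply, Module.End.one_apply] at hv ⊢
    rw [hv, hT.quad i hi, hT.quad j hj, map_add, map_add, map_smul, map_smul, hv, hc]
  right v hv := by
    simp only [mem_braidSet, alt, Module.End.mul_apply, Module.End.one_apply] at hv ⊢
    rw [← hv, hT.quad j hj, hT.quad i hi, map_add, map_add, map_smul, map_smul, hv, hc]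

theorem stableSet_braidSet_four (hT : BernsteinOps b κ T) (hi : i ∈ b.support)
    (hj : j ∈ b.support) : StableSet κ T i j (braidSet T i j 4) where
  add_mem v hv w hw := by
    rw [mem_braidSet] at hv hw ⊢; rw [map_add, map_add, hv, hw]
  smul_mem z v hv := by
    rw [mem_braidSet] at hv ⊢; rw [map_smul, map_smul, hv]
  left v hv := by
    simp only [mem_braidSet, alt, Module.End.mul_apply, Module.End.one_apply] at hv ⊢
    rw [← hv, hT.quad i hi, hT.quad i hi]
    simp only [map_add, map_smul]
    rw [hv]
  right v hv := by
    simp only [mem_braidSet, alt, Module.End.mul_apply, Module.End.one_apply] at hv ⊢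
    rw [hv, hT.quad j hj, hT.quad j hj]
    simp only [map_add, map_smul]
    rw [hv]

theorem stableSet_braidSet_six (hT : BernsteinOps b κ T) (hi : i ∈ b.support)
    (hj : j ∈ b.support) : StableSet κ T i j (braidSet T i j 6) where
  add_mem v hv w hw := by
    rw [mem_braidSet] at hv hw ⊢; rw [map_add, map_add, hv, hw]
  smul_mem z v hv := by
    rw [mem_braidSet] at hv ⊢; rw [map_smul, map_smul, hv]
  left v hv := by
    simp only [mem_braidSet, alt, Module.End.mul_apply, Module.End.one_apply] at hv ⊢
    rw [← hv, hT.quad i hi, hT.quad i hi]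
    simp only [map_add, map_smul]
    rw [hv]
  right v hv := by
    simp only [mem_braidSet, alt, Module.End.mul_apply, Module.End.one_apply] at hv ⊢
    rw [hv, hT.quad j hj, hT.quad j hj]
    simp only [map_add, map_smul]
    rw [hv]

/-- Once `±α_i` and `±α_j` are known to be harmless, only representatives modulo the lattice they
span remain to be examined. -/
theorem latStable_of_translate {x : X} (hi : LatStable S (D.root i))
    (hi' : LatStable S (-D.root i)) (hj : LatStable S (D.root j)) (hj' : LatStable S (-D.root j))
    (m n : ℤ) (h : LatStable S (x + m • D.root i + n • D.root j)) : LatStable S x := by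
  have h2 := (h.add (hi.zsmul hi' (-m))).add (hj.zsmul hj' (-n))
  rwa [show x + m • D.root i + n • D.root j + -m • D.root i + -n • D.root j = x by module] at h2

theorem cpair_translate (x : X) (m n : ℤ) (k : ι) :
    cpair D (x + m • D.root i + n • D.root j) k
      = cpair D x k + m * cpair D (D.root i) k + n * cpair D (D.root j) k := by
  rw [cpair_add, cpair_add, cpair_zsmul, cpair_zsmul]

theorem alt_of_cpair_zero (hT : BernsteinOps b κ T) (hi : i ∈ b.support)
    (hj : j ∈ b.support) {x : X} (h1 : cpair D x i = 0) (h2 : cpair D x j = 0) (m : ℕ) (v : V) :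
    alt (T i) (T j) m (lat x • v) = lat x • alt (T i) (T j) m v := by
  induction m generalizing i j with
  | zero => rfl
  | succ m ih =>
    simp only [alt, Module.End.mul_apply]
    rw [ih hj hi h2 h1, hT.apply_of_zero hi h1]

theorem LatStable.of_cpair_zero (hT : BernsteinOps b κ T) (hi : i ∈ b.support)
    (hj : j ∈ b.support) {x : X} (h1 : cpair D x i = 0) (h2 : cpair D x j = 0) {m : ℕ} :
    LatStable (braidSet T i j m) x := fun v hv => by
  rw [mem_braidSet] at hv ⊢
  rw [alt_of_cpair_zero hT hi hj h1 h2, alt_of_cpair_zero hT hj hi h2 h1, hv]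

theorem BernsteinOps.apply_of_neg_one' (hT : BernsteinOps b κ T) (hi : i ∈ b.support) {x y : X}
    (h : cpair D x i = -1) (hy : y = x + D.root i) (v : V) :
    T i (lat x • v) = lat y • inv κ T i v := by
  rw [hy, hT.apply_of_neg_one hi h]

theorem latStable_two (hT : BernsteinOps b κ T) (hi : i ∈ b.support) (hj : j ∈ b.support)
    (hij : cpair D (D.root i) j = 0) (hji : cpair D (D.root j) i = 0) (x : X) :
    LatStable (braidSet T i j 2) x := by
  have hii := cpair_self (D := D) i
  have hjj := cpair_self (D := D) j
  have hSi := stableSet_braidSet_two hT hi hj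
  have key : ∀ {i j : ι}, i ∈ b.support → j ∈ b.support → cpair D (D.root i) j = 0 →
      LatStable (braidSet T i j 2) (-D.root i) := by
    intro i j hi hj hij v hv
    have hij' : cpair D (-D.root i) j = 0 := by rw [cpair_neg, hij, neg_zero]
    simp only [mem_braidSet, alt, Module.End.mul_apply, Module.End.one_apply] at hv ⊢
    rw [hT.apply_of_zero hj hij', hT.apply_neg_root hi, hT.apply_neg_root hi, map_sub, LinearMap.map_smul,
      hT.apply_of_zero hj hij, BernsteinOps.inv_apply, BernsteinOps.inv_apply, map_sub, LinearMap.map_smul,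
      hv]
  have key2 : ∀ {i j : ι}, i ∈ b.support → j ∈ b.support → cpair D (D.root i) j = 0 →
      ∀ x, cpair D x i = -1 → cpair D x j = 0 → LatStable (braidSet T i j 2) x := by
    intro i j hi hj hij x h1 h2 v hv
    have h3 : cpair D (x + D.root i) j = 0 := by rw [cpair_add, h2, hij, add_zero]
    simp only [mem_braidSet, alt, Module.End.mul_apply, Module.End.one_apply] at hv ⊢
    rw [hT.apply_of_zero hj h2, hT.apply_of_neg_one hi h1, hT.apply_of_neg_one hi h1,
      hT.apply_of_zero hj h3, BernsteinOps.inv_apply, BernsteinOps.inv_apply, map_sub, LinearMap.map_smul,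
      hv]
  have h1 := key hi hj hij
  have h2 := key hj hi hji
  rw [braidSet_comm] at h2
  -- Adding `α_i` changes only the pairing with `i`, by `2`, and similarly for `j`. So both pairings
  -- can be brought into `{0, -1}`.
  refine latStable_of_translate (i := i) (j := j) (.root hT hi hSi h1) h1
    (.root hT hj hSi.symm h2) h2 (-((cpair D x i + 1) / 2)) (-((cpair D x j + 1) / 2)) ?_
  set y := x + -((cpair D x i + 1) / 2) • D.root i + -((cpair D x j + 1) / 2) • D.root j with hy
  have hyi : cpair D y i = 0 ∨ cpair D y i = -1 := by
    rw [hy, cpair_translate, hii, hji]; omega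
  have hyj : cpair D y j = 0 ∨ cpair D y j = -1 := by
    rw [hy, cpair_translate, hjj, hij]; omega
  rcases hyi with hyi | hyi <;> rcases hyj with hyj | hyj
  · exact .of_cpair_zero hT hi hj hyi hyj
  · rw [braidSet_comm]; exact key2 hj hi hji y hyj hyi
  · exact key2 hi hj hij y hyi hyj
  · intro v hv
    have h3 : cpair D (y + D.root i) j = -1 := by rw [cpair_add, hyj, hij, add_zero]
    have h4 : cpair D (y + D.root j) i = -1 := by rw [cpair_add, hyi, hji, add_zero]
    simp only [mem_braidSet, alt, Module.End.mul_apply, Module.End.one_apply] at hv ⊢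
    rw [hT.apply_of_neg_one hj hyj, hT.apply_of_neg_one hi h4, hT.apply_of_neg_one hi hyi,
      hT.apply_of_neg_one hj h3]
    simp only [BernsteinOps.inv_apply, map_sub, LinearMap.map_smul, hv, smul_sub]
    rw [add_right_comm, smul_comm (κ.c i) (κ.c j)]
    abel

theorem inverse_braidSet_three (hT : BernsteinOps b κ T) (hi : i ∈ b.support)
    (hj : j ∈ b.support) (hc : κ.c i = κ.c j) {v : V} (hv : v ∈ braidSet T i j 3) :
    BernsteinOps.inv κ T i (BernsteinOps.inv κ T j (BernsteinOps.inv κ T i v))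
      = BernsteinOps.inv κ T j (BernsteinOps.inv κ T i (BernsteinOps.inv κ T j v)) :=
  have hS := stableSet_braidSet_three hT hi hj hc
  inverse_braid_three (hT.apply_inv hi) (hT.inv_apply_self hi) (hT.apply_inv hj)
    (hT.inv_apply_self hj) (fun v hv => by simpa [mem_braidSet, alt] using hv)
    (fun _ hv => hS.left_inv hv) (fun _ hv => hS.right_inv hv) hv

theorem inverse_braidSet_four (hT : BernsteinOps b κ T) (hi : i ∈ b.support)
    (hj : j ∈ b.support) {v : V} (hv : v ∈ braidSet T i j 4) :
    BernsteinOps.inv κ T i (BernsteinOps.inv κ T j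
        (BernsteinOps.inv κ T i (BernsteinOps.inv κ T j v)))
      = BernsteinOps.inv κ T j (BernsteinOps.inv κ T i
        (BernsteinOps.inv κ T j (BernsteinOps.inv κ T i v))) :=
  have hS := stableSet_braidSet_four hT hi hj
  inverse_braid_four (hT.apply_inv hi) (hT.inv_apply_self hi) (hT.apply_inv hj)
    (hT.inv_apply_self hj) (fun v hv => by simpa [mem_braidSet, alt] using hv)
    (fun _ hv => hS.left_inv hv) (fun _ hv => hS.right_inv hv) hv

theorem inverse_braidSet_six (hT : BernsteinOps b κ T) (hi : i ∈ b.support)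
    (hj : j ∈ b.support) {v : V} (hv : v ∈ braidSet T i j 6) :
    BernsteinOps.inv κ T i (BernsteinOps.inv κ T j (BernsteinOps.inv κ T i
        (BernsteinOps.inv κ T j (BernsteinOps.inv κ T i (BernsteinOps.inv κ T j v)))))
      = BernsteinOps.inv κ T j (BernsteinOps.inv κ T i (BernsteinOps.inv κ T j
        (BernsteinOps.inv κ T i (BernsteinOps.inv κ T j (BernsteinOps.inv κ T i v))))) :=
  have hS := stableSet_braidSet_six hT hi hj
  inverse_braid_six (hT.apply_inv hi) (hT.inv_apply_self hi) (hT.apply_inv hj)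
    (hT.inv_apply_self hj) (fun v hv => by simpa [mem_braidSet, alt] using hv)
    (fun _ hv => hS.left_inv hv) (fun _ hv => hS.right_inv hv) hv

theorem latStable_three_fundamental (hT : BernsteinOps b κ T) (hi : i ∈ b.support)
    (hj : j ∈ b.support) (hc : κ.c i = κ.c j) (hij : cpair D (D.root i) j = -1)
    (hji : cpair D (D.root j) i = -1) {y : X} (hyi : cpair D y i = -1) (hyj : cpair D y j = 0) :
    LatStable (braidSet T i j 3) y := by
  intro v hv
  have hS := stableSet_braidSet_three hT hi hj hc
  have h1 : cpair D (y + D.root i) j = -1 := by rw [cpair_add, hyj, hij]; norm_num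
  have h2 : cpair D (y + D.root i + D.root j) i = 0 := by
    rw [cpair_add, cpair_add, hyi, hji, cpair_self]; norm_num
  -- The mixed word that is needed comes from the relation between inverses at `T j v`, followed by
  -- `T i`: one inverse cancels on each side.
  have h3 := congrArg (T i) (inverse_braidSet_three hT hi hj hc (hS.right v hv))
  rw [hT.inv_apply_self hj, hT.apply_inv hi] at h3
  simp only [mem_braidSet, alt, Module.End.mul_apply, Module.End.one_apply]
  rw [hT.apply_of_neg_one hi hyi, hT.apply_of_neg_one hj h1, hT.apply_of_zero hi h2,
    hT.apply_of_zero hj hyj, hT.apply_of_neg_one hi hyi, hT.apply_of_neg_one hj h1, h3]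

/-- Type `A₂`. The element `-(α_i + α_j)` pairs to `-1` with both coroots and gives the first stable
translation. Reflecting it produces `-α_i` and `-α_j`, hence the lattice they span. -/
theorem latStable_three (hT : BernsteinOps b κ T) (hi : i ∈ b.support) (hj : j ∈ b.support)
    (hc : κ.c i = κ.c j) (hc' : κ.cStar i = κ.cStar j)
    (hij : cpair D (D.root i) j = -1) (hji : cpair D (D.root j) i = -1) (x : X) :
    LatStable (braidSet T i j 3) x := by
  have hii := cpair_self (D := D) i
  have hjj := cpair_self (D := D) j
  have hS := stableSet_braidSet_three hT hi hj hc
  have h1 : cpair D (-(D.root i + D.root j)) i = -1 := by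
    rw [cpair_neg, cpair_add, hii, hji]; norm_num
  have h2 : cpair D (-(D.root i + D.root j)) j = -1 := by
    rw [cpair_neg, cpair_add, hjj, hij]; norm_num
  have key : LatStable (braidSet T i j 3) (-(D.root i + D.root j)) := fun v hv => by
    simp only [mem_braidSet, alt, Module.End.mul_apply, Module.End.one_apply]
    rw [hT.apply_of_neg_one' hi h1 (y := -D.root j) (by abel), hT.apply_neg_root hj, map_sub,
      hT.apply_of_neg_one' hi hji (y := D.root i + D.root j) (by abel),
      hT.apply_of_neg_one' hj h2 (y := -D.root i) (by abel), hT.apply_neg_root hi, map_sub,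
      hT.apply_of_neg_one' hj hij (y := D.root i + D.root j) (by abel), LinearMap.map_smul,
      LinearMap.map_smul, hT.apply_inv hi, hT.apply_inv hj,
      inverse_braidSet_three hT hi hj hc hv, hc']
  have hj' := LatStable.reflect hT hi hS h1 key
  rw [show -(D.root i + D.root j) + D.root i = -D.root j by abel] at hj'
  have hi' := LatStable.reflect hT hj hS.symm h2 key
  rw [show -(D.root i + D.root j) + D.root j = -D.root i by abel] at hi'
  obtain ⟨m, n, h⟩ : ∃ m n : ℤ,
      (cpair D (x + m • D.root i + n • D.root j) i = 0 ∧
        cpair D (x + m • D.root i + n • D.root j) j = 0) ∨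
      (cpair D (x + m • D.root i + n • D.root j) i = -1 ∧
        cpair D (x + m • D.root i + n • D.root j) j = 0) ∨
      (cpair D (x + m • D.root i + n • D.root j) i = 0 ∧
        cpair D (x + m • D.root i + n • D.root j) j = -1) := by
    simp only [cpair_translate, hii, hji, hjj, hij]
    -- This residue is the class of `x` in the quotient, of order three, of the weight lattice of
    -- `A₂` by its root lattice.
    have h : (cpair D x i + 2 * cpair D x j) % 3 = 0 ∨ (cpair D x i + 2 * cpair D x j) % 3 = 1 ∨
      (cpair D x i + 2 * cpair D x j) % 3 = 2 := by omega
    set k := (cpair D x i + 2 * cpair D x j) / 3 with hk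
    rcases h with h | h | h
    · exact ⟨cpair D x j - 2 * k, -k, Or.inl (by omega)⟩
    · exact ⟨cpair D x j - 2 * k - 1, -k - 1, Or.inr (Or.inr (by omega))⟩
    · exact ⟨cpair D x j - 2 * (k + 1), -(k + 1), Or.inr (Or.inl (by omega))⟩
  refine latStable_of_translate (.root hT hi hS hi') hi' (.root hT hj hS.symm hj') hj' m n ?_
  rcases h with ⟨h3, h4⟩ | ⟨h3, h4⟩ | ⟨h3, h4⟩
  · exact .of_cpair_zero hT hi hj h3 h4
  · exact latStable_three_fundamental hT hi hj hc hij hji h3 h4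
  · rw [braidSet_comm]
    exact latStable_three_fundamental hT hj hi hc.symm hji hij h4 h3

/-- Type `B₂`. The starting point is the short root `-(α_i + α_j)`, with pairings `0` and `-1`. The
root lattice has index two in the weight lattice, which leaves the representatives with pairings
`(0, 0)` and `(-1, 0)`. -/
theorem latStable_four (hT : BernsteinOps b κ T) (hi : i ∈ b.support) (hj : j ∈ b.support)
    (hij : cpair D (D.root i) j = -1) (hji : cpair D (D.root j) i = -2) (x : X) :
    LatStable (braidSet T i j 4) x := by
  have hii := cpair_self (D := D) i
  have hjj := cpair_self (D := D) j
  have hS := stableSet_braidSet_four hT hi hj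
  have h1 : cpair D (-(D.root i + D.root j)) i = 0 := by
    rw [cpair_neg, cpair_add, hii, hji]; norm_num
  have h1' : cpair D (D.root i + D.root j) i = 0 := by
    rw [cpair_add, hii, hji]; norm_num
  have h2 : cpair D (-(D.root i + D.root j)) j = -1 := by
    rw [cpair_neg, cpair_add, hjj, hij]; norm_num
  have key : LatStable (braidSet T i j 4) (-(D.root i + D.root j)) := fun v hv => by
    have h3 := congrArg (T i) (inverse_braidSet_four hT hi hj (hS.left v hv))
    rw [hT.inv_apply_self hi, hT.apply_inv hi] at h3
    simp only [mem_braidSet, alt, Module.End.mul_apply, Module.End.one_apply]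
    rw [hT.apply_of_zero hi h1]
    simp only [hT.apply_of_neg_one' hj h2 (y := -D.root i) (by abel), hT.apply_neg_root hi, map_sub,
      hT.apply_of_neg_one' hj hij (y := D.root i + D.root j) (by abel), LinearMap.map_smul,
      hT.apply_inv hj, hT.apply_of_zero hi h1', h3]
  have hi' := LatStable.reflect hT hj hS.symm h2 key
  rw [show -(D.root i + D.root j) + D.root j = -D.root i by abel] at hi'
  have hri := LatStable.root hT hi hS hi'
  have hrj := (LatStable.reflect hT hj hS.symm hij hri).add hi'
  rw [show D.root i + D.root j + -D.root i = D.root j by abel] at hrj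
  have hj' := key.add hri
  rw [show -(D.root i + D.root j) + D.root i = -D.root j by abel] at hj'
  obtain ⟨m, n, h⟩ : ∃ m n : ℤ,
      (cpair D (x + m • D.root i + n • D.root j) i = 0 ∨
        cpair D (x + m • D.root i + n • D.root j) i = -1) ∧
      cpair D (x + m • D.root i + n • D.root j) j = 0 := by
    simp only [cpair_translate, hii, hji, hjj, hij]
    set k := (cpair D x i + 2 * cpair D x j + 1) / 2 with hk
    exact ⟨cpair D x j - 2 * k, -k, by omega⟩
  refine latStable_of_translate hri hi' hrj hj' m n ?_
  set y := x + m • D.root i + n • D.root j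
  obtain ⟨hyi | hyi, hyj⟩ := h
  · exact .of_cpair_zero hT hi hj hyi hyj
  · intro v hv
    have h3 : cpair D (y + D.root i) j = -1 := by rw [cpair_add, hyj, hij]; norm_num
    have h4 : cpair D (y + D.root i + D.root j) i = -1 := by
      rw [cpair_add, cpair_add, hyi, hji, hii]; norm_num
    have h5 : cpair D (y + D.root i + D.root j + D.root i) j = 0 := by
      rw [cpair_add, cpair_add, h3, hij, hjj]; norm_num
    have h6 := congrArg (T j) (inverse_braidSet_four hT hi hj (hS.right v hv))
    rw [hT.inv_apply_self hj, hT.apply_inv hj] at h6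
    simp only [mem_braidSet, alt, Module.End.mul_apply, Module.End.one_apply]
    rw [hT.apply_of_zero hj hyj]
    simp only [hT.apply_of_neg_one hi hyi, hT.apply_of_neg_one hj h3, hT.apply_of_neg_one hi h4,
      hT.apply_of_zero hj h5, h6]

/-- Type `G₂`. The starting point is the short root `-(2 α_i + α_j)`, with pairings `-1` and `0`.
The Cartan matrix has determinant one, so every `x` can be translated by roots to an element with
both pairings zero, and no other representative is needed. -/
theorem latStable_six (hT : BernsteinOps b κ T) (hi : i ∈ b.support) (hj : j ∈ b.support)
    (hij : cpair D (D.root i) j = -1) (hji : cpair D (D.root j) i = -3) (x : X) :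
    LatStable (braidSet T i j 6) x := by
  have hii := cpair_self (D := D) i
  have hjj := cpair_self (D := D) j
  have hS := stableSet_braidSet_six hT hi hj
  have h1 : cpair D (-(D.root i + D.root j + D.root i)) i = -1 := by
    rw [cpair_neg, cpair_add, cpair_add, hii, hji]; norm_num
  have h2 : cpair D (-(D.root i + D.root j + D.root i)) j = 0 := by
    rw [cpair_neg, cpair_add, cpair_add, hjj, hij]; norm_num
  have h2' : cpair D (D.root i + D.root j + D.root i) j = 0 := by
    rw [cpair_add, cpair_add, hjj, hij]; norm_num
  have h3 : cpair D (-(D.root i + D.root j)) j = -1 := by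
    rw [cpair_neg, cpair_add, hjj, hij]; norm_num
  have h4 : cpair D (D.root i + D.root j) i = -1 := by
    rw [cpair_add, hii, hji]; norm_num
  have key : LatStable (braidSet T i j 6) (-(D.root i + D.root j + D.root i)) := fun v hv => by
    have h5 := congrArg (T j) (inverse_braidSet_six hT hi hj (hS.right v hv))
    rw [hT.inv_apply_self hj, hT.apply_inv hj] at h5
    simp only [mem_braidSet, alt, Module.End.mul_apply, Module.End.one_apply]
    rw [hT.apply_of_zero hj h2]
    simp only [hT.apply_of_neg_one' hi h1 (y := -(D.root i + D.root j)) (by abel),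
      hT.apply_of_neg_one' hj h3 (y := -D.root i) (by abel), hT.apply_neg_root hi, map_sub,
      hT.apply_of_neg_one' hj hij (y := D.root i + D.root j) (by abel), LinearMap.map_smul,
      hT.apply_inv hj, hT.apply_of_neg_one hi h4, hT.apply_inv hi, hT.apply_of_zero hj h2', h5]
  have hi' := LatStable.reflect hT hi hS h1 key
  rw [show -(D.root i + D.root j + D.root i) + D.root i = -(D.root i + D.root j) by abel] at hi'
  have hij' := hi'
  replace hi' := LatStable.reflect hT hj hS.symm h3 hi'
  rw [show -(D.root i + D.root j) + D.root j = -D.root i by abel] at hi'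
  have hri := LatStable.root hT hi hS hi'
  have hrj := (LatStable.reflect hT hj hS.symm hij hri).add hi'
  rw [show D.root i + D.root j + -D.root i = D.root j by abel] at hrj
  have hj' := hij'.add hri
  rw [show -(D.root i + D.root j) + D.root i = -D.root j by abel] at hj'
  refine latStable_of_translate hri hi' hrj hj'
    (cpair D x j - 2 * (cpair D x i + 2 * cpair D x j)) (-(cpair D x i + 2 * cpair D x j)) ?_
  refine .of_cpair_zero hT hi hj ?_ ?_ <;>
  · simp only [cpair_translate, hii, hji, hjj, hij]; ring

end RankTwo

/-! ### Rank two root systems -/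

section Dihedral

variable {ι X Y : Type u} [AddCommGroup X] [AddCommGroup Y] {D : RootPairing ι ℤ X Y}

/-- The alternating list `i, j, i, ...` of length `n`. -/
def altList (i j : ι) : ℕ → List ι
  | 0 => []
  | n + 1 => i :: altList j i n

theorem length_altList (i j : ι) (n : ℕ) : (altList i j n).length = n := by
  induction n generalizing i j with
  | zero => rfl
  | succ n ih => simp [altList, ih]

theorem prod_map_altList {M : Type*} [Monoid M] (T : ι → M) (i j : ι) (n : ℕ) :
    ((altList i j n).map T).prod = alt (T i) (T j) n := by
  induction n generalizing i j with
  | zero => rfl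
  | succ n ih => simp [altList, alt, ih]

theorem mem_altList {i j k : ι} {n : ℕ} (h : k ∈ altList i j n) : k = i ∨ k = j := by
  induction n generalizing i j with
  | zero => simp [altList] at h
  | succ n ih =>
    rcases List.mem_cons.mp h with h | h
    · exact Or.inl h
    · exact (ih h).symm

/-- The roots `i, s_i j, s_i s_j i, ...`. -/
def chain (D : RootPairing ι ℤ X Y) (i j : ι) : ℕ → ι
  | 0 => i
  | n + 1 => refl D i • chain D j i n

variable {b : D.Base} [Finite ι] [D.IsReduced]

/-- The roots of the chain are the ones that make the successive letters of the alternating word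
left descents, so each letter stripped from `w` lowers the length by one. -/
theorem len_of_chain {i j : ι} (hi : i ∈ b.support) (hj : j ∈ b.support) {n : ℕ}
    {w : D.weylGroup} (h : ∀ k < n, ¬ b.IsPos (w⁻¹ • chain D i j k)) :
    len b w = n + len b ((alt (refl D i) (refl D j) n)⁻¹ * w) := by
  induction n generalizing i j w with
  | zero => simp [alt]
  | succ n ih =>
    have h1 := ih hj hi (w := refl D i * w) fun k hk => by
      rw [mul_inv_rev, refl_inv, mul_smul]
      exact h (k + 1) (by omega)
    have h2 := len_refl_mul_of_neg hi (h 0 (by omega))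
    rw [alt, mul_inv_rev, refl_inv, mul_assoc]
    omega

/-- `s_i` and `s_j` satisfy the braid relation of length `m`, and the roots that are made negative by
the longest element of the subgroup they generate are nonnegative combinations of `i` and `j`. -/
structure Dihedral (b : D.Base) (i j : ι) (m : ℕ) : Prop where
  pos : 0 < m
  braid : alt (refl D i) (refl D j) m = alt (refl D j) (refl D i) m
  left : ∀ w : D.weylGroup, ¬ b.IsPos (w • i) → ¬ b.IsPos (w • j) →
    ∀ k < m, ¬ b.IsPos (w • chain D i j k)
  right : ∀ w : D.weylGroup, ¬ b.IsPos (w • i) → ¬ b.IsPos (w • j) →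
    ∀ k < m, ¬ b.IsPos (w • chain D j i k)

theorem Dihedral.symm {i j : ι} {m : ℕ} (h : Dihedral b i j m) : Dihedral b j i m :=
  ⟨h.pos, h.braid.symm, fun w hi hj => h.right w hj hi, fun w hi hj => h.left w hj hi⟩

/-- Since `w_Δ` makes both `i` and `j` negative, stripping `k` letters from it lowers the length by
`k`. Complements in `w_Δ` have complementary length, so the word that was removed has length `k`. -/
theorem Dihedral.len_alt {i j : ι} (hi : i ∈ b.support) (hj : j ∈ b.support) {m : ℕ}
    (h : Dihedral b i j m) {k : ℕ} (hk : k ≤ m) : len b (alt (refl D i) (refl D j) k) = k := by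
  set w := longest b (b.support : Set ι) with hw
  have hs : (b.support : Set ι) ⊆ b.support := le_rfl
  have hinv : w⁻¹ = w := longest_inv hs
  have h1 := len_of_chain (b := b) hi hj (n := k) (w := w) fun l hl => by
    rw [hinv]
    exact h.left w (not_isPos_longest_smul hs hi) (not_isPos_longest_smul hs hj) l (by omega)
  have h2 := len_longest_mul hs (mem_parabolicWeyl_support (b := b)
    ((alt (refl D i) (refl D j) k)⁻¹ * w)⁻¹)
  rw [len_inv, mul_inv_rev, inv_inv, ← hw, mul_inv_cancel_left] at h2
  omega

theorem not_isPos_comb {w : D.weylGroup} {i j k : ι} (hi : ¬ b.IsPos (w • i))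
    (hj : ¬ b.IsPos (w • j)) {m n : ℤ} (hm : 0 ≤ m) (hn : 0 ≤ n)
    (h : D.root k = m • D.root i + n • D.root j) : ¬ b.IsPos (w • k) := by
  rw [← isPos_negIdx] at hi hj ⊢
  refine isPos_comb hi hj hm hn ?_
  rw [root_negIdx, root_negIdx, root_negIdx, root_smul, root_smul, root_smul, h, smul_add,
    smul_zsmul', smul_zsmul', neg_add, smul_neg, smul_neg]

theorem root_refl_smul (i k : ι) :
    D.root (refl D i • k) = D.root k - cpair D (D.root k) i • D.root i := by
  rw [root_smul, refl_smul']

theorem root_refl_comb {i j k : ι} {m n a : ℤ} (h : D.root k = m • D.root j + n • D.root i)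
    (ha : cpair D (D.root j) i = a) :
    D.root (refl D i • k) = (-n - m * a) • D.root i + m • D.root j := by
  rw [root_refl_smul, h, cpair_add, cpair_zsmul, cpair_zsmul, ha, cpair_self]
  module

section Cases

variable {i j : ι}

theorem dihedral_two (hij : cpair D (D.root i) j = 0) (hji : cpair D (D.root j) i = 0) :
    Dihedral b i j 2 := by
  have c0 : D.root (chain D i j 0) = (1 : ℤ) • D.root i + (0 : ℤ) • D.root j := by simp [chain]
  have d0 : D.root (chain D j i 0) = (1 : ℤ) • D.root j + (0 : ℤ) • D.root i := by simp [chain]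
  have c1 : D.root (chain D i j 1) = (0 : ℤ) • D.root i + (1 : ℤ) • D.root j :=
    root_refl_comb d0 hji
  have d1 : D.root (chain D j i 1) = (0 : ℤ) • D.root j + (1 : ℤ) • D.root i :=
    root_refl_comb c0 hij
  refine ⟨by norm_num, ?_, ?_, ?_⟩
  · have h : refl D i • j = j := root_injective (D := D) (by rw [show refl D i • j = chain D i j 1 from rfl, c1]; simp)
    simp only [alt, mul_one]
    rw [mul_refl_eq, h]
  · intro w hi hj k hk
    interval_cases k
    · exact not_isPos_comb hi hj (by norm_num) (by norm_num) c0
    · exact not_isPos_comb hi hj (by norm_num) (by norm_num) c1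
  · intro w hi hj k hk
    interval_cases k
    · exact not_isPos_comb hj hi (by norm_num) (by norm_num) d0
    · exact not_isPos_comb hj hi (by norm_num) (by norm_num) d1

theorem dihedral_three (hij : cpair D (D.root i) j = -1) (hji : cpair D (D.root j) i = -1) :
    Dihedral b i j 3 := by
  have c0 : D.root (chain D i j 0) = (1 : ℤ) • D.root i + (0 : ℤ) • D.root j := by simp [chain]
  have d0 : D.root (chain D j i 0) = (1 : ℤ) • D.root j + (0 : ℤ) • D.root i := by simp [chain]
  have c1 : D.root (chain D i j 1) = (1 : ℤ) • D.root i + (1 : ℤ) • D.root j :=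
    root_refl_comb d0 hji
  have d1 : D.root (chain D j i 1) = (1 : ℤ) • D.root j + (1 : ℤ) • D.root i :=
    root_refl_comb c0 hij
  have c2 : D.root (chain D i j 2) = (0 : ℤ) • D.root i + (1 : ℤ) • D.root j :=
    root_refl_comb d1 hji
  have d2 : D.root (chain D j i 2) = (0 : ℤ) • D.root j + (1 : ℤ) • D.root i :=
    root_refl_comb c1 hij
  refine ⟨by norm_num, ?_, ?_, ?_⟩
  · have h : refl D i • j = refl D j • i := root_injective (D := D) (by
      rw [show refl D i • j = chain D i j 1 from rfl, c1,
        show refl D j • i = chain D j i 1 from rfl, d1, add_comm])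
    have h1 := refl_conj (refl D i) j
    have h2 := refl_conj (refl D j) i
    rw [refl_inv] at h1 h2
    simp only [alt, mul_one, ← mul_assoc]
    rw [h1, h2, h]
  · intro w hi hj k hk
    interval_cases k
    · exact not_isPos_comb hi hj (by norm_num) (by norm_num) c0
    · exact not_isPos_comb hi hj (by norm_num) (by norm_num) c1
    · exact not_isPos_comb hi hj (by norm_num) (by norm_num) c2
  · intro w hi hj k hk
    interval_cases k
    · exact not_isPos_comb hj hi (by norm_num) (by norm_num) d0
    · exact not_isPos_comb hj hi (by norm_num) (by norm_num) d1
    · exact not_isPos_comb hj hi (by norm_num) (by norm_num) d2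

theorem dihedral_four (hij : cpair D (D.root i) j = -1) (hji : cpair D (D.root j) i = -2) :
    Dihedral b i j 4 := by
  have c0 : D.root (chain D i j 0) = (1 : ℤ) • D.root i + (0 : ℤ) • D.root j := by simp [chain]
  have d0 : D.root (chain D j i 0) = (1 : ℤ) • D.root j + (0 : ℤ) • D.root i := by simp [chain]
  have c1 : D.root (chain D i j 1) = (2 : ℤ) • D.root i + (1 : ℤ) • D.root j :=
    root_refl_comb d0 hji
  have d1 : D.root (chain D j i 1) = (1 : ℤ) • D.root j + (1 : ℤ) • D.root i :=
    root_refl_comb c0 hij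
  have c2 : D.root (chain D i j 2) = (1 : ℤ) • D.root i + (1 : ℤ) • D.root j :=
    root_refl_comb d1 hji
  have d2 : D.root (chain D j i 2) = (1 : ℤ) • D.root j + (2 : ℤ) • D.root i :=
    root_refl_comb c1 hij
  have c3 : D.root (chain D i j 3) = (0 : ℤ) • D.root i + (1 : ℤ) • D.root j :=
    root_refl_comb d2 hji
  have d3 : D.root (chain D j i 3) = (0 : ℤ) • D.root j + (1 : ℤ) • D.root i :=
    root_refl_comb c2 hij
  refine ⟨by norm_num, ?_, ?_, ?_⟩
  -- Since `s_i` fixes the root `s_j α_i`, it commutes with the reflection `s_j s_i s_j`.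
  · have h : refl D i • (refl D j • i) = refl D j • i := root_injective (D := D) (by
      rw [show refl D i • (refl D j • i) = chain D i j 2 from rfl, c2,
        show refl D j • i = chain D j i 1 from rfl, d1]
      module)
    have h1 := refl_conj (refl D j) i
    rw [refl_inv] at h1
    simp only [alt, mul_one]
    rw [← mul_assoc (refl D j), ← mul_assoc (refl D j) (refl D i) (_ * _),
      ← mul_assoc (refl D j * refl D i), h1, mul_refl_eq (refl D i), h]
  · intro w hi hj k hk
    interval_cases k
    · exact not_isPos_comb hi hj (by norm_num) (by norm_num) c0
    · exact not_isPos_comb hi hj (by norm_num) (by norm_num) c1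
    · exact not_isPos_comb hi hj (by norm_num) (by norm_num) c2
    · exact not_isPos_comb hi hj (by norm_num) (by norm_num) c3
  · intro w hi hj k hk
    interval_cases k
    · exact not_isPos_comb hj hi (by norm_num) (by norm_num) d0
    · exact not_isPos_comb hj hi (by norm_num) (by norm_num) d1
    · exact not_isPos_comb hj hi (by norm_num) (by norm_num) d2
    · exact not_isPos_comb hj hi (by norm_num) (by norm_num) d3

theorem dihedral_six (hij : cpair D (D.root i) j = -1) (hji : cpair D (D.root j) i = -3) :
    Dihedral b i j 6 := by
  have c0 : D.root (chain D i j 0) = (1 : ℤ) • D.root i + (0 : ℤ) • D.root j := by simp [chain]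
  have d0 : D.root (chain D j i 0) = (1 : ℤ) • D.root j + (0 : ℤ) • D.root i := by simp [chain]
  have c1 : D.root (chain D i j 1) = (3 : ℤ) • D.root i + (1 : ℤ) • D.root j :=
    root_refl_comb d0 hji
  have d1 : D.root (chain D j i 1) = (1 : ℤ) • D.root j + (1 : ℤ) • D.root i :=
    root_refl_comb c0 hij
  have c2 : D.root (chain D i j 2) = (2 : ℤ) • D.root i + (1 : ℤ) • D.root j :=
    root_refl_comb d1 hji
  have d2 : D.root (chain D j i 2) = (2 : ℤ) • D.root j + (3 : ℤ) • D.root i :=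
    root_refl_comb c1 hij
  have c3 : D.root (chain D i j 3) = (3 : ℤ) • D.root i + (2 : ℤ) • D.root j :=
    root_refl_comb d2 hji
  have d3 : D.root (chain D j i 3) = (1 : ℤ) • D.root j + (2 : ℤ) • D.root i :=
    root_refl_comb c2 hij
  have c4 : D.root (chain D i j 4) = (1 : ℤ) • D.root i + (1 : ℤ) • D.root j :=
    root_refl_comb d3 hji
  have d4 : D.root (chain D j i 4) = (1 : ℤ) • D.root j + (3 : ℤ) • D.root i :=
    root_refl_comb c3 hij
  have c5 : D.root (chain D i j 5) = (0 : ℤ) • D.root i + (1 : ℤ) • D.root j :=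
    root_refl_comb d4 hji
  have d5 : D.root (chain D j i 5) = (0 : ℤ) • D.root j + (1 : ℤ) • D.root i :=
    root_refl_comb c4 hij
  refine ⟨by norm_num, ?_, ?_, ?_⟩
  -- Since `s_i` fixes the root `s_j s_i α_j`, it commutes with the reflection `s_j s_i s_j s_i
  -- s_j`.
  · have h : refl D i • ((refl D j * refl D i) • j) = (refl D j * refl D i) • j :=
      root_injective (D := D) (by
        rw [show refl D i • ((refl D j * refl D i) • j) = chain D i j 3 by
            rw [mul_smul]; rfl, c3,
          show (refl D j * refl D i) • j = chain D j i 2 by rw [mul_smul]; rfl, d2]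
        module)
    have h1 := refl_conj (refl D j * refl D i) j
    rw [mul_inv_rev, refl_inv, refl_inv] at h1
    have h2 := mul_refl_eq (refl D i) ((refl D j * refl D i) • j)
    rw [h, ← h1] at h2
    simpa only [alt, mul_one, mul_assoc] using h2
  · intro w hi hj k hk
    interval_cases k
    · exact not_isPos_comb hi hj (by norm_num) (by norm_num) c0
    · exact not_isPos_comb hi hj (by norm_num) (by norm_num) c1
    · exact not_isPos_comb hi hj (by norm_num) (by norm_num) c2
    · exact not_isPos_comb hi hj (by norm_num) (by norm_num) c3
    · exact not_isPos_comb hi hj (by norm_num) (by norm_num) c4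
    · exact not_isPos_comb hi hj (by norm_num) (by norm_num) c5
  · intro w hi hj k hk
    interval_cases k
    · exact not_isPos_comb hj hi (by norm_num) (by norm_num) d0
    · exact not_isPos_comb hj hi (by norm_num) (by norm_num) d1
    · exact not_isPos_comb hj hi (by norm_num) (by norm_num) d2
    · exact not_isPos_comb hj hi (by norm_num) (by norm_num) d3
    · exact not_isPos_comb hj hi (by norm_num) (by norm_num) d4
    · exact not_isPos_comb hj hi (by norm_num) (by norm_num) d5

end Cases

theorem cartan_cases {i j : ι} (hi : i ∈ b.support) (hj : j ∈ b.support) (hij : i ≠ j) :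
    (cpair D (D.root i) j = 0 ∧ cpair D (D.root j) i = 0) ∨
    (cpair D (D.root i) j = -1 ∧ cpair D (D.root j) i = -1) ∨
    (cpair D (D.root i) j = -1 ∧ cpair D (D.root j) i = -2) ∨
    (cpair D (D.root i) j = -2 ∧ cpair D (D.root j) i = -1) ∨
    (cpair D (D.root i) j = -1 ∧ cpair D (D.root j) i = -3) ∨
    (cpair D (D.root i) j = -3 ∧ cpair D (D.root j) i = -1) := by
  have h1 := b.pairingIn_le_zero_of_ne hij hi hj
  have hne : D.root i ≠ -D.root j := fun h =>
    (isPos_neg_iff h).mp (isPos_of_mem hi) (isPos_of_mem hj)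
  have h2 := D.pairingIn_pairingIn_mem_set_of_isCrystal_of_isRed' i j
    (fun h => hij (root_injective (D := D) h)) hne
  have e : ∀ i j, cpair D (D.root i) j = D.pairingIn ℤ i j := fun i j =>
    (D.algebraMap_pairingIn ℤ i j).symm
  rw [e, e]
  simp only [Set.mem_insert_iff, Set.mem_singleton_iff, Prod.mk.injEq] at h2
  omega

end Dihedral

/-! ### Braid relations and Matsumoto's theorem -/

section Matsumoto

variable {ι X Y : Type u} [AddCommGroup X] [AddCommGroup Y] {D : RootPairing ι ℤ X Y}
  {b : D.Base} [Finite ι] [D.IsReduced]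

theorem wd_altList (i j : ι) (n : ℕ) : wd D (altList i j n) = alt (refl D i) (refl D j) n :=
  prod_map_altList _ i j n

theorem exists_reduced_word (b : D.Base) (w : D.weylGroup) :
    ∃ l : List ι, (∀ k ∈ l, k ∈ b.support) ∧ wd D l = w ∧ l.length = len b w :=
  exists_reduced (P := (b.support : Set ι)) le_rfl (mem_parabolicWeyl_support w)

theorem isPos_of_reduced_cons {i : ι} {l : List ι} (hl : ∀ k ∈ i :: l, k ∈ b.support)
    (h : (i :: l).length = len b (wd D (i :: l))) :
    l.length = len b (wd D l) ∧ ¬ b.IsPos ((wd D (i :: l))⁻¹ • i) := by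
  have hi := hl i (by simp)
  have hl' : ∀ k ∈ l, k ∈ b.support := fun k hk => hl k (by simp [hk])
  have e : wd D (i :: l) = refl D i * wd D l := by simp [wd]
  rw [e, List.length_cons] at h
  have h1 := len_wd_le (b := b) l hl'
  rw [e]
  by_cases hp : b.IsPos ((wd D l)⁻¹ • i)
  · refine ⟨?_, ?_⟩
    · rw [len_refl_mul_of_pos hi hp] at h; omega
    · rw [mul_inv_rev, refl_inv, isPos_mul_refl_smul, not_not]; exact hp
  · have := len_refl_mul_of_neg hi hp
    omega

/-- If two reduced words of `w` start with different letters `i` and `j`, both are left descents of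
`w`. Then `w` has reduced words that begin with either full alternating word in `i` and `j`,
followed by the same rest `t`. Each given word agrees with the one of these that has the same first
letter, by induction after removing that letter, and the two are related by a single braid relation.
-/
theorem matsumoto {M : Type*} [Monoid M] {T : ι → M}
    (hT : ∀ i ∈ b.support, ∀ j ∈ b.support, i ≠ j →
      ∃ m, Dihedral b i j m ∧ alt (T i) (T j) m = alt (T j) (T i) m)
    (l l' : List ι) (hl : ∀ k ∈ l, k ∈ b.support) (hl' : ∀ k ∈ l', k ∈ b.support)
    (h : l.length = len b (wd D l)) (h' : l'.length = len b (wd D l')) (e : wd D l = wd D l') :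
    (l.map T).prod = (l'.map T).prod := by
  obtain ⟨n, hn⟩ : ∃ n, l.length = n := ⟨_, rfl⟩
  induction n using Nat.strong_induction_on generalizing l l' with
  | _ n ih =>
  have hlen : l.length = l'.length := by rw [h, h', e]
  match l, l', hl, hl', h, h', e, hlen with
  | [], [], _, _, _, _, _, _ => rfl
  | i :: r, j :: r', hl, hl', h, h', e, hlen =>
    have same : ∀ (i : ι) (r r' : List ι), (∀ k ∈ i :: r, k ∈ b.support) →
        (∀ k ∈ i :: r', k ∈ b.support) → (i :: r).length = n →
        (i :: r).length = len b (wd D (i :: r)) →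
        (i :: r').length = len b (wd D (i :: r')) → wd D (i :: r) = wd D (i :: r') →
        ((i :: r).map T).prod = ((i :: r').map T).prod := by
      intro i r r' hl hl' hn h h' e
      have e' : wd D r = wd D r' := by simpa [wd] using e
      simp only [List.map_cons, List.prod_cons]
      rw [ih r.length (by rw [← hn]; simp) r r' (fun k hk => hl k (by simp [hk]))
        (fun k hk => hl' k (by simp [hk])) (isPos_of_reduced_cons hl h).1
        (isPos_of_reduced_cons hl' h').1 e' rfl]
    by_cases hij : i = j
    · subst hij
      exact same i r r' hl hl' hn h h' e
    have hi := hl i (by simp)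
    have hj := hl' j (by simp)
    obtain ⟨m, hm, hmT⟩ := hT i hi j hj hij
    set w := wd D (i :: r) with hw
    have h1 := (isPos_of_reduced_cons hl h).2
    have h2 := (isPos_of_reduced_cons hl' h').2
    rw [← hw] at h1
    rw [← e] at h2
    have h3 := len_of_chain hi hj fun k hk => hm.left _ h1 h2 k hk
    set u := (alt (refl D i) (refl D j) m)⁻¹ * w with hu
    obtain ⟨t, ht, htu, htl⟩ := exists_reduced_word b u
    obtain ⟨m, rfl⟩ : ∃ m', m = m' + 1 := ⟨m - 1, by have := hm.pos; omega⟩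
    have hmem : ∀ i ∈ b.support, ∀ j ∈ b.support, ∀ k ∈ altList i j (m + 1) ++ t,
        k ∈ b.support := by
      intro i hi j hj k hk
      rcases List.mem_append.mp hk with hk | hk
      · rcases mem_altList hk with rfl | rfl <;> assumption
      · exact ht k hk
    have e1 : wd D (altList i j (m + 1) ++ t) = w := by
      rw [wd_append, wd_altList, htu, hu, mul_inv_cancel_left]
    have e2 : wd D (altList j i (m + 1) ++ t) = w := by
      rw [wd_append, wd_altList, ← hm.braid, htu, hu, mul_inv_cancel_left]
    have hl1 : (altList i j (m + 1) ++ t).length = len b w := by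
      rw [List.length_append, length_altList, htl, h3]
    have hl2 : (altList j i (m + 1) ++ t).length = len b w := by
      rw [List.length_append, length_altList, htl, h3]
    have a1 := same i r (altList j i m ++ t) hl (hmem i hi j hj) hn h
      (by rw [← List.cons_append, ← altList, hl1, e1])
      (by rw [← List.cons_append, ← altList, e1])
    have a2 := same j r' (altList i j m ++ t) hl' (hmem j hj i hi) (hlen ▸ hn) h'
      (by rw [← List.cons_append, ← altList, hl2, e2])
      (by rw [← List.cons_append, ← altList, e2, ← e])
    rw [a1, a2, ← List.cons_append, ← altList, ← List.cons_append, ← altList, List.map_append,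
      List.map_append, List.prod_append, List.prod_append, prod_map_altList, prod_map_altList, hmT]

theorem exists_matsumoto {M : Type*} [Monoid M] {T : ι → M}
    (hT : ∀ i ∈ b.support, ∀ j ∈ b.support, i ≠ j →
      ∃ m, Dihedral b i j m ∧ alt (T i) (T j) m = alt (T j) (T i) m) :
    ∃ F : D.weylGroup → M, F 1 = 1 ∧ (∀ i ∈ b.support, F (refl D i) = T i) ∧
      ∀ i ∈ b.support, ∀ w, b.IsPos (w • i) → F (w * refl D i) = F w * T i := by
  choose l hl hlw hll using exists_reduced_word b
  refine ⟨fun w => ((l w).map T).prod, ?_, ?_, ?_⟩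
  · have : l 1 = [] := List.eq_nil_of_length_eq_zero (by rw [hll, len_one])
    simp [this]
  · intro i hi
    have hs : ∀ k ∈ [i], k ∈ b.support := by simpa using hi
    have e : wd D [i] = refl D i := by simp [wd]
    have h1 : len b (refl D i) = 1 := by
      have := len_mul_refl_of_pos (w := 1) hi (by simpa using isPos_of_mem hi)
      rwa [one_mul, len_one] at this
    have := matsumoto hT (l (refl D i)) [i] (hl _) hs (by rw [hlw, hll])
      (by rw [e, h1]; rfl) (by rw [hlw, e])
    simpa using this
  · intro i hi w hw
    have e : wd D (l w ++ [i]) = w * refl D i := by rw [wd_append, hlw]; simp [wd]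
    have hs : ∀ k ∈ l w ++ [i], k ∈ b.support := by
      intro k hk
      rcases List.mem_append.mp hk with hk | hk
      · exact hl _ k hk
      · rw [List.mem_singleton.mp hk]; exact hi
    have := matsumoto hT (l (w * refl D i)) (l w ++ [i]) (hl _) hs (by rw [hlw, hll])
      (by rw [e, len_mul_refl_of_pos hi hw, List.length_append, hll]; rfl) (by rw [hlw, e])
    simpa using this

end Matsumoto

/-! ### Braid relations on the standard module -/

section StandardBraid

variable {ι X Y : Type u} [AddCommGroup X] [AddCommGroup Y] {D : RootPairing ι ℤ X Y}
  [Module.Free ℤ X] [Module.Finite ℤ X] {b : D.Base} {κ : Labels D} [Finite ι] [D.IsReduced]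

theorem alt_leftOp_rightOp_comm {i j k : ι} (hi : i ∈ b.support) (hj : j ∈ b.support)
    (hk : k ∈ b.support) (n : ℕ) (v : Std D) :
    alt (leftOp b κ i) (leftOp b κ j) n (rightOp b κ k v)
      = rightOp b κ k (alt (leftOp b κ i) (leftOp b κ j) n v) := by
  induction n generalizing i j with
  | zero => rfl
  | succ n ih =>
    rw [alt, Module.End.mul_apply, Module.End.mul_apply, ih hj hi, leftOp_rightOp_comm hi hk]

theorem alt_leftOp_one {i j : ι} (hi : i ∈ b.support) (hj : j ∈ b.support) {m : ℕ}
    (h : Dihedral b i j m) {n : ℕ} (hn : n ≤ m) :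
    alt (leftOp (X := X) b κ i) (leftOp b κ j) n (Finsupp.single 1 1)
      = Finsupp.single (alt (refl D i) (refl D j) n) 1 := by
  induction n generalizing i j with
  | zero => rfl
  | succ n ih =>
    have h1 := h.len_alt hi hj hn
    have h2 := h.symm.len_alt hj hi (k := n) (by omega)
    rw [alt] at h1
    have hp : b.IsPos ((alt (refl D j) (refl D i) n)⁻¹ • i) := by
      by_contra hc
      have := len_refl_mul_of_neg hi hc
      omega
    rw [alt, Module.End.mul_apply, ih hj hi h.symm (by omega), leftOp_single, leftC_of_pos hp,
      zero_smul, add_zero, map_one, ← lat_zero, demazure_of_cpair_zero (by simp [cpair])]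
    rw [Finsupp.single_zero, add_zero, alt]

/-- At the basis vector `e_1` both words give the basis vector of the same group element. Right
multiplications commute with left ones and carry the relation from `e_1` to every `e_w`; stability
under `θ_x` carries it to the whole module. -/
theorem alt_leftOp_eq {i j : ι} (hi : i ∈ b.support) (hj : j ∈ b.support) {m : ℕ}
    (h : Dihedral b i j m) (hS : StableSet κ (leftOp (X := X) b κ) i j
      (braidSet (leftOp (X := X) b κ) i j m))
    (hL : ∀ x : X, LatStable (braidSet (leftOp (X := X) b κ) i j m) x) :
    alt (leftOp (X := X) b κ i) (leftOp b κ j) m = alt (leftOp b κ j) (leftOp b κ i) m := by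
  have hone : ∀ w : D.weylGroup, Finsupp.single w 1 ∈ braidSet (leftOp (X := X) b κ) i j m := by
    intro w
    induction w using weyl_induction_right b with
    | one =>
      rw [mem_braidSet, alt_leftOp_one hi hj h le_rfl, alt_leftOp_one hj hi h.symm le_rfl, h.braid]
    | mul w k hk hp ih =>
      have e : Finsupp.single (w * refl D k) 1 = rightOp (X := X) b κ k (Finsupp.single w 1) := by
        rw [rightOp_single, rightC_of_pos hp, zero_smul, add_zero]
      rw [mem_braidSet, e, alt_leftOp_rightOp_comm hi hj hk, alt_leftOp_rightOp_comm hj hi hk,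
        mem_braidSet.mp ih]
  have hsingle : ∀ (w : D.weylGroup) (f : AddMonoidAlgebra ℂ X),
      Finsupp.single w f ∈ braidSet (leftOp (X := X) b κ) i j m := by
    intro w f
    induction f using lat_induction with
    | of x =>
      have := hL x _ (hone w)
      rwa [Finsupp.smul_single, smul_eq_mul, mul_one] at this
    | add f g hf hg => rw [Finsupp.single_add]; exact hS.add_mem _ hf _ hg
    | smul z f hf => rw [← Finsupp.smul_single]; exact hS.smul_mem z _ hf
  exact std_linear_ext fun w f => mem_braidSet.mp (hsingle w f)

theorem leftOp_braid (i : ι) (hi : i ∈ b.support) (j : ι) (hj : j ∈ b.support) (hij : i ≠ j) :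
    ∃ m, Dihedral b i j m ∧
      alt (leftOp (X := X) b κ i) (leftOp b κ j) m = alt (leftOp b κ j) (leftOp b κ i) m := by
  have hT := leftOp_bernstein (X := X) (b := b) (κ := κ)
  rcases cartan_cases hi hj hij with ⟨h1, h2⟩ | ⟨h1, h2⟩ | ⟨h1, h2⟩ | ⟨h1, h2⟩ | ⟨h1, h2⟩ | ⟨h1, h2⟩
  · exact ⟨2, dihedral_two h1 h2, alt_leftOp_eq hi hj (dihedral_two h1 h2)
      (stableSet_braidSet_two hT hi hj) (latStable_two hT hi hj h1 h2)⟩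
  -- The two simple roots are conjugate, so the labels agree by `W`-invariance.
  · have hconj : (refl D i * refl D j) • i = j := by
      refine root_injective (D := D) ?_
      rw [mul_smul, root_refl_smul, root_refl_smul, h1, neg_smul, one_smul, sub_neg_eq_add, cpair_add,
        cpair_self, h2]
      module
    have hc : κ.c i = κ.c j := by rw [← hconj, κ.c_smul]
    have hc' : κ.cStar i = κ.cStar j := by rw [← hconj, κ.cStar_smul]
    exact ⟨3, dihedral_three h1 h2, alt_leftOp_eq hi hj (dihedral_three h1 h2)
      (stableSet_braidSet_three hT hi hj hc) (latStable_three hT hi hj hc hc' h1 h2)⟩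
  · exact ⟨4, dihedral_four h1 h2, alt_leftOp_eq hi hj (dihedral_four h1 h2)
      (stableSet_braidSet_four hT hi hj) (latStable_four hT hi hj h1 h2)⟩
  · exact ⟨4, (dihedral_four h2 h1).symm, (alt_leftOp_eq hj hi (dihedral_four h2 h1)
      (stableSet_braidSet_four hT hj hi) (latStable_four hT hj hi h2 h1)).symm⟩
  · exact ⟨6, dihedral_six h1 h2, alt_leftOp_eq hi hj (dihedral_six h1 h2)
      (stableSet_braidSet_six hT hi hj) (latStable_six hT hi hj h1 h2)⟩
  · exact ⟨6, (dihedral_six h2 h1).symm, (alt_leftOp_eq hj hi (dihedral_six h2 h1)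
      (stableSet_braidSet_six hT hj hi) (latStable_six hT hj hi h2 h1)).symm⟩

end StandardBraid

/-! ### The Poincaré--Birkhoff--Witt basis -/

section Bernstein

variable {ι X Y : Type u} [AddCommGroup X] [AddCommGroup Y] {D : RootPairing ι ℤ X Y}
  [Module.Free ℤ X] [Module.Finite ℤ X] {b : D.Base} {κ : Labels D} [Finite ι] [D.IsReduced]

theorem len_mul_le (v u : D.weylGroup) : len b (v * u) ≤ len b v + len b u := by
  induction u using weyl_induction_right b with
  | one => rw [mul_one, len_one, add_zero]
  | mul u i hi hp ih =>
    have h1 := len_mul_refl_of_pos hi hp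
    have h2 := len_mul_refl_le (b := b) (w := v * u) hi
    rw [← mul_assoc]
    omega

theorem N_one : N b κ 1 = 1 :=
  (RingQuot.mkAlgHom_rel ℂ (Rel.N_one (b := b) (κ := κ))).trans (map_one _)

theorem theta_zero : theta b κ 0 = 1 :=
  (RingQuot.mkAlgHom_rel ℂ (Rel.theta_zero (b := b) (κ := κ))).trans (map_one _)

theorem theta_add (x y : X) : theta b κ (x + y) = theta b κ x * theta b κ y :=
  (RingQuot.mkAlgHom_rel ℂ (Rel.theta_add (b := b) (κ := κ) x y)).symm.trans (map_mul _ _ _)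

theorem N_mul_refl_of_pos {w : D.weylGroup} {i : ι} (hi : i ∈ b.support)
    (h : b.IsPos (w • i)) : N b κ w * N b κ (refl D i) = N b κ (w * refl D i) :=
  (map_mul _ _ _).symm.trans
    (RingQuot.mkAlgHom_rel ℂ (Rel.N_up (b := b) (κ := κ) w i hi (len_mul_refl_of_pos hi h)))

theorem N_mul_refl_of_neg {w : D.weylGroup} {i : ι} (hi : i ∈ b.support)
    (h : ¬ b.IsPos (w • i)) :
    N b κ w * N b κ (refl D i) = N b κ (w * refl D i) + κ.c i • N b κ w := by
  refine (map_mul _ _ _).symm.trans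
    ((RingQuot.mkAlgHom_rel ℂ
      (Rel.N_down (b := b) (κ := κ) w i hi (len_mul_refl_of_neg hi h))).trans ?_)
  rw [map_add, map_smul]
  rfl

theorem N_refl_mul_self {i : ι} (hi : i ∈ b.support) :
    N b κ (refl D i) * N b κ (refl D i) = 1 + κ.c i • N b κ (refl D i) := by
  rw [N_mul_refl_of_neg hi, refl_mul_self, N_one]
  have := (isPos_neg_iff (b := b) (refl_smul_self (D := D) i))
  exact fun h => this.mp h (isPos_of_mem hi)

theorem N_mul_of_len {v u : D.weylGroup} (h : len b (v * u) = len b v + len b u) :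
    N b κ v * N b κ u = N b κ (v * u) := by
  induction u using weyl_induction_right b with
  | one => rw [N_one, mul_one, mul_one]
  | mul u i hi hp ih =>
    have h1 := len_mul_refl_of_pos hi hp
    have h2 := len_mul_refl_le (b := b) (w := v * u) hi
    have h4 := len_mul_le (b := b) v u
    have hp' : b.IsPos ((v * u) • i) := by
      by_contra hc
      have := len_mul_refl_of_neg hi hc
      rw [← mul_assoc] at h
      omega
    rw [← mul_assoc] at h
    have h3 := len_mul_refl_of_pos hi hp'
    rw [← N_mul_refl_of_pos hi hp, ← mul_assoc, ih (by omega), N_mul_refl_of_pos hi hp', mul_assoc]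

theorem N_refl_mul_of_pos {w : D.weylGroup} {i : ι} (hi : i ∈ b.support)
    (h : b.IsPos (w⁻¹ • i)) : N b κ (refl D i) * N b κ w = N b κ (refl D i * w) := by
  have h1 : len b (refl D i) = 1 := by
    have := len_mul_refl_of_pos (w := 1) hi (by simpa using isPos_of_mem hi)
    rwa [one_mul, len_one] at this
  refine N_mul_of_len ?_
  rw [len_refl_mul_of_pos hi h, h1, add_comm]

/-- The presentation only prescribes right multiplication by `N_s`. The left version comes from
writing `N_w = N_s N_{sw}`. -/
theorem N_refl_mul_of_neg {w : D.weylGroup} {i : ι} (hi : i ∈ b.support)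
    (h : ¬ b.IsPos (w⁻¹ • i)) :
    N b κ (refl D i) * N b κ w = N b κ (refl D i * w) + κ.c i • N b κ w := by
  have h1 : b.IsPos ((refl D i * w)⁻¹ • i) := by
    rwa [mul_inv_rev, refl_inv, isPos_mul_refl_smul]
  have h2 := N_refl_mul_of_pos (κ := κ) hi h1
  rw [refl_mul_refl_mul] at h2
  conv_lhs => rw [← h2]
  rw [← mul_assoc, N_refl_mul_self hi, add_mul, one_mul, smul_mul_assoc, h2]

variable (b κ) in
/-- The embedding of `ℂ[X]` in the affine Hecke algebra. -/
def thetaHom : AddMonoidAlgebra ℂ X →ₐ[ℂ] Hecke b κ :=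
  AddMonoidAlgebra.lift ℂ (Hecke b κ) X
    { toFun := fun x => theta b κ x.toAdd
      map_one' := theta_zero
      map_mul' := fun x y => theta_add x.toAdd y.toAdd }

theorem thetaHom_lat (x : X) : thetaHom b κ (lat x) = theta b κ x := by
  simp [thetaHom, lat]

theorem mkAlgHom_freeLift (f : AddMonoidAlgebra ℂ X) :
    RingQuot.mkAlgHom ℂ (Rel b κ) (freeLift D f) = thetaHom b κ f := by
  rw [thetaHom, AddMonoidAlgebra.lift_apply, freeLift, Finsupp.sum, map_sum]
  exact Finset.sum_congr rfl fun x _ => map_smul _ _ _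

theorem den_eq_one_sub (i : ι) : den D i = 1 - lat (-((2 : ℤ) • D.root i)) := rfl

theorem thetaHom_mul_N {i : ι} (hi : i ∈ b.support) (f : AddMonoidAlgebra ℂ X) :
    thetaHom b κ f * N b κ (refl D i)
      = N b κ (refl D i) * thetaHom b κ (wAct (refl D i) f) + thetaHom b κ (demazure κ i f) := by
  induction f using lat_induction with
  | of x =>
    rw [thetaHom_lat, wAct_lat, thetaHom_lat]
    have h := RingQuot.mkAlgHom_rel ℂ (Rel.cross (b := b) (κ := κ) i hi x
      (demazure κ i (lat x)) (by
        rw [mul_comm, ← den_eq_one_sub, den_mul_demazure, wAct_lat]; rfl))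
    rw [map_mul, map_add, map_mul, mkAlgHom_freeLift] at h
    exact h
  | add f g hf hg => simp only [map_add, add_mul, mul_add, hf, hg]; abel
  | smul z f hf => simp only [map_smul, smul_mul_assoc, mul_smul_comm, hf, smul_add]

theorem N_mul_thetaHom {i : ι} (hi : i ∈ b.support) (f : AddMonoidAlgebra ℂ X) :
    N b κ (refl D i) * thetaHom b κ f
      = thetaHom b κ (wAct (refl D i) f) * N b κ (refl D i) + thetaHom b κ (demazure κ i f) := by
  rw [thetaHom_mul_N hi, wAct_refl_refl, demazure_wAct, map_neg, neg_add_cancel_right]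

/-- Multiplication by elements of `ℂ[X]` on the standard module. -/
def stdMul (D : RootPairing ι ℤ X Y) : AddMonoidAlgebra ℂ X →ₐ[ℂ] Module.End ℂ (Std D) :=
  Algebra.lsmul ℂ ℂ (Std D)

theorem stdMul_apply (f : AddMonoidAlgebra ℂ X) (v : Std D) : stdMul D f v = f • v := rfl

/-- The braid relations make the product of left operators along a reduced word depend only on `w`.
With these as the images of the `N_w`, the relations of the presentation reduce to the quadratic and
cross relations of the operators. -/
theorem exists_rep : ∃ Φ : Hecke b κ →ₐ[ℂ] Module.End ℂ (Std D),
    (∀ f, Φ (thetaHom b κ f) = stdMul D f) ∧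
    ∀ i ∈ b.support, Φ (N b κ (refl D i)) = leftOp b κ i := by
  obtain ⟨F, hF1, hF2, hF3⟩ := exists_matsumoto (leftOp_braid (X := X) (b := b) (κ := κ))
  have hT := leftOp_bernstein (X := X) (b := b) (κ := κ)
  set L : FreeAlgebra ℂ (D.weylGroup ⊕ X) →ₐ[ℂ] Module.End ℂ (Std D) :=
    FreeAlgebra.lift ℂ (Sum.elim F fun x => stdMul D (lat x)) with hL
  have hN : ∀ w, L (freeN w) = F w := fun w => by simp [hL, freeN]
  have hθ : ∀ x, L (freeTheta D x) = stdMul D (lat x) := fun w => by simp [hL, freeTheta]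
  have hlift : ∀ f, L (freeLift D f) = stdMul D f := fun f => by
    rw [freeLift, Finsupp.sum, map_sum]
    conv_rhs => rw [← AddMonoidAlgebra.sum_coeff_single f, Finsupp.sum, map_sum]
    refine Finset.sum_congr rfl fun x _ => ?_
    rw [map_smul, hθ, ← map_smul, lat, AddMonoidAlgebra.smul_single, smul_eq_mul, mul_one]
  have hrel : ∀ ⦃x y⦄, Rel b κ x y → L x = L y := by
    intro x y h
    induction h with
    | N_one => rw [hN, hF1, map_one]
    | N_up w i hi h =>
      have hp : b.IsPos (w • i) := by
        by_contra hc
        have := len_mul_refl_of_neg hi hc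
        omega
      rw [map_mul, hN, hN, hN, hF2 i hi, hF3 i hi w hp]
    | N_down w i hi h =>
      have hp : ¬ b.IsPos (w • i) := by
        intro hc
        have := len_mul_refl_of_pos hi hc
        omega
      have h1 := hF3 i hi (w * refl D i) (isPos_mul_refl_smul.mpr hp)
      rw [mul_refl_mul_refl] at h1
      rw [map_mul, map_add, map_smul, hN, hN, hN, hF2 i hi, h1, mul_assoc]
      have h2 : leftOp (X := X) b κ i * leftOp b κ i = κ.c i • leftOp b κ i + 1 :=
        LinearMap.ext fun v => hT.quad i hi v
      rw [h2, mul_add, mul_one, mul_smul_comm, add_comm]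
    | theta_zero => rw [hθ, lat_zero, map_one, map_one]
    | theta_add x y => rw [map_mul, hθ, hθ, hθ, ← map_mul, lat_mul]
    | cross i hi x f hf =>
      have h1 : f = demazure κ i (lat x) := by
        refine eq_demazure ?_
        rw [wAct_lat, mul_comm, den_eq_one_sub]; exact hf
      rw [map_add, map_mul, map_mul, hθ, hθ, hN, hF2 i hi, hlift, h1]
      refine LinearMap.ext fun v => ?_
      rw [LinearMap.add_apply, Module.End.mul_apply, Module.End.mul_apply, stdMul_apply,
        stdMul_apply, stdMul_apply, hT.cross i hi, ← wAct_lat, wAct_refl_refl, demazure_wAct,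
        neg_smul, neg_add_cancel_right]
  refine ⟨RingQuot.liftAlgHom ℂ ⟨L, hrel⟩, fun f => ?_, fun i hi => ?_⟩
  · rw [← mkAlgHom_freeLift, RingQuot.liftAlgHom_mkAlgHom_apply, hlift]
  · rw [N, RingQuot.liftAlgHom_mkAlgHom_apply, hN, hF2 i hi]

variable (b κ) in
/-- The action of the affine Hecke algebra on the standard module. -/
def rep : Hecke b κ →ₐ[ℂ] Module.End ℂ (Std D) := Classical.choose exists_rep

theorem rep_thetaHom (f : AddMonoidAlgebra ℂ X) : rep b κ (thetaHom b κ f) = stdMul D f :=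
  (Classical.choose_spec exists_rep).1 f

theorem rep_N_refl {i : ι} (hi : i ∈ b.support) :
    rep b κ (N b κ (refl D i)) = leftOp b κ i :=
  (Classical.choose_spec exists_rep).2 i hi

/-- Acting on `e_1` separates the `N_w`; this is what makes the `θ_x N_w` linearly independent in
`coef_ofStd`. -/
theorem rep_N_one (w : D.weylGroup) :
    rep b κ (N b κ w) (Finsupp.single 1 1) = Finsupp.single w 1 := by
  induction w using weyl_induction_left b with
  | one => rw [N_one, map_one]; rfl
  | mul w i hi hp ih =>
    rw [← N_refl_mul_of_pos hi hp, map_mul, Module.End.mul_apply, ih, rep_N_refl hi, leftOp_single,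
      leftC_of_pos hp, zero_smul, add_zero, map_one, ← lat_zero,
      demazure_of_cpair_zero (by simp [cpair]), Finsupp.single_zero, add_zero]

variable (b κ) in
/-- The linear map `Std D → 𝓗` with `θ_x e_w ↦ θ_x N_w`. -/
def ofStd : Std D →ₗ[ℂ] Hecke b κ :=
  Finsupp.lsum ℂ fun w => LinearMap.mulRight ℂ (N b κ w) ∘ₗ (thetaHom b κ).toLinearMap

theorem ofStd_single (w : D.weylGroup) (f : AddMonoidAlgebra ℂ X) :
    ofStd b κ (Finsupp.single w f) = thetaHom b κ f * N b κ w := by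
  simp [ofStd]

theorem ofStd_smul (f : AddMonoidAlgebra ℂ X) (v : Std D) :
    ofStd b κ (f • v) = thetaHom b κ f * ofStd b κ v := by
  refine DFunLike.congr_fun (std_linear_ext (φ := ofStd b κ ∘ₗ stdMul D f)
    (φ' := LinearMap.mulLeft ℂ (thetaHom b κ f) ∘ₗ ofStd b κ) fun w g => ?_) v
  simp only [LinearMap.comp_apply, stdMul_apply, Finsupp.smul_single, ofStd_single,
    LinearMap.mulLeft_apply, smul_eq_mul, map_mul, mul_assoc]

theorem ofStd_leftOp {i : ι} (hi : i ∈ b.support) (v : Std D) :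
    ofStd b κ (leftOp b κ i v) = N b κ (refl D i) * ofStd b κ v := by
  refine DFunLike.congr_fun (std_linear_ext (φ := ofStd b κ ∘ₗ leftOp b κ i)
    (φ' := LinearMap.mulLeft ℂ (N b κ (refl D i)) ∘ₗ ofStd b κ) fun w g => ?_) v
  simp only [LinearMap.comp_apply, leftOp_single, ofStd_single, map_add, map_smul,
    LinearMap.mulLeft_apply]
  rw [← mul_assoc, N_mul_thetaHom hi, add_mul, mul_assoc _ _ (N b κ w)]
  by_cases hp : b.IsPos (w⁻¹ • i)
  · rw [leftC_of_pos hp, zero_smul, add_zero, N_refl_mul_of_pos hi hp]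
  · rw [leftC_of_neg hp, N_refl_mul_of_neg hi hp, mul_add, mul_smul_comm]

/-- Multiplication from the left by the generators, in terms of the standard module. -/
theorem mul_ofStd_mem (h : Hecke b κ) (v : Std D) : h * ofStd b κ v ∈ (ofStd b κ).range := by
  obtain ⟨a, rfl⟩ := RingQuot.mkAlgHom_surjective ℂ (Rel b κ) h
  induction a using FreeAlgebra.induction generalizing v with
  | grade0 z => rw [AlgHom.commutes, Algebra.algebraMap_eq_smul_one, smul_mul_assoc, one_mul]
                exact Submodule.smul_mem _ _ ⟨v, rfl⟩
  | grade1 x =>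
    rcases x with w | x
    · change N b κ w * _ ∈ _
      induction w using weyl_induction_left b generalizing v with
      | one => rw [N_one, one_mul]; exact ⟨v, rfl⟩
      | mul w i hi hp ih =>
        obtain ⟨v', hv'⟩ := ih v
        rw [← N_refl_mul_of_pos hi hp, mul_assoc, ← hv', ← ofStd_leftOp hi]
        exact ⟨_, rfl⟩
    · change theta b κ x * _ ∈ _
      rw [← thetaHom_lat, ← ofStd_smul]
      exact ⟨_, rfl⟩
  | mul a a' ha ha' =>
    obtain ⟨v', hv'⟩ := ha' v
    rw [map_mul, mul_assoc, ← hv']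
    exact ha v'
  | add a a' ha ha' => rw [map_add, add_mul]; exact Submodule.add_mem _ (ha v) (ha' v)

variable (b κ) in
/-- The coefficients of an element of `𝓗` with respect to the `N_w`. -/
def coef : Hecke b κ →ₗ[ℂ] Std D :=
  LinearMap.applyₗ (Finsupp.single 1 1) ∘ₗ (rep b κ).toLinearMap

theorem coef_ofStd (v : Std D) : coef b κ (ofStd b κ v) = v := by
  refine DFunLike.congr_fun (std_linear_ext (φ := coef b κ ∘ₗ ofStd b κ)
    (φ' := LinearMap.id) fun w g => ?_) v
  simp only [LinearMap.comp_apply, ofStd_single, coef, LinearMap.applyₗ_apply_apply,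
    AlgHom.toLinearMap_apply, map_mul, Module.End.mul_apply, rep_N_one, rep_thetaHom, stdMul_apply,
    Finsupp.smul_single, smul_eq_mul, mul_one, LinearMap.id_apply]

/-- The range of `ofStd` is stable under left multiplication and contains `1`, so the `θ_x N_w` span
`𝓗`. -/
theorem ofStd_coef (h : Hecke b κ) : ofStd b κ (coef b κ h) = h := by
  obtain ⟨v, hv⟩ := mul_ofStd_mem h (Finsupp.single 1 1)
  rw [ofStd_single, map_one, one_mul, N_one, mul_one] at hv
  rw [← hv, coef_ofStd]

end Bernstein

/-! ### Supports, and the parabolic subalgebras -/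

section Support

variable {ι X Y : Type u} [AddCommGroup X] [AddCommGroup Y] {D : RootPairing ι ℤ X Y}
  [Module.Free ℤ X] [Module.Finite ℤ X] {b : D.Base} {κ : Labels D} [Finite ι] [D.IsReduced]

theorem coef_single (w : D.weylGroup) (f : AddMonoidAlgebra ℂ X) :
    coef b κ (thetaHom b κ f * N b κ w) = Finsupp.single w f := by
  rw [← ofStd_single, coef_ofStd]

theorem hecke_induction {p : Hecke b κ → Prop} (zero : p 0)
    (add : ∀ h h', p h → p h' → p (h + h'))
    (single : ∀ f w, p (thetaHom b κ f * N b κ w)) (h : Hecke b κ) : p h := by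
  rw [← ofStd_coef h]
  induction coef b κ h using Finsupp.induction_linear with
  | zero => rw [map_zero]; exact zero
  | add v v' hv hv' => rw [map_add]; exact add _ _ hv hv'
  | single w f => rw [ofStd_single]; exact single f w

theorem hecke_linear_ext {V : Type*} [AddCommGroup V] [Module ℂ V] {L L' : Hecke b κ →ₗ[ℂ] V}
    (h : ∀ f w, L (thetaHom b κ f * N b κ w) = L' (thetaHom b κ f * N b κ w)) : L = L' := by
  ext a
  induction a using hecke_induction with
  | zero => rw [map_zero, map_zero]
  | add a a' ha ha' => rw [map_add, map_add, ha, ha']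
  | single f w => exact h f w

variable (b κ) in
/-- The span of the `θ_x N_w` with `w ∈ S`. -/
def suppOn (S : Set D.weylGroup) : Submodule ℂ (Hecke b κ) :=
  (Finsupp.supported (AddMonoidAlgebra ℂ X) ℂ S).comap (coef b κ)

theorem single_mem_suppOn {S : Set D.weylGroup} {w : D.weylGroup} (hw : w ∈ S)
    (f : AddMonoidAlgebra ℂ X) : thetaHom b κ f * N b κ w ∈ suppOn b κ S := by
  rw [suppOn, Submodule.mem_comap, coef_single]
  exact Finsupp.single_mem_supported ℂ f hw

theorem N_mem_suppOn {S : Set D.weylGroup} {w : D.weylGroup} (hw : w ∈ S) :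
    N b κ w ∈ suppOn b κ S := by
  simpa using single_mem_suppOn (κ := κ) hw 1

theorem suppOn_le {S : Set D.weylGroup} {M : Submodule ℂ (Hecke b κ)}
    (h : ∀ f, ∀ w ∈ S, thetaHom b κ f * N b κ w ∈ M) : suppOn b κ S ≤ M := by
  intro a ha
  rw [← ofStd_coef a, ← Finsupp.sum_single (coef b κ a), Finsupp.sum, map_sum]
  refine Submodule.sum_mem _ fun w hw => ?_
  rw [ofStd_single]
  exact h _ _ ((Finsupp.mem_supported ℂ _).mp ha hw)

theorem suppOn_mono {S S' : Set D.weylGroup} (h : S ⊆ S') : suppOn b κ S ≤ suppOn b κ S' :=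
  suppOn_le fun f _ hw => single_mem_suppOn (h hw) f

theorem N_refl_mul_mem_suppOn {S S' : Set D.weylGroup} {i : ι} (hi : i ∈ b.support)
    (h : ∀ w ∈ S, w ∈ S' ∧ refl D i * w ∈ S') {a : Hecke b κ} (ha : a ∈ suppOn b κ S) :
    N b κ (refl D i) * a ∈ suppOn b κ S' := by
  refine suppOn_le (M := (suppOn b κ S').comap (LinearMap.mulLeft ℂ (N b κ (refl D i))))
    (fun g w hw => ?_) ha
  rw [Submodule.mem_comap, LinearMap.mulLeft_apply, ← ofStd_single, ← ofStd_leftOp hi,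
    leftOp_single, map_add, map_add, map_smul, ofStd_single, ofStd_single, ofStd_single]
  obtain ⟨h1, h2⟩ := h w hw
  exact add_mem (add_mem (single_mem_suppOn h2 _)
    (Submodule.smul_mem _ _ (single_mem_suppOn h1 _))) (single_mem_suppOn h1 _)

theorem coef_mul_N_refl {i : ι} (hi : i ∈ b.support) (a : Hecke b κ) :
    coef b κ (a * N b κ (refl D i)) = rightOp b κ i (coef b κ a) := by
  refine DFunLike.congr_fun (hecke_linear_ext
    (L := coef b κ ∘ₗ LinearMap.mulRight ℂ (N b κ (refl D i)))
    (L' := rightOp b κ i ∘ₗ coef b κ) fun f w => ?_) a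
  simp only [LinearMap.comp_apply, LinearMap.mulRight_apply, coef_single, rightOp_single]
  rw [mul_assoc]
  by_cases hp : b.IsPos (w • i)
  · rw [N_mul_refl_of_pos hi hp, coef_single, rightC_of_pos hp, zero_smul, add_zero]
  · rw [N_mul_refl_of_neg hi hp, mul_add, map_add, mul_smul_comm, map_smul, coef_single,
      coef_single, rightC_of_neg hp]

theorem coef_N_refl_mul {i : ι} (hi : i ∈ b.support) (a : Hecke b κ) :
    coef b κ (N b κ (refl D i) * a) = leftOp b κ i (coef b κ a) := by
  rw [← coef_ofStd (b := b) (κ := κ) (leftOp b κ i (coef b κ a)), ofStd_leftOp hi, ofStd_coef]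

theorem mul_N_refl_mem_suppOn {S S' : Set D.weylGroup} {i : ι} (hi : i ∈ b.support)
    (h : ∀ w ∈ S, w ∈ S' ∧ w * refl D i ∈ S') {a : Hecke b κ} (ha : a ∈ suppOn b κ S) :
    a * N b κ (refl D i) ∈ suppOn b κ S' := by
  refine suppOn_le (M := (suppOn b κ S').comap (LinearMap.mulRight ℂ (N b κ (refl D i))))
    (fun g w hw => ?_) ha
  obtain ⟨h1, h2⟩ := h w hw
  rw [Submodule.mem_comap, LinearMap.mulRight_apply, suppOn, Submodule.mem_comap,
    coef_mul_N_refl hi, coef_single, rightOp_single]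
  exact add_mem (Finsupp.single_mem_supported ℂ _ h2)
    (Submodule.smul_mem _ _ (Finsupp.single_mem_supported ℂ _ h1))

/-- The elements of length less than `n`. -/
abbrev shorter (b : D.Base) (n : ℕ) : Set D.weylGroup := {w | len b w < n}

theorem shorter_mul_refl {i : ι} (hi : i ∈ b.support) {n : ℕ} :
    ∀ w ∈ shorter b n, w ∈ shorter b (n + 1) ∧ w * refl D i ∈ shorter b (n + 1) := by
  intro w hw
  have := len_mul_refl_le (w := w) hi
  simp only [Set.mem_ofPred_eq] at hw ⊢
  omega

theorem shorter_refl_mul {i : ι} (hi : i ∈ b.support) {n : ℕ} :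
    ∀ w ∈ shorter b n, w ∈ shorter b (n + 1) ∧ refl D i * w ∈ shorter b (n + 1) := by
  intro w hw
  have := len_mul_refl_le (w := w⁻¹) hi
  rw [len_inv, ← refl_inv, ← mul_inv_rev, len_inv] at this
  simp only [Set.mem_ofPred_eq] at hw ⊢
  omega

/-- When a further letter produces an extra term by the quadratic relation, that term is a multiple
of `N_{vu}`, of length at most `ℓ(v) + ℓ(u)`, which is below the new bound. The unitriangularity of
the Gram matrix rests on this. -/
theorem N_mul_N_sub_mem (v u : D.weylGroup) :
    N b κ v * N b κ u - N b κ (v * u) ∈ suppOn b κ (shorter b (len b v + len b u)) := by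
  induction u using weyl_induction_right b with
  | one => rw [N_one, mul_one, mul_one, sub_self]; exact zero_mem _
  | mul u i hi hp ih =>
    have h1 := len_mul_refl_of_pos hi hp
    have h2 := mul_N_refl_mem_suppOn hi (shorter_mul_refl hi) ih
    rw [h1, ← add_assoc, ← N_mul_refl_of_pos hi hp, ← mul_assoc]
    rw [sub_mul] at h2
    have h3 : N b κ (v * u) * N b κ (refl D i) - N b κ (v * (u * refl D i)) ∈
        suppOn b κ (shorter b (len b v + len b u + 1)) := by
      by_cases hp' : b.IsPos ((v * u) • i)
      · rw [N_mul_refl_of_pos hi hp', mul_assoc, sub_self]; exact zero_mem _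
      · rw [N_mul_refl_of_neg hi hp', mul_assoc, add_sub_cancel_left]
        refine Submodule.smul_mem _ _ (N_mem_suppOn ?_)
        exact Nat.lt_succ_of_le (len_mul_le v u)
    simpa using add_mem h2 h3

/-- Each time `θ` crosses a letter, the Demazure term lacks that letter and is therefore shorter. -/
theorem N_mul_thetaHom_sub_mem (w : D.weylGroup) (f : AddMonoidAlgebra ℂ X) :
    N b κ w * thetaHom b κ f - thetaHom b κ (wAct w f) * N b κ w ∈
      suppOn b κ (shorter b (len b w)) := by
  induction w using weyl_induction_left b with
  | one => rw [N_one, wAct_one, one_mul, mul_one, sub_self]; exact zero_mem _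
  | mul w i hi hp ih =>
    have h1 := len_refl_mul_of_pos hi hp
    have h2 := N_refl_mul_mem_suppOn hi (shorter_refl_mul hi) ih
    rw [mul_sub, ← mul_assoc, ← mul_assoc, N_mul_thetaHom hi, add_mul, mul_assoc (thetaHom b κ _),
      N_refl_mul_of_pos hi hp, ← wAct_mul] at h2
    have h3 : thetaHom b κ (demazure κ i (wAct w f)) * N b κ w ∈
        suppOn b κ (shorter b (len b w + 1)) := single_mem_suppOn (Nat.lt_succ_self _) _
    rw [h1]
    have h4 := add_mem h2 h3
    rwa [← sub_sub, sub_add_cancel] at h4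

/-! #### Parabolic subalgebras -/

variable {P : Set ι}

theorem theta_mem (x : X) : theta b κ x ∈ parabolic b κ P :=
  Algebra.subset_adjoin (Or.inl ⟨x, rfl⟩)

theorem thetaHom_mem (f : AddMonoidAlgebra ℂ X) : thetaHom b κ f ∈ parabolic b κ P := by
  induction f using lat_induction with
  | of x => rw [thetaHom_lat]; exact theta_mem x
  | add f g hf hg => rw [map_add]; exact add_mem hf hg
  | smul z f hf => rw [map_smul]; exact Subalgebra.smul_mem _ hf z

theorem N_mem {w : D.weylGroup} (hw : w ∈ parabolicWeyl D P) : N b κ w ∈ parabolic b κ P :=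
  Algebra.subset_adjoin (Or.inr ⟨w, hw, rfl⟩)

@[elab_as_elim]
theorem parabolic_algebra_induction (hP : P ⊆ b.support)
    {p : (a : Hecke b κ) → a ∈ parabolic b κ P → Prop}
    (algebraMap : ∀ z, p (algebraMap ℂ _ z) (algebraMap_mem _ z))
    (theta : ∀ x, p (theta b κ x) (theta_mem x))
    (refl : ∀ i (hi : i ∈ P), p (N b κ (refl D i)) (N_mem (refl_mem_parabolic hi)))
    (add : ∀ a a' ha ha', p a ha → p a' ha' → p (a + a') (add_mem ha ha'))
    (mul : ∀ a a' ha ha', p a ha → p a' ha' → p (a * a') (mul_mem ha ha'))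
    {a : Hecke b κ} (ha : a ∈ parabolic b κ P) : p a ha := by
  induction ha using Algebra.adjoin_induction with
  | mem x hx =>
    rcases hx with ⟨x, rfl⟩ | ⟨w, hw, rfl⟩
    · exact theta x
    · induction hw using parabolic_induction_right hP with
      | one => simpa only [N_one, map_one] using algebraMap 1
      | mul w hw i hi hp ih =>
        simpa only [N_mul_refl_of_pos (hP hi) hp] using mul _ _ (N_mem hw) _ ih (refl i hi)
  | algebraMap z => exact algebraMap z
  | add a a' ha ha' h h' => exact add _ _ _ _ h h'
  | mul a a' ha ha' h h' => exact mul _ _ _ _ h h'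

end Support

/-! ### The top coefficient -/

section TopCoefficient

variable {ι X Y : Type u} [AddCommGroup X] [AddCommGroup Y] {D : RootPairing ι ℤ X Y}
  [Module.Free ℤ X] [Module.Finite ℤ X] {b : D.Base} {κ : Labels D} [Finite ι] [D.IsReduced]

open Classical in
/-- The map `θ_x e_(p d) ↦ θ_x e_p` for `p ∈ W_P`, which kills the other basis elements. -/
def stdTop (P : Set ι) (d : D.weylGroup) : Std D →ₗ[ℂ] Std D :=
  Finsupp.lsum ℂ fun w =>
    if w * d⁻¹ ∈ parabolicWeyl D P then Finsupp.lsingle (w * d⁻¹) else 0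

theorem stdTop_of_mem {P : Set ι} {d w : D.weylGroup} (h : w * d⁻¹ ∈ parabolicWeyl D P)
    (f : AddMonoidAlgebra ℂ X) :
    stdTop P d (Finsupp.single w f) = Finsupp.single (w * d⁻¹) f := by
  simp [stdTop, h]

theorem stdTop_of_notMem {P : Set ι} {d w : D.weylGroup} (h : w * d⁻¹ ∉ parabolicWeyl D P)
    (f : AddMonoidAlgebra ℂ X) : stdTop P d (Finsupp.single w f) = 0 := by
  simp [stdTop, h]

variable (b κ) in
/-- The map `𝓗 → 𝓗^P` which takes the coefficient of `N_d` with respect to the basis of the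
left `𝓗^P`-module `𝓗` formed by the `N_v`, with `v` of minimal length in `W_P v`. -/
def topCoeff (P : Set ι) (d : D.weylGroup) : Hecke b κ →ₗ[ℂ] Hecke b κ :=
  ofStd b κ ∘ₗ stdTop P d ∘ₗ coef b κ

variable {P Q : Set ι} {d : D.weylGroup}

theorem topCoeff_apply (a : Hecke b κ) :
    topCoeff b κ P d a = ofStd b κ (stdTop P d (coef b κ a)) := rfl

theorem topCoeff_of_mem {w : D.weylGroup} (h : w * d⁻¹ ∈ parabolicWeyl D P)
    (f : AddMonoidAlgebra ℂ X) :
    topCoeff b κ P d (thetaHom b κ f * N b κ w) = thetaHom b κ f * N b κ (w * d⁻¹) := by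
  rw [topCoeff_apply, coef_single, stdTop_of_mem h, ofStd_single]

theorem topCoeff_of_notMem {w : D.weylGroup} (h : w * d⁻¹ ∉ parabolicWeyl D P)
    (f : AddMonoidAlgebra ℂ X) : topCoeff b κ P d (thetaHom b κ f * N b κ w) = 0 := by
  rw [topCoeff_apply, coef_single, stdTop_of_notMem h, map_zero]

theorem topCoeff_N_of_mem {w : D.weylGroup} (h : w * d⁻¹ ∈ parabolicWeyl D P) :
    topCoeff b κ P d (N b κ w) = N b κ (w * d⁻¹) := by
  simpa using topCoeff_of_mem (κ := κ) h 1

theorem topCoeff_N_of_notMem {w : D.weylGroup} (h : w * d⁻¹ ∉ parabolicWeyl D P) :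
    topCoeff b κ P d (N b κ w) = 0 := by
  simpa using topCoeff_of_notMem (κ := κ) h 1

theorem topCoeff_N_self : topCoeff b κ P d (N b κ d) = 1 := by
  rw [topCoeff_N_of_mem (by rw [mul_inv_cancel]; exact one_mem _), mul_inv_cancel, N_one]

theorem topCoeff_mem (a : Hecke b κ) :
    topCoeff b κ P d a ∈ parabolic b κ P := by
  induction a using hecke_induction with
  | zero => rw [map_zero]; exact zero_mem _
  | add a a' ha ha' => rw [map_add]; exact add_mem ha ha'
  | single f w =>
    by_cases h : w * d⁻¹ ∈ parabolicWeyl D P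
    · rw [topCoeff_of_mem h]; exact mul_mem (thetaHom_mem f) (N_mem h)
    · rw [topCoeff_of_notMem h]; exact zero_mem _

theorem topCoeff_thetaHom_mul (f : AddMonoidAlgebra ℂ X) (a : Hecke b κ) :
    topCoeff b κ P d (thetaHom b κ f * a) = thetaHom b κ f * topCoeff b κ P d a := by
  induction a using hecke_induction with
  | zero => simp
  | add a a' ha ha' => rw [mul_add, map_add, map_add, mul_add, ha, ha']
  | single g w =>
    rw [← mul_assoc, ← map_mul]
    by_cases h : w * d⁻¹ ∈ parabolicWeyl D P
    · rw [topCoeff_of_mem h, topCoeff_of_mem h, map_mul, mul_assoc]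
    · rw [topCoeff_of_notMem h, topCoeff_of_notMem h, mul_zero]

theorem topCoeff_eq_zero {S : Set D.weylGroup} (hS : ∀ w ∈ S, w * d⁻¹ ∉ parabolicWeyl D P)
    {a : Hecke b κ} (ha : a ∈ suppOn b κ S) : topCoeff b κ P d a = 0 :=
  suppOn_le (M := LinearMap.ker (topCoeff b κ P d))
    (fun f w hw => topCoeff_of_notMem (hS w hw) f) ha

theorem refl_mul_inv_mem_iff {i : ι} (hi : i ∈ P) {w : D.weylGroup} :
    refl D i * w * d⁻¹ ∈ parabolicWeyl D P ↔ w * d⁻¹ ∈ parabolicWeyl D P := by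
  rw [mul_assoc, Subgroup.mul_mem_cancel_left _ (refl_mem_parabolic hi)]

/-- `d⁻¹` preserves the sign of roots in the span of `P`. So `i` is a left descent of `p d` exactly
when it is one of `p`, and left multiplication by `N_s` has the same coefficients at both. -/
theorem topCoeff_N_refl_mul (h : Opposite b P Q d) {i : ι} (hi : i ∈ P) (a : Hecke b κ) :
    topCoeff b κ P d (N b κ (refl D i) * a) = N b κ (refl D i) * topCoeff b κ P d a := by
  have hib := h.left_subset hi
  rw [topCoeff_apply, topCoeff_apply, coef_N_refl_mul hib, ← ofStd_leftOp hib]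
  congr 1
  refine DFunLike.congr_fun (std_linear_ext (φ := stdTop P d ∘ₗ leftOp b κ i)
    (φ' := leftOp b κ i ∘ₗ stdTop P d) fun w f => ?_) (coef b κ a)
  simp only [LinearMap.comp_apply, leftOp_single, map_add, map_smul]
  by_cases hw : w * d⁻¹ ∈ parabolicWeyl D P
  · have hw' := (refl_mul_inv_mem_iff (d := d) hi).mpr hw
    rw [stdTop_of_mem hw', stdTop_of_mem hw, stdTop_of_mem hw, stdTop_of_mem hw, leftOp_single,
      mul_assoc]
    have hc : b.IsPos (w⁻¹ • i) ↔ b.IsPos ((w * d⁻¹)⁻¹ • i) := by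
      have e : w⁻¹ • i = d⁻¹ • (w * d⁻¹)⁻¹ • i := by
        rw [← mul_smul]; congr 1; group
      rw [e]
      constructor
      · intro h1
        by_contra h2
        exact not_isPos_smul_smul h.left_subset (fun i hi => h.isPos_inv_smul hi) (inv_mem hw) hi
          h2 h1
      · exact isPos_smul_smul h.left_subset (fun i hi => h.isPos_inv_smul hi) (inv_mem hw) hi
    rw [leftC_congr hc]
  · have hw' := fun h' => hw ((refl_mul_inv_mem_iff (d := d) hi).mp h')
    rw [stdTop_of_notMem hw', stdTop_of_notMem hw, stdTop_of_notMem hw, stdTop_of_notMem hw,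
      map_zero, smul_zero, add_zero, add_zero]

theorem topCoeff_mul_left (h : Opposite b P Q d) {a : Hecke b κ} (ha : a ∈ parabolic b κ P)
    (a' : Hecke b κ) : topCoeff b κ P d (a * a') = a * topCoeff b κ P d a' := by
  induction ha using parabolic_algebra_induction h.left_subset generalizing a' with
  | algebraMap z =>
    rw [Algebra.algebraMap_eq_smul_one, smul_mul_assoc, one_mul, map_smul, smul_mul_assoc, one_mul]
  | theta x => rw [← thetaHom_lat, topCoeff_thetaHom_mul]
  | refl i hi => exact topCoeff_N_refl_mul h hi a'
  | add a₁ a₂ _ _ h₁ h₂ => rw [add_mul, map_add, h₁, h₂, add_mul]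
  | mul a₁ a₂ _ _ h₁ h₂ => rw [mul_assoc, h₁, h₂, mul_assoc]

theorem mul_refl_mul_inv (w : D.weylGroup) (j : ι) :
    w * refl D j * d⁻¹ = w * d⁻¹ * refl D (d • j) := by
  rw [← refl_conj]; group

/-- `w s_j d⁻¹ = (w d⁻¹) s_{d j}`, and `w α_j = (w d⁻¹)(d α_j)` shows that the descent conditions
agree as well. -/
theorem topCoeff_mul_N_refl (h : Opposite b P Q d) {j : ι} (hj : j ∈ Q) (a : Hecke b κ) :
    topCoeff b κ P d (a * N b κ (refl D j)) = topCoeff b κ P d a * N b κ (refl D (d • j)) := by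
  have hjb := h.right_subset hj
  have hdj := h.map_right j hj
  have key : stdTop (X := X) P d ∘ₗ rightOp b κ j = rightOp b κ (d • j) ∘ₗ stdTop P d := by
    refine std_linear_ext fun w f => ?_
    simp only [LinearMap.comp_apply, rightOp_single, map_add, map_smul]
    by_cases hw : w * d⁻¹ ∈ parabolicWeyl D P
    · have hw' : w * refl D j * d⁻¹ ∈ parabolicWeyl D P := by
        rw [mul_refl_mul_inv]; exact mul_mem hw (refl_mem_parabolic hdj)
      rw [stdTop_of_mem hw', stdTop_of_mem hw, rightOp_single, mul_refl_mul_inv]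
      have hc : rightC b κ j w = rightC b κ (d • j) (w * d⁻¹) := by
        unfold rightC
        rw [κ.c_smul, ← mul_smul, inv_mul_cancel_right]
      rw [hc]
    · have hw' : w * refl D j * d⁻¹ ∉ parabolicWeyl D P := by
        rw [mul_refl_mul_inv, Subgroup.mul_mem_cancel_right _ (refl_mem_parabolic hdj)]
        exact hw
      rw [stdTop_of_notMem hw', stdTop_of_notMem hw, map_zero, smul_zero, add_zero]
  have h1 := DFunLike.congr_fun key (coef b κ a)
  simp only [LinearMap.comp_apply] at h1
  rw [topCoeff_apply, coef_mul_N_refl hjb, h1, topCoeff_apply]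
  have h2 := coef_mul_N_refl (κ := κ) (h.left_subset hdj) (ofStd b κ (stdTop P d (coef b κ a)))
  rw [coef_ofStd] at h2
  rw [← h2, ofStd_coef]

theorem shorter_mul_inv_notMem (h : Opposite b P Q d) :
    ∀ w ∈ shorter b (len b d), w * d⁻¹ ∉ parabolicWeyl D P := by
  intro w hw hm
  have := len_parabolic_mul h.left_subset (fun i hi => h.isPos_inv_smul hi) hm
  rw [inv_mul_cancel_right] at this
  change len b w < len b d at hw
  omega

/-- Left linearity reduces to `a = N_v` with `v` a minimal representative, so `ℓ(v) ≤ ℓ(d)`. The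
error terms of `N_v θ` are shorter than `d` and vanish under the top coefficient, and so does `N_v`
itself unless `v = d`. -/
theorem topCoeff_mul_thetaHom (h : Opposite b P Q d) (f : AddMonoidAlgebra ℂ X) (a : Hecke b κ) :
    topCoeff b κ P d (a * thetaHom b κ f) = topCoeff b κ P d a * thetaHom b κ (wAct d f) := by
  have hz {v : D.weylGroup} (hv : len b v ≤ len b d) :
      topCoeff b κ P d (N b κ v * thetaHom b κ f)
        = thetaHom b κ (wAct v f) * topCoeff b κ P d (N b κ v) := by
    have h1 := suppOn_mono (κ := κ) (S' := shorter b (len b d))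
      (fun w (hw : len b w < len b v) => lt_of_lt_of_le hw hv) (N_mul_thetaHom_sub_mem v f)
    have h2 := topCoeff_eq_zero (shorter_mul_inv_notMem h) h1
    rw [map_sub, topCoeff_thetaHom_mul] at h2
    exact sub_eq_zero.mp h2
  induction a using hecke_induction with
  | zero => simp
  | add a a' ha ha' => rw [add_mul, map_add, map_add, add_mul, ha, ha']
  | single g w =>
    rw [mul_assoc, topCoeff_thetaHom_mul, topCoeff_thetaHom_mul, mul_assoc]
    congr 1
    obtain ⟨p, hp, v, hv, rfl⟩ := exists_min_coset_rep h.left_subset w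
    rw [← N_mul_of_len (len_parabolic_mul h.left_subset hv hp), mul_assoc,
      topCoeff_mul_left h (N_mem hp), topCoeff_mul_left h (N_mem hp), hz (h.len_le hv), mul_assoc]
    congr 1
    by_cases hd : v = d
    · rw [hd, topCoeff_N_self, mul_one, one_mul]
    · have h3 : len b v < len b d := by
        by_contra hc
        exact hd (h.eq_of_len hv (by omega))
      rw [topCoeff_N_of_notMem (shorter_mul_inv_notMem h v h3), mul_zero, zero_mul]

/-! #### The isomorphism between opposite parabolic subalgebras -/

/-- For the generators this is contained in the two preceding rules. Allowing arbitrary `a` lets the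
induction pass to products: the choice `a = N_d c` shows that `c ↦ E(N_d c)` is multiplicative. -/
theorem topCoeff_mul_right (h : Opposite b P Q d) {c : Hecke b κ} (hc : c ∈ parabolic b κ Q)
    (a : Hecke b κ) :
    topCoeff b κ P d (a * c) = topCoeff b κ P d a * topCoeff b κ P d (N b κ d * c) := by
  induction hc using parabolic_algebra_induction h.right_subset generalizing a with
  | algebraMap z =>
    rw [Algebra.algebraMap_eq_smul_one, mul_smul_comm, mul_one, map_smul, mul_smul_comm, mul_one,
      map_smul, topCoeff_N_self, mul_smul_comm, mul_one]
  | theta x =>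
    rw [← thetaHom_lat, topCoeff_mul_thetaHom h, topCoeff_mul_thetaHom h, topCoeff_N_self, one_mul]
  | refl j hj => rw [topCoeff_mul_N_refl h hj, topCoeff_mul_N_refl h hj, topCoeff_N_self, one_mul]
  | add c c' _ _ ih ih' => rw [mul_add, map_add, ih, ih', mul_add, map_add, mul_add]
  | mul c c' _ _ ih ih' => rw [← mul_assoc, ih', ih, ← mul_assoc, ih' (N b κ d * c), mul_assoc]

/-- The homomorphism `𝓗^Q → 𝓗^P` with `N_w θ_x ↦ N_(d w d⁻¹) θ_(d x)`. -/
def oppHom (h : Opposite b P Q d) : parabolic b κ Q →ₐ[ℂ] parabolic b κ P where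
  toFun c := ⟨topCoeff b κ P d (N b κ d * c), topCoeff_mem _⟩
  map_one' := Subtype.ext (by
    change topCoeff b κ P d (N b κ d * 1) = 1
    rw [mul_one, topCoeff_N_self])
  map_mul' c c' := Subtype.ext (by
    change topCoeff b κ P d (N b κ d * (c * c')) = _ * _
    rw [← mul_assoc, topCoeff_mul_right h c'.2])
  map_zero' := Subtype.ext (by
    change topCoeff b κ P d (N b κ d * 0) = 0
    rw [mul_zero, map_zero])
  map_add' c c' := Subtype.ext (by
    change topCoeff b κ P d (N b κ d * (c + c')) = _ + _
    rw [mul_add, map_add])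
  commutes' z := Subtype.ext (by
    change topCoeff b κ P d (N b κ d * algebraMap ℂ _ z) = algebraMap ℂ _ z
    rw [Algebra.algebraMap_eq_smul_one, mul_smul_comm, mul_one, map_smul, topCoeff_N_self])

theorem oppHom_apply (h : Opposite b P Q d) (c : parabolic b κ Q) :
    (oppHom h c : Hecke b κ) = topCoeff b κ P d (N b κ d * c) := rfl

theorem oppHom_N (h : Opposite b P Q d) {w : D.weylGroup} (hw : w ∈ parabolicWeyl D Q) :
    oppHom h ⟨N b κ w, N_mem hw⟩
      = ⟨N b κ (d * w * d⁻¹), N_mem (conj_mem_parabolic h.map_right hw)⟩ := by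
  refine Subtype.ext ?_
  rw [oppHom_apply, N_mul_of_len (len_mul_parabolic h.right_subset (fun i hi => h.isPos_smul hi) hw),
    topCoeff_N_of_mem (conj_mem_parabolic h.map_right hw)]

theorem oppHom_theta (h : Opposite b P Q d) (x : X) :
    oppHom h ⟨theta b κ x, theta_mem x⟩ = ⟨theta b κ (d • x), theta_mem _⟩ := by
  refine Subtype.ext ?_
  rw [oppHom_apply]
  change topCoeff b κ P d (N b κ d * theta b κ x) = theta b κ (d • x)
  rw [← thetaHom_lat, topCoeff_mul_thetaHom h, topCoeff_N_self, one_mul, wAct_lat, thetaHom_lat]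

theorem oppHom_symm (h : Opposite b P Q d) (c : parabolic b κ Q) :
    oppHom h.symm (oppHom h c) = c := by
  obtain ⟨c, hc⟩ := c
  induction hc using parabolic_algebra_induction h.right_subset with
  | algebraMap z => exact ((oppHom h.symm).comp (oppHom h)).commutes z
  | theta x => rw [oppHom_theta, oppHom_theta]; simp only [inv_smul_smul]
  | refl i hi => 
    rw [oppHom_N h (refl_mem_parabolic hi),
      oppHom_N h.symm (conj_mem_parabolic h.map_right (refl_mem_parabolic hi))]
    congr 2
    group
  | add c c' hc hc' ih ih' =>
    have e : (⟨c + c', add_mem hc hc'⟩ : parabolic b κ Q) = ⟨c, hc⟩ + ⟨c', hc'⟩ := rfl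
    rw [e, map_add, map_add, ih, ih']
  | mul c c' hc hc' ih ih' =>
    have e : (⟨c * c', mul_mem hc hc'⟩ : parabolic b κ Q) = ⟨c, hc⟩ * ⟨c', hc'⟩ := rfl
    rw [e, map_mul, map_mul, ih, ih']

theorem oppHom_oppHom_symm (h : Opposite b P Q d) (c : parabolic b κ P) :
    oppHom h (oppHom h.symm c) = c := by
  have := oppHom_symm h.symm c
  simp only [inv_inv] at this
  exact this

end TopCoefficient

/-! ### Frobenius extensions of the second kind -/

section Frobenius

variable {A : Type u} [Ring A] [Algebra ℂ A]

/-- A pair of subalgebras `B`, `C` of `A`, an isomorphism `B → C` (given as the restriction of a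
linear map `equiv` with inverse `inv`), a map `E : A → B` which is linear for the left action of
`B` and for the right action of `C`, transported to `B`, and dual bases for the associated form. -/
structure FrobeniusData (B C : Subalgebra ℂ A) where
  trace : A →ₗ[ℂ] A
  iso : A →ₗ[ℂ] A
  inv : A →ₗ[ℂ] A
  trace_mem : ∀ a, trace a ∈ B
  iso_mem : ∀ a ∈ B, iso a ∈ C
  inv_mem : ∀ a ∈ C, inv a ∈ B
  inv_iso : ∀ a ∈ B, inv (iso a) = a
  iso_inv : ∀ a ∈ C, iso (inv a) = a
  iso_one : iso 1 = 1
  iso_mul : ∀ a ∈ B, ∀ a' ∈ B, iso (a * a') = iso a * iso a'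
  trace_left : ∀ b ∈ B, ∀ a, trace (b * a) = b * trace a
  trace_right : ∀ b ∈ B, ∀ a, trace (a * iso b) = trace a * b
  index : Type u
  fintype : Fintype index
  x : index → A
  y : index → A
  left_dual : ∀ a, ∑ i, trace (a * x i) * y i = a
  right_dual : ∀ a, ∑ i, x i * iso (trace (y i * a)) = a

namespace FrobeniusData

attribute [instance] FrobeniusData.fintype

variable {B C : Subalgebra ℂ A} (F : FrobeniusData B C)

/-- The isomorphism `B → C`. -/
def isoHom : B →ₐ[ℂ] C where
  toFun a := ⟨F.iso a, F.iso_mem a a.2⟩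
  map_one' := Subtype.ext F.iso_one
  map_mul' a a' := Subtype.ext (F.iso_mul a a.2 a' a'.2)
  map_zero' := Subtype.ext (map_zero F.iso)
  map_add' a a' := Subtype.ext (map_add F.iso _ _)
  commutes' z := Subtype.ext (by
    change F.iso (algebraMap ℂ A z) = algebraMap ℂ A z
    rw [Algebra.algebraMap_eq_smul_one, map_smul, F.iso_one])

/-- The isomorphism `B → C`. -/
def isoEquiv : B ≃ₐ[ℂ] C :=
  { F.isoHom with
    invFun := fun c => ⟨F.inv c, F.inv_mem c c.2⟩
    left_inv := fun a => Subtype.ext (F.inv_iso a a.2)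
    right_inv := fun c => Subtype.ext (F.iso_inv c c.2) }

theorem isoEquiv_apply (a : B) : (F.isoEquiv a : A) = F.iso a := rfl

variable {F}

/-- The trace map with values in `B`. -/
def traceB (F : FrobeniusData B C) (a : A) : B := ⟨F.trace a, F.trace_mem a⟩

theorem traceB_add (a a' : A) : F.traceB (a + a') = F.traceB a + F.traceB a' :=
  Subtype.ext (map_add F.trace a a')

theorem traceB_mul_left (c : B) (a : A) : F.traceB (c * a) = c * F.traceB a :=
  Subtype.ext (F.trace_left c c.2 a)

theorem traceB_mul_right (a : A) (c : C) :
    F.traceB (a * c) = F.traceB a * F.isoEquiv.symm c := by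
  refine Subtype.ext ?_
  obtain ⟨b, rfl⟩ := F.isoEquiv.surjective c
  rw [AlgEquiv.symm_apply_apply]
  exact F.trace_right b b.2 a

section Maps

variable {V W M : Type (max u v)} [AddCommGroup V] [Module B V] [AddCommGroup W] [Module C W]
  [AddCommGroup M] [Module A M]

/-- The map `A ⊗ W → V`, `a ⊗ w ↦ E(a) w`, where the `B`-module `V` is identified with the
`C`-module `W`. -/
def counitAux (F : FrobeniusData B C) (e : W →+ V) : A ⊗[ℤ] W →ₗ[ℤ] V :=
  TensorProduct.lift (LinearMap.mk₂ ℤ (fun a w => F.traceB a • e w)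
    (fun a a' w => by rw [← add_smul, traceB_add])
    (fun n a w => by
      rw [← smul_assoc]; congr 1; exact Subtype.ext (map_zsmul F.trace n a))
    (fun a w w' => by rw [map_add, smul_add])
    (fun n a w => by rw [map_zsmul, smul_comm]))

theorem counitAux_tmul (e : W →+ V) (a : A) (w : W) :
    F.counitAux e (a ⊗ₜ w) = F.traceB a • e w := rfl

theorem counitAux_eq_zero {e : W →+ V} (he : ∀ (c : C) w, e (c • w) = F.isoEquiv.symm c • e w)
    {t : A ⊗[ℤ] W} (ht : t ∈ balanced.{u, v} C W) : F.counitAux e t = 0 := by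
  -- `balanced` is an `A`-span but the map is not `A`-linear, so vanishing has to be proved for all
  -- `A`-multiples at once.
  suffices h : ∀ a : A, F.counitAux e (a • t) = 0 by
    have h1 := h 1
    rwa [one_smul] at h1
  induction ht using Submodule.span_induction with
  | mem t ht =>
    obtain ⟨a, c, m, rfl⟩ := ht
    intro a'
    rw [smul_sub, map_sub, TensorProduct.smul_tmul', TensorProduct.smul_tmul', counitAux_tmul,
      counitAux_tmul, smul_eq_mul, smul_eq_mul, ← mul_assoc, traceB_mul_right, mul_smul, he,
      sub_self]
  | zero => intro a; rw [smul_zero, map_zero]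
  | add t t' _ _ h h' => intro a; rw [smul_add, map_add, h, h', add_zero]
  | smul a' t _ h => intro a; rw [← mul_smul]; exact h _

/-- The map `A ⊗_C W → V`, `a ⊗ w ↦ E(a) w`. -/
def counitMap (F : FrobeniusData B C) (e : W →+ V)
    (he : ∀ (c : C) w, e (c • w) = F.isoEquiv.symm c • e w) : IndObj.{u, v} C W →ₗ[ℤ] V :=
  Submodule.liftQ ((balanced.{u, v} C W).restrictScalars ℤ) (F.counitAux e)
    (fun _ ht => counitAux_eq_zero he ht) ∘ₗ
    (Submodule.Quotient.restrictScalarsEquiv ℤ (balanced.{u, v} C W)).symm.toLinearMap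

theorem counitMap_mk (e : W →+ V) (he : ∀ (c : C) w, e (c • w) = F.isoEquiv.symm c • e w)
    (a : A) (w : W) :
    F.counitMap e he (Submodule.Quotient.mk (a ⊗ₜ w)) = F.traceB a • e w := rfl

theorem indObj_induction {p : IndObj.{u, v} C W → Prop} (zero : p 0)
    (tmul : ∀ (a : A) (w : W), p (Submodule.Quotient.mk (a ⊗ₜ w)))
    (add : ∀ t t', p t → p t' → p (t + t')) (t : IndObj.{u, v} C W) : p t := by
  induction t using Submodule.Quotient.induction_on with
  | _ t =>
    induction t using TensorProduct.induction_on with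
    | zero => exact zero
    | tmul a w => exact tmul a w
    | add t t' h h' => exact add _ _ h h'

theorem counitMap_smul (e : W →+ V) (he : ∀ (c : C) w, e (c • w) = F.isoEquiv.symm c • e w)
    (c : B) (t : IndObj.{u, v} C W) :
    F.counitMap e he ((c : A) • t) = c • F.counitMap e he t := by
  induction t using indObj_induction with
  | zero => rw [smul_zero, map_zero, smul_zero]
  | tmul a w =>
    rw [← Submodule.Quotient.mk_smul, TensorProduct.smul_tmul', smul_eq_mul, counitMap_mk,
      counitMap_mk, traceB_mul_left, mul_smul]
  | add t t' h h' => rw [smul_add, map_add, map_add, smul_add, h, h']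

theorem mk_mul_tmul (a : A) (c : C) (w : W) :
    (Submodule.Quotient.mk ((a * c) ⊗ₜ w) : IndObj.{u, v} C W)
      = Submodule.Quotient.mk (a ⊗ₜ (c • w)) :=
  (Submodule.Quotient.eq _).mpr (Submodule.subset_span ⟨a, c, w, rfl⟩)

theorem smul_mk_tmul (a a' : A) (w : W) :
    a • (Submodule.Quotient.mk (a' ⊗ₜ w) : IndObj.{u, v} C W)
      = Submodule.Quotient.mk ((a * a') ⊗ₜ w) := rfl

theorem mk_sum_tmul {J : Type*} (s : Finset J) (a : J → A) (w : W) :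
    (Submodule.Quotient.mk ((∑ i ∈ s, a i) ⊗ₜ w) : IndObj.{u, v} C W)
      = ∑ i ∈ s, Submodule.Quotient.mk (a i ⊗ₜ w) := by
  rw [TensorProduct.sum_tmul]
  exact map_sum (Submodule.mkQ (balanced.{u, v} C W)) _ _

theorem mk_tmul_sum {J : Type*} (s : Finset J) (a : A) (w : J → W) :
    (Submodule.Quotient.mk (a ⊗ₜ (∑ i ∈ s, w i)) : IndObj.{u, v} C W)
      = ∑ i ∈ s, Submodule.Quotient.mk (a ⊗ₜ w i) := by
  rw [TensorProduct.tmul_sum]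
  exact map_sum (Submodule.mkQ (balanced.{u, v} C W)) _ _

/-- The map `M → A ⊗_C W`, `m ↦ ∑ x_i ⊗ y_i m`, where the `B`-module `M` is identified with the
`C`-module `W`. -/
def unitMap (F : FrobeniusData B C) (e : M →+ W)
    (he : ∀ (c : B) m, e ((c : A) • m) = F.isoEquiv c • e m) : M →ₗ[A] IndObj.{u, v} C W where
  toFun m := ∑ i, Submodule.Quotient.mk (F.x i ⊗ₜ e (F.y i • m))
  map_add' m m' := by
    rw [← Finset.sum_add_distrib]
    refine Finset.sum_congr rfl fun i _ => ?_
    rw [smul_add, map_add, TensorProduct.tmul_add, Submodule.Quotient.mk_add]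
  -- `left_dual` expands `y_i a` and `right_dual` expands `a x_j`, both with the coefficients `E(y_i
  -- a x_j)`. After moving these across the tensor sign, `a` commutes with `∑ x_i ⊗ y_i`.
  map_smul' a m := by
    have h1 : ∀ i, e (F.y i • a • m)
        = ∑ j, F.isoEquiv (F.traceB (F.y i * a * F.x j)) • e (F.y j • m) := fun i => by
      conv_lhs => rw [← mul_smul, ← F.left_dual (F.y i * a), Finset.sum_smul, map_sum]
      refine Finset.sum_congr rfl fun j _ => ?_
      rw [← he, mul_smul]; rfl
    have h2 : ∀ j, a * F.x j = ∑ i, F.x i * (F.isoEquiv (F.traceB (F.y i * a * F.x j)) : A) :=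
      fun j => by
        conv_lhs => rw [← F.right_dual (a * F.x j)]
        refine Finset.sum_congr rfl fun i _ => ?_
        rw [← mul_assoc]; rfl
    simp only [RingHom.id_apply, Finset.smul_sum, smul_mk_tmul, h1, h2, mk_sum_tmul, mk_tmul_sum,
      mk_mul_tmul]
    exact Finset.sum_comm

theorem unitMap_apply (e : M →+ W) (he : ∀ (c : B) m, e ((c : A) • m) = F.isoEquiv c • e m)
    (m : M) : F.unitMap e he m = ∑ i, Submodule.Quotient.mk (F.x i ⊗ₜ e (F.y i • m)) := rfl

end Maps

/-- The left triangle identity, which amounts to `∑ E(x_i) y_i = 1`. -/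
theorem counit_unit {V W M : Type (max u v)} [AddCommGroup V] [Module B V] [AddCommGroup W]
    [Module C W] [AddCommGroup M] [Module A M] (e : M →+ W)
    (he : ∀ (c : B) m, e ((c : A) • m) = F.isoEquiv c • e m) (e' : W →+ V)
    (he' : ∀ (c : C) w, e' (c • w) = F.isoEquiv.symm c • e' w)
    (hs : ∀ (c : B) m, e' (e ((c : A) • m)) = c • e' (e m)) (m : M) :
    F.counitMap e' he' (F.unitMap e he m) = e' (e m) := by
  rw [unitMap_apply, map_sum]
  have h : ∀ i, F.counitMap e' he' (Submodule.Quotient.mk (F.x i ⊗ₜ e (F.y i • m)))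
      = e' (e ((F.trace (1 * F.x i) * F.y i) • m)) := fun i => by
    rw [counitMap_mk, ← hs, mul_smul, one_mul]; rfl
  rw [Finset.sum_congr rfl fun i _ => h i, ← map_sum, ← map_sum, ← Finset.sum_smul, F.left_dual,
    one_smul]

/-- The right triangle identity, which amounts to `∑ x_i ψ(E(y_i a)) = a`. In the application `e`
and `e'` are identity maps that only change the module structure, and `f` is the pulled back counit.
-/
theorem unit_counit {V W W' : Type (max u v)} [AddCommGroup V] [Module B V] [AddCommGroup W]
    [Module C W] [AddCommGroup W'] [Module C W'] (e' : W →+ V)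
    (he' : ∀ (c : C) w, e' (c • w) = F.isoEquiv.symm c • e' w) (e : IndObj.{u, v} C W →+ W')
    (he : ∀ (c : B) m, e ((c : A) • m) = F.isoEquiv c • e m) (f : W' →ₗ[C] W)
    (hf : ∀ t, e' (f (e t)) = F.counitMap e' he' t) (hinj : Function.Injective e')
    (t : IndObj.{u, v} C W) : indMap.{u, v} C f (F.unitMap e he t) = t := by
  induction t using indObj_induction with
  | zero => rw [map_zero, map_zero]
  | add t t' h h' => rw [map_add, map_add, h, h']
  | tmul a w =>
    rw [unitMap_apply, map_sum]
    have h1 : ∀ i, f (e (F.y i • Submodule.Quotient.mk (a ⊗ₜ w)))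
        = F.isoEquiv (F.traceB (F.y i * a)) • w := fun i => hinj (by
      rw [hf, smul_mk_tmul, counitMap_mk, he', AlgEquiv.symm_apply_apply])
    have h2 : ∀ i, indMap.{u, v} C f (Submodule.Quotient.mk
        (F.x i ⊗ₜ e (F.y i • Submodule.Quotient.mk (a ⊗ₜ w))))
        = Submodule.Quotient.mk ((F.x i * F.iso (F.trace (F.y i * a))) ⊗ₜ w) := fun i => by
      change Submodule.Quotient.mk (F.x i ⊗ₜ f (e (F.y i • Submodule.Quotient.mk (a ⊗ₜ w)))) = _
      rw [h1, ← mk_mul_tmul]; rfl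
    rw [Finset.sum_congr rfl fun i _ => h2 i, ← mk_sum_tmul, F.right_dual]

theorem unitMap_naturality {M M' W W' : Type (max u v)} [AddCommGroup M] [Module A M]
    [AddCommGroup M'] [Module A M'] [AddCommGroup W] [Module C W] [AddCommGroup W'] [Module C W']
    (e : M →+ W) (he : ∀ (c : B) m, e ((c : A) • m) = F.isoEquiv c • e m)
    (e' : M' →+ W') (he' : ∀ (c : B) m, e' ((c : A) • m) = F.isoEquiv c • e' m)
    (f : M →ₗ[A] M') (g : W →ₗ[C] W') (h : ∀ m, e' (f m) = g (e m)) (m : M) :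
    F.unitMap e' he' (f m) = indMap.{u, v} C g (F.unitMap e he m) := by
  rw [unitMap_apply, unitMap_apply, map_sum]
  refine Finset.sum_congr rfl fun i _ => ?_
  rw [← map_smul, h]
  rfl

theorem counitMap_naturality {V V' W W' : Type (max u v)} [AddCommGroup V] [Module B V]
    [AddCommGroup V'] [Module B V'] [AddCommGroup W] [Module C W] [AddCommGroup W'] [Module C W']
    (e : W →+ V) (he : ∀ (c : C) w, e (c • w) = F.isoEquiv.symm c • e w)
    (e' : W' →+ V') (he' : ∀ (c : C) w, e' (c • w) = F.isoEquiv.symm c • e' w)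
    (f : V →ₗ[B] V') (g : W →ₗ[C] W') (h : ∀ w, e' (g w) = f (e w)) (t : IndObj.{u, v} C W) :
    F.counitMap e' he' (indMap.{u, v} C g t) = f (F.counitMap e he t) := by
  induction t using indObj_induction with
  | zero => simp only [map_zero]
  | add t t' h h' => simp only [map_add, h, h']
  | tmul a w =>
    change F.traceB a • e' (g w) = f (F.traceB a • e w)
    rw [map_smul, h]

variable (F) in
/-- The identity map of `M`, considered as a map to `M` as a `C`-module. -/
def toPull (M : ModuleCat.{max u v} A) :
    M →+ (pull.{u, v} F.isoEquiv.symm).obj ((Res.{u, v} B).obj M) := AddMonoidHom.id M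

variable (F) in
/-- The identity map of `V`, considered as a map from `V` as a `C`-module. -/
def ofPull (V : ModuleCat.{max u v} B) : (pull.{u, v} F.isoEquiv.symm).obj V →+ V :=
  AddMonoidHom.id V

variable (F) in
theorem toPull_smul (M : ModuleCat.{max u v} A) (c : B) (m : M) :
    F.toPull M ((c : A) • m) = F.isoEquiv c • F.toPull M m := by
  change (c : A) • m = ((F.isoEquiv.symm (F.isoEquiv c) : B) : A) • m
  rw [AlgEquiv.symm_apply_apply]

variable (F) in
theorem ofPull_smul (V : ModuleCat.{max u v} B) (c : C)
    (w : (pull.{u, v} F.isoEquiv.symm).obj V) :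
    F.ofPull V (c • w) = F.isoEquiv.symm c • F.ofPull V w := rfl

variable (F) in
/-- The unit of the adjunction between restriction and induction. -/
def unitHom (M : ModuleCat.{max u v} A) :
    M ⟶ (Res.{u, v} B ⋙ pull.{u, v} F.isoEquiv.symm ⋙ Induce.{u, v} C).obj M :=
  ModuleCat.ofHom (F.unitMap (W := (pull.{u, v} F.isoEquiv.symm).obj ((Res.{u, v} B).obj M))
    (F.toPull M) (F.toPull_smul M))

variable (F) in
/-- The counit of the adjunction between restriction and induction. -/
def counitHom (V : ModuleCat.{max u v} B) :
    ((pull.{u, v} F.isoEquiv.symm ⋙ Induce.{u, v} C) ⋙ Res.{u, v} B).obj V ⟶ V :=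
  ModuleCat.ofHom (X := ((pull.{u, v} F.isoEquiv.symm ⋙ Induce.{u, v} C) ⋙ Res.{u, v} B).obj V)
    (Y := V)
    { toFun := F.counitMap (V := V) (W := (pull.{u, v} F.isoEquiv.symm).obj V)
        (F.ofPull V) (F.ofPull_smul V)
      map_add' := map_add _
      map_smul' := counitMap_smul _ _ }

variable (F) in
/-- Restriction to `B` is left adjoint to the composition of `B ≅ C` and induction from `C`. -/
def adjunction : Res.{u, v} B ⊣ pull.{u, v} F.isoEquiv.symm ⋙ Induce.{u, v} C :=
  Adjunction.mkOfUnitCounit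
    { unit :=
        { app := F.unitHom
          naturality := fun M M' f => ModuleCat.hom_ext (LinearMap.ext fun m =>
            F.unitMap_naturality (M := M) (M' := M')
              (W := (pull.{u, v} F.isoEquiv.symm).obj ((Res.{u, v} B).obj M))
              (W' := (pull.{u, v} F.isoEquiv.symm).obj ((Res.{u, v} B).obj M'))
              (F.toPull M) (F.toPull_smul M) (F.toPull M') (F.toPull_smul M') f.hom
              ((pull.{u, v} F.isoEquiv.symm).map ((Res.{u, v} B).map f)).hom (fun _ => rfl) m) }
      counit :=
        { app := F.counitHom
          naturality := fun V V' f => ModuleCat.hom_ext (LinearMap.ext fun t =>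
            F.counitMap_naturality (V := V) (V' := V')
              (W := (pull.{u, v} F.isoEquiv.symm).obj V)
              (W' := (pull.{u, v} F.isoEquiv.symm).obj V')
              (F.ofPull V) (F.ofPull_smul V) (F.ofPull V') (F.ofPull_smul V') f.hom
              ((pull.{u, v} F.isoEquiv.symm).map f).hom (fun _ => rfl) t) }
      left_triangle := NatTrans.ext (funext fun M => ModuleCat.hom_ext (LinearMap.ext fun m =>
        F.counit_unit (M := M) (V := (Res.{u, v} B).obj M)
          (W := (pull.{u, v} F.isoEquiv.symm).obj ((Res.{u, v} B).obj M))
          (F.toPull M) (F.toPull_smul M) (F.ofPull ((Res.{u, v} B).obj M))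
          (F.ofPull_smul ((Res.{u, v} B).obj M))
          (fun _ _ => rfl) m))
      right_triangle := NatTrans.ext (funext fun V => ModuleCat.hom_ext (LinearMap.ext fun t => by
        refine F.unit_counit (V := V) (W := (pull.{u, v} F.isoEquiv.symm).obj V)
          (W' := (pull.{u, v} F.isoEquiv.symm).obj ((Res.{u, v} B).obj
            ((Induce.{u, v} C).obj ((pull.{u, v} F.isoEquiv.symm).obj V))))
          (F.ofPull V) (F.ofPull_smul V)
          (F.toPull ((Induce.{u, v} C).obj ((pull.{u, v} F.isoEquiv.symm).obj V)))
          (F.toPull_smul ((Induce.{u, v} C).obj ((pull.{u, v} F.isoEquiv.symm).obj V))) ((pull.{u, v} F.isoEquiv.symm).map (F.counitHom V)).hom (fun _ => rfl)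
          (fun _ _ h => h) t)) }

theorem nonempty_adjunction (ψ : B ≃ₐ[ℂ] C) (hψ : ∀ a : B, (ψ a : A) = F.iso a) :
    Nonempty (Res.{u, v} B ⊣ pull.{u, v} ψ.symm ⋙ Induce.{u, v} C) := by
  obtain rfl : ψ = F.isoEquiv := AlgEquiv.ext fun a => Subtype.ext (hψ a)
  exact ⟨F.adjunction⟩

/-- Composition with the equivalence given by `ψ` moves the twist from the right adjoint to the left
adjoint. -/
theorem nonempty_adjunction_pull (ψ : C ≃ₐ[ℂ] B) (hψ : ∀ a : C, F.inv a = ψ a) :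
    Nonempty (Res.{u, v} B ⋙ pull.{u, v} ψ ⊣ Induce.{u, v} C) := by
  obtain rfl : ψ = F.isoEquiv.symm := AlgEquiv.ext fun a => Subtype.ext (hψ a).symm
  let e : ModuleCat.{max u v} B ≌ ModuleCat.{max u v} C :=
    ModuleCat.restrictScalarsEquivalenceOfRingEquiv (F.isoEquiv.symm : C ≃ₐ[ℂ] B).toRingEquiv
  have h1 : pull.{u, v} F.isoEquiv.symm ⊣ e.inverse := e.toAdjunction
  have i : e.inverse ⋙ pull.{u, v} F.isoEquiv.symm ≅ 𝟭 _ := e.counitIso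
  exact ⟨(F.adjunction.comp h1).ofNatIsoRight
    ((Functor.associator _ _ _).symm ≪≫ Functor.isoWhiskerRight i _ ≪≫ Functor.leftUnitor _)⟩

end FrobeniusData

end Frobenius

/-! ### Crossed products -/

namespace Crossed

section Basic

variable {A Γ : Type u} [Ring A] [Algebra ℂ A] [Group Γ]
  {act : Γ →* (A ≃ₐ[ℂ] A)} {κ : Cocycle Γ}

theorem coeff_single_self (γ : Γ) (a : A) : (single act κ γ a).coeff γ = a := by
  simp [single]

theorem coeff_single_of_ne {γ δ : Γ} (h : δ ≠ γ) (a : A) : (single act κ γ a).coeff δ = 0 := by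
  simp [single, h]

theorem single_zero (γ : Γ) : single act κ γ (0 : A) = 0 := by
  ext δ
  by_cases h : δ = γ
  · rw [h, coeff_single_self]; rfl
  · rw [coeff_single_of_ne h]; rfl

theorem single_add (γ : Γ) (a a' : A) :
    single act κ γ (a + a') = single act κ γ a + single act κ γ a' := by
  ext δ
  by_cases h : δ = γ
  · subst h; simp only [coeff_add, Pi.add_apply, coeff_single_self]
  · simp only [coeff_add, Pi.add_apply, coeff_single_of_ne h, add_zero]

theorem single_smul (γ : Γ) (z : ℂ) (a : A) : single act κ γ (z • a) = z • single act κ γ a := by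
  ext δ
  by_cases h : δ = γ
  · subst h; simp only [coeff_smul, Pi.smul_apply, coeff_single_self]
  · simp only [coeff_smul, Pi.smul_apply, coeff_single_of_ne h, smul_zero]

/-- The map `a ↦ a N_γ`, as a linear map. -/
def singleHom (act : Γ →* (A ≃ₐ[ℂ] A)) (κ : Cocycle Γ) (γ : Γ) : A →ₗ[ℂ] Crossed act κ where
  toFun := single act κ γ
  map_add' := single_add γ
  map_smul' z a := single_smul γ z a

theorem singleHom_apply (γ : Γ) (a : A) : singleHom act κ γ a = single act κ γ a := rfl

/-- The coefficient of `N_γ`, as a linear map. -/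
def coeffHom (act : Γ →* (A ≃ₐ[ℂ] A)) (κ : Cocycle Γ) (γ : Γ) : Crossed act κ →ₗ[ℂ] A where
  toFun f := f.coeff γ
  map_add' _ _ := rfl
  map_smul' _ _ := rfl

theorem coeff_sum {J : Type*} (s : Finset J) (f : J → Crossed act κ) (γ : Γ) :
    (∑ i ∈ s, f i).coeff γ = ∑ i ∈ s, (f i).coeff γ :=
  map_sum (coeffHom act κ γ) _ _

variable [Fintype Γ]

theorem eq_sum_single (f : Crossed act κ) : f = ∑ γ, single act κ γ (f.coeff γ) := by
  ext δ
  rw [coeff_sum, Finset.sum_eq_single δ, coeff_single_self]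
  · intro γ _ h; exact coeff_single_of_ne h.symm _
  · simp

theorem crossed_induction {p : Crossed act κ → Prop} (zero : p 0)
    (add : ∀ f g, p f → p g → p (f + g)) (single : ∀ γ a, p (single act κ γ a))
    (f : Crossed act κ) : p f := by
  rw [eq_sum_single f]
  induction (Finset.univ : Finset Γ) using Finset.cons_induction with
  | empty => exact zero
  | cons γ s h ih => rw [Finset.sum_cons]; exact add _ _ (single _ _) ih

theorem single_mul_single (γ δ : Γ) (a a' : A) :
    single act κ γ a * single act κ δ a'
      = single act κ (γ * δ) ((κ.val γ δ).val • (a * act γ a')) := by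
  ext ε
  rw [coeff_mul, Finset.sum_eq_single γ]
  · by_cases h : ε = γ * δ
    · subst h
      rw [inv_mul_cancel_left, coeff_single_self, coeff_single_self, coeff_single_self]
    · have h' : γ⁻¹ * ε ≠ δ := fun h' => h (by rw [← h', mul_inv_cancel_left])
      rw [coeff_single_of_ne h', coeff_single_of_ne h, map_zero, mul_zero, smul_zero]
  · intro γ' _ h
    rw [coeff_single_of_ne h, zero_mul, smul_zero]
  · simp

theorem incl_mul_single (a a' : A) (γ : Γ) :
    incl act κ a * single act κ γ a' = single act κ γ (a * a') := by
  rw [incl, single_mul_single, one_mul, Cocycle.one_left, map_one, smul_mul_assoc, smul_smul,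
    Units.mul_inv, one_smul]
  rfl

theorem single_mul_incl (γ : Γ) (a a' : A) :
    single act κ γ a * incl act κ a' = single act κ γ (a * act γ a') := by
  rw [incl, single_mul_single, mul_one, Cocycle.one_right, map_smul, mul_smul_comm, smul_smul,
    Units.mul_inv, one_smul]

theorem incl_mul_Ngamma (a : A) (γ : Γ) :
    incl act κ a * Ngamma act κ γ = single act κ γ a := by
  rw [Ngamma, incl_mul_single, mul_one]

/-- The inverse of `N_γ`. -/
def NgammaInv (act : Γ →* (A ≃ₐ[ℂ] A)) (κ : Cocycle Γ) (γ : Γ) : Crossed act κ :=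
  -- The first scalar cancels `♮(γ⁻¹, γ)`; the second is needed because the unit is `♮(1,1)⁻¹ N_1`.
  single act κ γ⁻¹ (((κ.val γ⁻¹ γ)⁻¹ * (κ.val 1 1)⁻¹ : ℂˣ).val • 1)

theorem NgammaInv_mul (γ : Γ) : NgammaInv act κ γ * Ngamma act κ γ = 1 := by
  rw [NgammaInv, Ngamma, single_mul_single, map_one, mul_one, smul_smul, inv_mul_cancel,
    ← Units.val_mul, mul_inv_cancel_left]
  rfl

theorem single_mul_NgammaInv (γ δ : Γ) (a : A) :
    ∃ a', single act κ δ a * NgammaInv act κ γ = single act κ (δ * γ⁻¹) a' :=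
  ⟨_, single_mul_single _ _ _ _⟩

theorem Ngamma_mul_single (γ δ : Γ) (a : A) :
    ∃ a', Ngamma act κ γ * single act κ δ a = single act κ (γ * δ) a' :=
  ⟨_, single_mul_single _ _ _ _⟩

end Basic

end Crossed

/-! ### Frobenius data for crossed products with finite groups -/

namespace FrobeniusData

open Crossed

variable {A Γ : Type u} [Ring A] [Algebra ℂ A] [Group Γ] [Fintype Γ]
  {act : Γ →* (A ≃ₐ[ℂ] A)} {κ : Cocycle Γ} {Γ' : Subgroup Γ}

/-- `B'` consists of the sums of terms `a N_γ` with `a ∈ B` and `γ ∈ Γ'`. -/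
def IsCrossedSub (Γ' : Subgroup Γ) (B : Subalgebra ℂ A) (B' : Subalgebra ℂ (Crossed act κ)) :
    Prop :=
  ∀ f, f ∈ B' ↔ ∀ γ, f.coeff γ ∈ B ∧ (γ ∉ Γ' → f.coeff γ = 0)

/-- The coefficientwise extension of a linear map. -/
def mapCoeff (act : Γ →* (A ≃ₐ[ℂ] A)) (κ : Cocycle Γ) (L : A →ₗ[ℂ] A) :
    Crossed act κ →ₗ[ℂ] Crossed act κ where
  toFun f := ⟨fun γ => L (f.coeff γ)⟩
  map_add' _ _ := Crossed.ext (funext fun _ => map_add L _ _)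
  map_smul' _ _ := Crossed.ext (funext fun _ => map_smul L _ _)

theorem coeff_mapCoeff (L : A →ₗ[ℂ] A) (f : Crossed act κ) (γ : Γ) :
    (mapCoeff act κ L f).coeff γ = L (f.coeff γ) := rfl

theorem mapCoeff_single (L : A →ₗ[ℂ] A) (γ : Γ) (a : A) :
    mapCoeff act κ L (single act κ γ a) = single act κ γ (L a) := by
  ext δ
  rw [coeff_mapCoeff]
  by_cases h : δ = γ
  · subst h; rw [coeff_single_self, coeff_single_self]
  · rw [coeff_single_of_ne h, coeff_single_of_ne h, map_zero]

open Classical in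
/-- The projection to the sums of terms `a N_γ` with `γ ∈ Γ'`. -/
def restrictTo (act : Γ →* (A ≃ₐ[ℂ] A)) (κ : Cocycle Γ) (Γ' : Subgroup Γ) :
    Crossed act κ →ₗ[ℂ] Crossed act κ where
  toFun f := ⟨fun γ => if γ ∈ Γ' then f.coeff γ else 0⟩
  map_add' f g := Crossed.ext (funext fun γ => by
    by_cases h : γ ∈ Γ' <;> simp [h])
  map_smul' z f := Crossed.ext (funext fun γ => by
    by_cases h : γ ∈ Γ' <;> simp [h])

theorem coeff_restrictTo_of_mem {γ : Γ} (h : γ ∈ Γ') (f : Crossed act κ) :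
    (restrictTo act κ Γ' f).coeff γ = f.coeff γ := if_pos h

theorem coeff_restrictTo_of_notMem {γ : Γ} (h : γ ∉ Γ') (f : Crossed act κ) :
    (restrictTo act κ Γ' f).coeff γ = 0 := if_neg h

theorem restrictTo_single_of_mem {γ : Γ} (h : γ ∈ Γ') (a : A) :
    restrictTo act κ Γ' (single act κ γ a) = single act κ γ a := by
  ext δ
  by_cases hδ : δ = γ
  · subst hδ; exact coeff_restrictTo_of_mem h _
  · by_cases h' : δ ∈ Γ'
    · exact coeff_restrictTo_of_mem h' _
    · rw [coeff_restrictTo_of_notMem h', coeff_single_of_ne hδ]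

theorem restrictTo_single_of_notMem {γ : Γ} (h : γ ∉ Γ') (a : A) :
    restrictTo act κ Γ' (single act κ γ a) = 0 := by
  ext δ
  by_cases hδ : δ = γ
  · subst hδ; exact coeff_restrictTo_of_notMem h _
  · by_cases h' : δ ∈ Γ'
    · rw [coeff_restrictTo_of_mem h', coeff_single_of_ne hδ]; rfl
    · rw [coeff_restrictTo_of_notMem h']; rfl

variable {B C : Subalgebra ℂ A} (F : FrobeniusData B C)

/-- The trace map for crossed products. -/
def crossedTrace (act : Γ →* (A ≃ₐ[ℂ] A)) (κ : Cocycle Γ) (Γ' : Subgroup Γ) :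
    Crossed act κ →ₗ[ℂ] Crossed act κ := restrictTo act κ Γ' ∘ₗ mapCoeff act κ F.trace

theorem coeff_crossedTrace_of_mem {γ : Γ} (h : γ ∈ Γ') (f : Crossed act κ) :
    (F.crossedTrace act κ Γ' f).coeff γ = F.trace (f.coeff γ) := coeff_restrictTo_of_mem h _

theorem coeff_crossedTrace_of_notMem {γ : Γ} (h : γ ∉ Γ') (f : Crossed act κ) :
    (F.crossedTrace act κ Γ' f).coeff γ = 0 := coeff_restrictTo_of_notMem h _

theorem crossedTrace_single_of_mem {γ : Γ} (h : γ ∈ Γ') (a : A) :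
    F.crossedTrace act κ Γ' (single act κ γ a) = single act κ γ (F.trace a) := by
  rw [crossedTrace, LinearMap.comp_apply, mapCoeff_single, restrictTo_single_of_mem h]

theorem crossedTrace_single_of_notMem {γ : Γ} (h : γ ∉ Γ') (a : A) :
    F.crossedTrace act κ Γ' (single act κ γ a) = 0 := by
  rw [crossedTrace, LinearMap.comp_apply, mapCoeff_single, restrictTo_single_of_notMem h]

theorem card_ne_zero : (Nat.card Γ' : ℂ) ≠ 0 := by
  have : Nat.card Γ' ≠ 0 := Nat.card_pos.ne'
  exact_mod_cast this

-- All of `Γ` serves as index set instead of coset representatives of `Γ'`. Every term then occurs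
-- `|Γ'|` times, which the scalar compensates.
open Classical in
theorem sum_ite_mem {M : Type*} [AddCommGroup M] [Module ℂ M] (e : Γ ≃ Γ) (m : M) :
    ∑ r : Γ, (Nat.card Γ' : ℂ)⁻¹ • (if e r ∈ Γ' then m else 0) = m := by
  rw [← Finset.smul_sum, Equiv.sum_comp e fun r => if r ∈ Γ' then m else 0, Finset.sum_ite,
    Finset.sum_const_zero, add_zero, Finset.sum_const, ← Nat.cast_smul_eq_nsmul ℂ, smul_smul]
  have h : (Finset.univ.filter fun r => r ∈ Γ').card = Nat.card Γ' := by
    rw [Nat.card_eq_fintype_card, Fintype.card_subtype]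
  rw [h, inv_mul_cancel₀ card_ne_zero, one_smul]

section Equivariant

variable (h_trace : ∀ γ ∈ Γ', ∀ a, F.trace (act γ a) = act γ (F.trace a))
  (h_iso : ∀ γ ∈ Γ', ∀ a, F.iso (act γ a) = act γ (F.iso a))

-- Inside `Γ'`, pulling `δ` out turns the sum into the dual basis identity of `F` at `δ⁻¹(a)`.
-- Outside `Γ'` the trace kills every term.
include h_trace in
open Classical in
theorem crossed_left_dual (δ : Γ) (a : A) :
    ∑ i, F.crossedTrace act κ Γ' (single act κ δ a * incl act κ (F.x i)) * incl act κ (F.y i)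
      = if δ ∈ Γ' then single act κ δ a else 0 := by
  by_cases hδ : δ ∈ Γ'
  · rw [if_pos hδ]
    have h : ∀ i, F.crossedTrace act κ Γ' (single act κ δ a * incl act κ (F.x i)) *
        incl act κ (F.y i)
        = singleHom act κ δ (act δ (F.trace ((act δ).symm a * F.x i) * F.y i)) := fun i => by
      rw [single_mul_incl, F.crossedTrace_single_of_mem hδ, single_mul_incl, singleHom_apply,
        map_mul (act δ), ← h_trace δ hδ, map_mul (act δ), AlgEquiv.apply_symm_apply]
    rw [Finset.sum_congr rfl fun i _ => h i, ← map_sum, ← map_sum, F.left_dual,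
      AlgEquiv.apply_symm_apply, singleHom_apply]
  · rw [if_neg hδ]
    refine Finset.sum_eq_zero fun i _ => ?_
    rw [single_mul_incl, F.crossedTrace_single_of_notMem hδ, zero_mul]

open Classical in
theorem crossed_right_dual (δ : Γ) (a : A) :
    ∑ i, incl act κ (F.x i) * mapCoeff act κ F.iso
        (F.crossedTrace act κ Γ' (incl act κ (F.y i) * single act κ δ a))
      = if δ ∈ Γ' then single act κ δ a else 0 := by
  by_cases hδ : δ ∈ Γ'
  · rw [if_pos hδ]
    have h : ∀ i, incl act κ (F.x i) * mapCoeff act κ F.iso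
        (F.crossedTrace act κ Γ' (incl act κ (F.y i) * single act κ δ a))
        = singleHom act κ δ (F.x i * F.iso (F.trace (F.y i * a))) := fun i => by
      rw [incl_mul_single, F.crossedTrace_single_of_mem hδ, mapCoeff_single, incl_mul_single,
        singleHom_apply]
    rw [Finset.sum_congr rfl fun i _ => h i, ← map_sum, F.right_dual, singleHom_apply]
  · rw [if_neg hδ]
    refine Finset.sum_eq_zero fun i _ => ?_
    rw [incl_mul_single, F.crossedTrace_single_of_notMem hδ, map_zero, mul_zero]

variable {B' C' : Subalgebra ℂ (Crossed act κ)} (hB : IsCrossedSub Γ' B B')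
  (hC : IsCrossedSub Γ' C C') (h_act : ∀ γ ∈ Γ', ∀ a ∈ B, act γ a ∈ B)

/-- The extension of `F` to crossed products with finite groups. -/
def crossed : FrobeniusData B' C' where
  trace := F.crossedTrace act κ Γ'
  iso := mapCoeff act κ F.iso
  inv := mapCoeff act κ F.inv
  trace_mem f := (hB _).mpr fun γ => by
    by_cases h : γ ∈ Γ'
    · rw [F.coeff_crossedTrace_of_mem h]; exact ⟨F.trace_mem _, fun h' => absurd h h'⟩
    · rw [F.coeff_crossedTrace_of_notMem h]; exact ⟨zero_mem _, fun _ => rfl⟩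
  iso_mem f hf := (hC _).mpr fun γ => ⟨F.iso_mem _ ((hB f).mp hf γ).1, fun h => by
    rw [coeff_mapCoeff, ((hB f).mp hf γ).2 h, map_zero]⟩
  inv_mem f hf := (hB _).mpr fun γ => ⟨F.inv_mem _ ((hC f).mp hf γ).1, fun h => by
    rw [coeff_mapCoeff, ((hC f).mp hf γ).2 h, map_zero]⟩
  inv_iso f hf := Crossed.ext (funext fun γ => F.inv_iso _ ((hB f).mp hf γ).1)
  iso_inv f hf := Crossed.ext (funext fun γ => F.iso_inv _ ((hC f).mp hf γ).1)
  iso_one := by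
    rw [one_def, incl, mapCoeff_single, map_smul, F.iso_one]
  iso_mul f hf g hg := by
    ext γ
    rw [coeff_mapCoeff, coeff_mul, coeff_mul, map_sum]
    refine Finset.sum_congr rfl fun δ _ => ?_
    rw [map_smul, coeff_mapCoeff, coeff_mapCoeff]
    by_cases hδ : δ ∈ Γ'
    · rw [F.iso_mul _ ((hB f).mp hf δ).1 _ (h_act δ hδ _ ((hB g).mp hg _).1), h_iso δ hδ]
    · rw [((hB f).mp hf δ).2 hδ, map_zero, zero_mul, zero_mul, map_zero]
  trace_left f hf g := by
    classical
    ext γ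
    rw [coeff_mul]
    have hterm : ∀ δ, (κ.val δ (δ⁻¹ * γ)).val • (f.coeff δ *
        act δ ((F.crossedTrace act κ Γ' g).coeff (δ⁻¹ * γ)))
        = if γ ∈ Γ' then F.trace ((κ.val δ (δ⁻¹ * γ)).val • (f.coeff δ *
          act δ (g.coeff (δ⁻¹ * γ)))) else 0 := by
      intro δ
      by_cases hδ : δ ∈ Γ'
      · have hiff : δ⁻¹ * γ ∈ Γ' ↔ γ ∈ Γ' := Subgroup.mul_mem_cancel_left _ (Γ'.inv_mem hδ)
        by_cases hγ : γ ∈ Γ'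
        · rw [if_pos hγ, F.coeff_crossedTrace_of_mem (hiff.mpr hγ), map_smul,
            F.trace_left _ ((hB f).mp hf δ).1, h_trace δ hδ]
        · rw [if_neg hγ, F.coeff_crossedTrace_of_notMem (fun h => hγ (hiff.mp h)), map_zero,
            mul_zero, smul_zero]
      · rw [((hB f).mp hf δ).2 hδ, zero_mul, zero_mul, smul_zero, map_zero, ite_self]
    rw [Finset.sum_congr rfl fun δ _ => hterm δ]
    by_cases hγ : γ ∈ Γ'
    · rw [F.coeff_crossedTrace_of_mem hγ, coeff_mul, map_sum]
      exact Finset.sum_congr rfl fun δ _ => (if_pos hγ).symm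
    · rw [F.coeff_crossedTrace_of_notMem hγ]
      exact (Finset.sum_eq_zero fun δ _ => if_neg hγ).symm
  trace_right f hf g := by
    classical
    ext γ
    rw [coeff_mul]
    have hterm : ∀ δ, (κ.val δ (δ⁻¹ * γ)).val • ((F.crossedTrace act κ Γ' g).coeff δ *
        act δ (f.coeff (δ⁻¹ * γ)))
        = if γ ∈ Γ' then F.trace ((κ.val δ (δ⁻¹ * γ)).val • (g.coeff δ *
          act δ ((mapCoeff act κ F.iso f).coeff (δ⁻¹ * γ)))) else 0 := by
      intro δ
      rw [coeff_mapCoeff]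
      by_cases hδ : δ ∈ Γ'
      · have hiff : δ⁻¹ * γ ∈ Γ' ↔ γ ∈ Γ' := Subgroup.mul_mem_cancel_left _ (Γ'.inv_mem hδ)
        rw [F.coeff_crossedTrace_of_mem hδ]
        by_cases hγ : γ ∈ Γ'
        · rw [if_pos hγ, map_smul, ← h_iso δ hδ,
            F.trace_right _ (h_act δ hδ _ ((hB f).mp hf _).1)]
        · rw [if_neg hγ, ((hB f).mp hf _).2 (fun h => hγ (hiff.mp h)), map_zero,
            mul_zero, smul_zero]
      · rw [F.coeff_crossedTrace_of_notMem hδ, zero_mul, smul_zero]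
        by_cases hγ : γ ∈ Γ'
        · have hn : δ⁻¹ * γ ∉ Γ' := fun h => hδ (by
            have := mul_mem hγ (Γ'.inv_mem h)
            rwa [mul_inv_rev, inv_inv, mul_inv_cancel_left] at this)
          rw [((hB f).mp hf _).2 hn, map_zero, map_zero, mul_zero, smul_zero, map_zero, ite_self]
        · rw [if_neg hγ]
    rw [Finset.sum_congr rfl fun δ _ => hterm δ]
    by_cases hγ : γ ∈ Γ'
    · rw [F.coeff_crossedTrace_of_mem hγ, coeff_mul, map_sum]
      exact Finset.sum_congr rfl fun δ _ => (if_pos hγ).symm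
    · rw [F.coeff_crossedTrace_of_notMem hγ]
      exact (Finset.sum_eq_zero fun δ _ => if_neg hγ).symm
  index := F.index × Γ
  fintype := inferInstance
  -- The inverse pair `N_γ⁻¹`, `N_γ` shifts the `Γ`-degree into `Γ'`, where the trace is nonzero,
  -- for exactly `|Γ'|` values of `γ`.
  x p := (Nat.card Γ' : ℂ)⁻¹ • (NgammaInv act κ p.2 * incl act κ (F.x p.1))
  y p := incl act κ (F.y p.1) * Ngamma act κ p.2
  left_dual f := by
    classical
    induction f using crossed_induction with
    | zero => simp
    | add f g hf hg => simp only [add_mul, map_add, Finset.sum_add_distrib, hf, hg]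
    | single γ a =>
      rw [Fintype.sum_prod_type_right]
      refine Eq.trans (Finset.sum_congr rfl fun r _ => ?_)
        (sum_ite_mem (Γ' := Γ') ((Equiv.inv Γ).trans (Equiv.mulLeft γ)) (single act κ γ a))
      obtain ⟨a', ha'⟩ := single_mul_NgammaInv (act := act) (κ := κ) r γ a
      have h1 : single act κ (γ * r⁻¹) a' * Ngamma act κ r = single act κ γ a := by
        rw [← ha', mul_assoc, NgammaInv_mul, mul_one]
      have h2 := congrArg (fun t => (Nat.card Γ' : ℂ)⁻¹ • (t * Ngamma act κ r))
        (F.crossed_left_dual (κ := κ) h_trace (γ * r⁻¹) a')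
      simp only [ite_mul, zero_mul, h1, Finset.sum_mul, Finset.smul_sum] at h2
      rw [Equiv.trans_apply, Equiv.inv_apply, Equiv.coe_mulLeft, ← h2]
      refine Finset.sum_congr rfl fun i _ => ?_
      rw [mul_smul_comm, map_smul, smul_mul_assoc, ← mul_assoc, ← mul_assoc, ha']
  right_dual f := by
    classical
    induction f using crossed_induction with
    | zero => simp
    | add f g hf hg => simp only [mul_add, map_add, Finset.sum_add_distrib, hf, hg]
    | single γ a =>
      rw [Fintype.sum_prod_type_right]
      refine Eq.trans (Finset.sum_congr rfl fun r _ => ?_)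
        (sum_ite_mem (Γ' := Γ') (Equiv.mulRight γ) (single act κ γ a))
      obtain ⟨a', ha'⟩ := Ngamma_mul_single (act := act) (κ := κ) r γ a
      have h1 : NgammaInv act κ r * single act κ (r * γ) a' = single act κ γ a := by
        rw [← ha', ← mul_assoc, NgammaInv_mul, one_mul]
      have h2 := congrArg (fun t => (Nat.card Γ' : ℂ)⁻¹ • (NgammaInv act κ r * t))
        (F.crossed_right_dual (κ := κ) (Γ' := Γ') (r * γ) a')
      simp only [mul_ite, mul_zero, h1, Finset.mul_sum, Finset.smul_sum] at h2
      rw [Equiv.coe_mulRight, ← h2]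
      refine Finset.sum_congr rfl fun i _ => ?_
      rw [smul_mul_assoc, mul_assoc, mul_assoc, ha']

end Equivariant

end FrobeniusData

/-! ### Dual bases from unitriangular Gram matrices -/

section Gram

/-- The ring is noncommutative, so determinants are not at hand. Instead, `1 - G` is nilpotent: its
entries vanish unless `l` strictly decreases from the row to the column. -/
theorem isUnit_of_unitriangular {R J : Type*} [Ring R] [Fintype J] [DecidableEq J] (l : J → ℕ)
    (G : Matrix J J R) (h1 : ∀ j, G j j = 1) (h0 : ∀ j k, l j ≤ l k → j ≠ k → G j k = 0) :
    IsUnit G := by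
  have hL : ∀ m j k, l j < l k + m → ((1 - G) ^ m) j k = 0 := by
    intro m
    induction m with
    | zero =>
      intro j k h
      rw [pow_zero, Matrix.one_apply_ne]
      rintro rfl
      omega
    | succ m ih =>
      intro j k h
      rw [pow_succ, Matrix.mul_apply]
      refine Finset.sum_eq_zero fun i _ => ?_
      by_cases h2 : l j < l i + m
      · rw [ih j i h2, zero_mul]
      · have h3 : (1 - G) i k = 0 := by
          rw [Matrix.sub_apply]
          by_cases hik : i = k
          · rw [hik, Matrix.one_apply_eq, h1, sub_self]
          · rw [Matrix.one_apply_ne hik, h0 i k (by omega) hik, sub_self]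
        rw [h3, mul_zero]
  have hnil : IsNilpotent (1 - G) := by
    -- The value `l j` can drop at most `l j` times, and the sum bounds all these values.
    refine ⟨∑ j, l j + 1, ?_⟩
    ext j k
    refine hL _ j k ?_
    have := Finset.single_le_sum (f := l) (fun _ _ => Nat.zero_le _) (Finset.mem_univ j)
    omega
  simpa using hnil.isUnit_one_sub

variable {A : Type u} [Ring A] [Algebra ℂ A] {B C : Subalgebra ℂ A}

/-- If `H` is the inverse of the Gram matrix `E(y_j n_k)`, then `x_k = ∑ n_i φ(H_ik)` satisfies
`E(y_i x_k) = δ_ik`. This and the expansion of `a` in the `y_j` give the first identity; the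
relation `H G = 1` and the expansion in the `n_j` give the second. -/
theorem exists_dual_basis {E φ : A →ₗ[ℂ] A} (hE : ∀ a, E a ∈ B)
    (hφ1 : φ 1 = 1)
    (hφm : ∀ a ∈ B, ∀ a' ∈ B, φ (a * a') = φ a * φ a')
    (hEl : ∀ b ∈ B, ∀ a, E (b * a) = b * E a) (hEr : ∀ b ∈ B, ∀ a, E (a * φ b) = E a * b)
    (hsurj : ∀ c ∈ C, ∃ b ∈ B, φ b = c) {J : Type*} [Fintype J] (y n : J → A) (l : J → ℕ)
    (h1 : ∀ j, E (y j * n j) = 1) (h0 : ∀ j k, l j ≤ l k → j ≠ k → E (y j * n k) = 0)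
    (hy : ∀ a, ∃ c : J → B, a = ∑ j, (c j : A) * y j)
    (hn : ∀ a, ∃ c : J → C, a = ∑ j, n j * (c j : A)) :
    ∃ x : J → A, (∀ a, ∑ j, E (a * x j) * y j = a) ∧ ∀ a, ∑ j, x j * φ (E (y j * a)) = a := by
  classical
  set G : Matrix J J B := fun j k => ⟨E (y j * n k), hE _⟩ with hG
  obtain ⟨u, hu⟩ := isUnit_of_unitriangular l G (fun j => Subtype.ext (h1 j))
    (fun j k h h' => Subtype.ext (h0 j k h h'))
  set H : Matrix J J B := ((u⁻¹ : (Matrix J J B)ˣ) : Matrix J J B) with hH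
  have hGH : G * H = 1 := by rw [← hu, hH, Units.mul_inv]
  have hHG : H * G = 1 := by rw [← hu, hH, Units.inv_mul]
  have hGH' : ∀ j k, ∑ i, E (y j * n i) * (H i k : A) = ((1 : Matrix J J B) j k : A) := fun j k => by
    rw [← hGH, Matrix.mul_apply, AddSubmonoidClass.coe_finsetSum]
    rfl
  have hHG' : ∀ j k, ∑ i, (H j i : A) * E (y i * n k) = ((1 : Matrix J J B) j k : A) := fun j k => by
    rw [← hHG, Matrix.mul_apply, AddSubmonoidClass.coe_finsetSum]
    rfl
  have hone : ∀ j k : J, ((1 : Matrix J J B) j k : A) = if j = k then 1 else 0 := fun j k => by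
    rw [Matrix.one_apply]
    split_ifs <;> rfl
  refine ⟨fun k => ∑ i, n i * φ (H i k : A), fun a => ?_, fun a => ?_⟩
  · obtain ⟨c, hc⟩ := hy a
    have h : ∀ k, E (a * ∑ i, n i * φ (H i k : A)) = c k := fun k => by
      have h2 : ∀ i, E (y i * ∑ i, n i * φ (H i k : A)) = if i = k then 1 else 0 := fun i => by
        rw [Finset.mul_sum, map_sum, ← hone, ← hGH']
        refine Finset.sum_congr rfl fun j _ => ?_
        rw [← mul_assoc, hEr _ (H j k).2]
      rw [hc, Finset.sum_mul, map_sum]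
      simp only [mul_assoc, hEl _ (c _).2, h2, mul_ite, mul_one, mul_zero, Finset.sum_ite_eq',
        Finset.mem_univ, if_true]
    rw [Finset.sum_congr rfl fun k _ => by rw [h k], ← hc]
  · obtain ⟨c, hc⟩ := hn a
    choose d hd hdc using fun j => hsurj (c j) (c j).2
    have h2 : ∀ i j, ∑ k, φ (H i k : A) * φ (E (y k * n j)) = if i = j then 1 else 0 := fun i j => by
      have h3 : ∀ k, φ (H i k : A) * φ (E (y k * n j)) = φ ((H i k : A) * E (y k * n j)) :=
        fun k => (hφm _ (H i k).2 _ (hE _)).symm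
      rw [Finset.sum_congr rfl fun k _ => h3 k, ← map_sum, hHG', hone]
      split_ifs
      · exact hφ1
      · exact map_zero φ
    have h4 : ∀ k, φ (E (y k * a)) = ∑ j, φ (E (y k * n j)) * (c j : A) := fun k => by
      conv_lhs => rw [hc, Finset.mul_sum, map_sum, map_sum]
      refine Finset.sum_congr rfl fun j _ => ?_
      rw [← hdc, ← mul_assoc, hEr _ (hd j), hφm _ (hE _) _ (hd j)]
    have h5 : ∀ k, (∑ i, n i * φ (H i k : A)) * φ (E (y k * a))
        = ∑ i, ∑ j, n i * (φ (H i k : A) * φ (E (y k * n j))) * (c j : A) := fun k => by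
      rw [h4, Finset.sum_mul]
      refine Finset.sum_congr rfl fun i _ => ?_
      rw [Finset.mul_sum]
      refine Finset.sum_congr rfl fun j _ => ?_
      simp only [mul_assoc]
    rw [Finset.sum_congr rfl fun k _ => h5 k, Finset.sum_comm]
    conv_rhs => rw [hc]
    refine Finset.sum_congr rfl fun i _ => ?_
    rw [Finset.sum_comm]
    have h6 : ∀ j, ∑ k, n i * (φ (H i k : A) * φ (E (y k * n j))) * (c j : A)
        = if i = j then n i * (c j : A) else 0 := fun j => by
      rw [← Finset.sum_mul, ← Finset.mul_sum, h2]
      split_ifs <;> simp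
    rw [Finset.sum_congr rfl fun j _ => h6 j]
    simp

end Gram

/-! ### The Frobenius structure of the affine Hecke algebra -/

section HeckeData

variable {ι X Y : Type u} [AddCommGroup X] [AddCommGroup Y] {D : RootPairing ι ℤ X Y}
  [Module.Free ℤ X] [Module.Finite ℤ X] {b : D.Base} {κ : Labels D} [Finite ι] [D.IsReduced]
  {P Q : Set ι} {d : D.weylGroup}

/-- An element that fixes all roots has no inversions, so it is trivial; hence `W` embeds in the
self-maps of the finite set of roots. -/
theorem finite_weylGroup (b : D.Base) : Finite D.weylGroup := by
  refine Finite.of_injective (fun (w : D.weylGroup) (i : ι) => w • i) fun w w' h => ?_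
  rw [← inv_mul_eq_one]
  refine (eq_one_of_len (b := b) ?_)
  rw [len, Set.ncard_eq_zero (Set.toFinite _), Set.eq_empty_iff_forall_notMem]
  rintro i ⟨h1, h2⟩
  have h3 : w • i = w' • i := congrFun h i
  rw [mul_smul, ← h3, inv_smul_smul] at h2
  exact h2 h1

variable (b P) in
/-- The elements `v` of minimal length in `W_P v`. -/
abbrev MinRep : Type u := {v : D.weylGroup // ∀ i ∈ P, b.IsPos (v⁻¹ • i)}

/-- If `v e⁻¹ ∈ W_P`, then `ℓ(v) = ℓ(v e⁻¹) + ℓ(e)` and `ℓ(e) = ℓ(e v⁻¹) + ℓ(v)`, so `v e⁻¹` has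
length zero. -/
theorem mul_inv_mem_iff (h : Opposite b P Q d) (v e : MinRep b P) :
    (v : D.weylGroup) * (e : D.weylGroup)⁻¹ ∈ parabolicWeyl D P ↔ v = e := by
  constructor
  · intro hm
    have hm' := inv_mem hm
    rw [mul_inv_rev, inv_inv] at hm'
    have h1 := len_parabolic_mul h.left_subset e.2 hm
    have h2 := len_parabolic_mul h.left_subset v.2 hm'
    rw [inv_mul_cancel_right] at h1 h2
    have h3 : (v : D.weylGroup) * (e : D.weylGroup)⁻¹ = 1 := eq_one_of_len (b := b) (by omega)
    exact Subtype.ext (mul_inv_eq_one.mp h3)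
  · rintro rfl
    rw [mul_inv_cancel]
    exact one_mem _

theorem topCoeff_N_mul_N (h : Opposite b P Q d) {v u : D.weylGroup}
    (hl : len b v + len b u ≤ len b d) :
    topCoeff b κ P d (N b κ v * N b κ u) = topCoeff b κ P d (N b κ (v * u)) := by
  have h1 := suppOn_mono (κ := κ) (S' := shorter b (len b d))
    (fun w (hw : len b w < len b v + len b u) => lt_of_lt_of_le hw hl) (N_mul_N_sub_mem v u)
  have h2 := topCoeff_eq_zero (shorter_mul_inv_notMem h) h1
  rw [map_sub] at h2
  exact sub_eq_zero.mp h2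

theorem topCoeff_gram_self (h : Opposite b P Q d) (v : MinRep b P) :
    topCoeff b κ P d (N b κ v * N b κ ((v : D.weylGroup)⁻¹ * d)) = 1 := by
  rw [topCoeff_N_mul_N h (h.len_inv_mul v.2).le, mul_inv_cancel_left, topCoeff_N_self]

/-- Here `ℓ(v) + ℓ(e⁻¹ d) ≤ ℓ(d)`, so only the leading term `N_{v e⁻¹ d}` can contribute, and it
does not since `v e⁻¹ ∉ W_P`. -/
theorem topCoeff_gram_eq_zero (h : Opposite b P Q d) (v e : MinRep b P)
    (hl : len b (v : D.weylGroup) ≤ len b (e : D.weylGroup)) (hne : v ≠ e) :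
    topCoeff b κ P d (N b κ v * N b κ ((e : D.weylGroup)⁻¹ * d)) = 0 := by
  have h1 := h.len_inv_mul e.2
  rw [topCoeff_N_mul_N h (by omega), topCoeff_N_of_notMem]
  rw [← mul_assoc, mul_inv_cancel_right]
  exact fun hm => hne ((mul_inv_mem_iff h v e).mp hm)

open Classical in
theorem exists_left_expansion (hP : P ⊆ b.support) [Fintype (MinRep b P)] (a : Hecke b κ) :
    ∃ c : MinRep b P → parabolic b κ P, a = ∑ v : MinRep b P, (c v : Hecke b κ) * N b κ v := by
  induction a using hecke_induction with
  | zero => exact ⟨0, by simp⟩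
  | add a a' ha ha' =>
    obtain ⟨c, hc⟩ := ha
    obtain ⟨c', hc'⟩ := ha'
    refine ⟨c + c', ?_⟩
    simp only [Pi.add_apply, Subalgebra.coe_add, add_mul, Finset.sum_add_distrib, ← hc, ← hc']
  | single f w =>
    obtain ⟨p, hp, v, hv, rfl⟩ := exists_min_coset_rep hP w
    refine ⟨Pi.single ⟨v, hv⟩ ⟨thetaHom b κ f * N b κ p, mul_mem (thetaHom_mem f) (N_mem hp)⟩, ?_⟩
    rw [Finset.sum_eq_single ⟨v, hv⟩]
    · rw [Pi.single_eq_same, mul_assoc, N_mul_of_len (len_parabolic_mul hP hv hp)]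
    · intro v' _ hv'
      rw [Pi.single_eq_of_ne hv', ZeroMemClass.coe_zero, zero_mul]
    · simp

open Classical in
theorem exists_right_expansion (h : Opposite b P Q d) [Fintype (MinRep b P)] (a : Hecke b κ) :
    ∃ c : MinRep b P → parabolic b κ Q,
      a = ∑ v : MinRep b P, N b κ ((v : D.weylGroup)⁻¹ * d) * (c v : Hecke b κ) := by
  let M : Submodule ℂ (Hecke b κ) :=
    { carrier := {a | ∃ c : MinRep b P → parabolic b κ Q,
        a = ∑ v : MinRep b P, N b κ ((v : D.weylGroup)⁻¹ * d) * (c v : Hecke b κ)}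
      zero_mem' := ⟨0, by simp⟩
      add_mem' := by
        rintro _ _ ⟨c, rfl⟩ ⟨c', rfl⟩
        exact ⟨c + c', by simp [mul_add, Finset.sum_add_distrib]⟩
      smul_mem' := by
        rintro z _ ⟨c, rfl⟩
        exact ⟨z • c, by simp [Finset.smul_sum]⟩ }
  have hN : ∀ w f, N b κ w * thetaHom b κ f ∈ M := by
    intro w f
    obtain ⟨q, hq, u, hu, hw⟩ := exists_min_coset_rep (b := b) h.right_subset w⁻¹
    have hw' : w = u⁻¹ * q⁻¹ := by rw [← mul_inv_rev, ← hw, inv_inv]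
    -- `d⁻¹` maps `P` into `Q`, so `u ↦ d u` turns minimal representatives for `Q` into those for
    -- `P`, and `u⁻¹ = (d u)⁻¹ d`.
    have hv : ∀ i ∈ P, b.IsPos ((d * u)⁻¹ • i) := fun i hi => by
      rw [mul_inv_rev, mul_smul]
      exact hu _ (h.map_left i hi)
    refine ⟨Pi.single (⟨d * u, hv⟩ : MinRep b P) ⟨N b κ q⁻¹ * thetaHom b κ f,
      mul_mem (N_mem (inv_mem hq)) (thetaHom_mem f)⟩, ?_⟩
    rw [Finset.sum_eq_single (⟨d * u, hv⟩ : MinRep b P)]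
    · rw [Pi.single_eq_same, ← mul_assoc, mul_inv_rev, inv_mul_cancel_right,
        N_mul_of_len (len_mul_parabolic h.right_subset hu (inv_mem hq)), ← hw']
    · intro v' _ hv'
      rw [Pi.single_eq_of_ne hv', ZeroMemClass.coe_zero, mul_zero]
    · simp
  -- Induction on length: `θ N_w` differs from a term `N_w θ'` by something supported on shorter
  -- elements.
  have hs : ∀ n, suppOn b κ (shorter b n) ≤ M := by
    intro n
    induction n with
    | zero => exact suppOn_le fun f w hw => absurd hw (Nat.not_lt_zero _)
    | succ n ih =>
      refine suppOn_le fun f w hw => ?_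
      have h1 := N_mul_thetaHom_sub_mem (b := b) (κ := κ) w (wAct w⁻¹ f)
      rw [← wAct_mul, mul_inv_cancel, wAct_one] at h1
      have h2 := ih (suppOn_mono (fun v (hv : len b v < len b w) =>
        lt_of_lt_of_le hv (Nat.le_of_lt_succ hw)) h1)
      have h3 := M.sub_mem (hN w (wAct w⁻¹ f)) h2
      rwa [sub_sub_cancel] at h3
  change a ∈ M
  induction a using hecke_induction with
  | zero => exact zero_mem _
  | add a a' ha ha' => exact add_mem ha ha'
  | single f w => exact hs _ (single_mem_suppOn (Nat.lt_succ_self (len b w)) f)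

variable (κ) in
/-- The map `a ↦ E(N_d a)`, which extends the isomorphism `𝓗^Q → 𝓗^P`. -/
def oppMap (P : Set ι) (d : D.weylGroup) : Hecke b κ →ₗ[ℂ] Hecke b κ :=
  topCoeff b κ P d ∘ₗ LinearMap.mulLeft ℂ (N b κ d)

theorem oppMap_apply (a : Hecke b κ) :
    oppMap κ P d a = topCoeff b κ P d (N b κ d * a) := rfl

theorem oppMap_mem (a : Hecke b κ) : oppMap κ P d a ∈ parabolic b κ P := by
  rw [oppMap_apply]
  exact topCoeff_mem _

theorem exists_frobeniusData (h : Opposite b P Q d) :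
    ∃ F : FrobeniusData (parabolic b κ P) (parabolic b κ Q),
      F.trace = topCoeff b κ P d ∧ F.iso = oppMap κ Q d⁻¹ ∧ F.inv = oppMap κ P d := by
  classical
  have := finite_weylGroup b
  let _ : Fintype (MinRep b P) := Fintype.ofFinite _
  have iso_mem : ∀ a ∈ parabolic b κ P, oppMap κ Q d⁻¹ a ∈ parabolic b κ Q :=
    fun a _ => oppMap_mem a
  have inv_iso : ∀ a ∈ parabolic b κ P, oppMap κ P d (oppMap κ Q d⁻¹ a) = a := fun a ha => by
    have := Subtype.ext_iff.mp (oppHom_oppHom_symm h ⟨a, ha⟩)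
    rwa [oppHom_apply, oppHom_apply] at this
  have iso_inv : ∀ a ∈ parabolic b κ Q, oppMap κ Q d⁻¹ (oppMap κ P d a) = a := fun a ha => by
    have := Subtype.ext_iff.mp (oppHom_symm h ⟨a, ha⟩)
    rwa [oppHom_apply, oppHom_apply] at this
  have iso_one : oppMap (b := b) κ Q d⁻¹ 1 = 1 := by
    rw [oppMap_apply, mul_one, topCoeff_N_self]
  have iso_mul : ∀ a ∈ parabolic b κ P, ∀ a' ∈ parabolic b κ P,
      oppMap κ Q d⁻¹ (a * a') = oppMap κ Q d⁻¹ a * oppMap κ Q d⁻¹ a' := fun a _ a' ha' => by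
    rw [oppMap_apply, ← mul_assoc, topCoeff_mul_right h.symm ha']
    rfl
  have trace_right : ∀ c ∈ parabolic b κ P, ∀ a,
      topCoeff b κ P d (a * oppMap κ Q d⁻¹ c) = topCoeff b κ P d a * c := fun c hc a => by
    rw [topCoeff_mul_right h (iso_mem c hc)]
    congr 1
    exact inv_iso c hc
  obtain ⟨x, hx, hx'⟩ := exists_dual_basis (E := topCoeff b κ P d) (φ := oppMap κ Q d⁻¹)
    (fun a => topCoeff_mem a) iso_one iso_mul (fun c hc a => topCoeff_mul_left h hc a)
    trace_right (fun c hc => ⟨oppMap κ P d c, oppMap_mem c, iso_inv c hc⟩)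
    (fun v : MinRep b P => N b κ v) (fun v => N b κ ((v : D.weylGroup)⁻¹ * d)) (fun v => len b v.1)
    (topCoeff_gram_self h) (topCoeff_gram_eq_zero h) (exists_left_expansion h.left_subset)
    (exists_right_expansion h)
  exact ⟨{
    trace := topCoeff b κ P d
    iso := oppMap κ Q d⁻¹
    inv := oppMap κ P d
    trace_mem := fun a => topCoeff_mem a
    iso_mem := iso_mem
    inv_mem := fun a _ => oppMap_mem a
    inv_iso := inv_iso
    iso_inv := iso_inv
    iso_one := iso_one
    iso_mul := iso_mul
    trace_left := fun c hc a => topCoeff_mul_left h hc a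
    trace_right := trace_right
    index := MinRep b P
    fintype := inferInstance
    x := x
    y := fun v => N b κ v
    left_dual := hx
    right_dual := hx' }, rfl, rfl, rfl⟩

end HeckeData

/-! ### Automorphisms of based root data -/

section Automorphism

variable {ι X Y : Type u} [AddCommGroup X] [AddCommGroup Y] {D : RootPairing ι ℤ X Y}

theorem conjNormal_refl (g : D.Aut) (i : ι) :
    MulAut.conjNormal g (refl D i) = refl D (g • i) := by
  refine weyl_ext fun x => ?_
  obtain ⟨y, rfl⟩ : ∃ y : X, x = g • y := ⟨g⁻¹ • x, (smul_inv_smul g x).symm⟩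
  have h1 : (MulAut.conjNormal g (refl D i) : D.weylGroup) • g • y = g • refl D i • y := by
    change (g * (refl D i : D.Aut) * g⁻¹) • g • y = g • (refl D i : D.Aut) • y
    rw [mul_smul, mul_smul, inv_smul_smul]
  have hr : D.root (g • i) = g • D.root i := RootPairing.Equiv.root_indexEquiv_eq_smul D i g
  rw [h1, refl_smul, refl_smul, smul_sub, hr, pairing_aut_smul]
  congr 1
  exact smul_comm g (D.toLinearMap y (D.coroot i)) (D.root i)

theorem conjNormal_smul (g : D.Aut) (w : D.weylGroup) (i : ι) :
    (MulAut.conjNormal g w : D.weylGroup) • i = g • w • g⁻¹ • i := by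
  change (g * (w : D.Aut) * g⁻¹) • i = g • (w : D.Aut) • g⁻¹ • i
  rw [mul_smul, mul_smul]

theorem conjNormal_mem_parabolicWeyl {P : Set ι} {g : D.Aut} (hg : ∀ i ∈ P, g • i ∈ P)
    {w : D.weylGroup} (hw : w ∈ parabolicWeyl D P) :
    MulAut.conjNormal g w ∈ parabolicWeyl D P := by
  have h : parabolicWeyl D P
      ≤ (parabolicWeyl D P).comap (MulAut.conjNormal g : MulAut D.weylGroup).toMonoidHom := by
    refine (Subgroup.closure_le _).mpr ?_
    rintro _ ⟨i, hi, rfl⟩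
    change MulAut.conjNormal g (refl D i) ∈ parabolicWeyl D P
    rw [conjNormal_refl]
    exact refl_mem_parabolic (hg i hi)
  exact h hw

theorem inv_smul_mem {P : Set ι} {g : D.Aut} (hg : (fun i => g • i) '' P = P) {i : ι}
    (hi : i ∈ P) : g⁻¹ • i ∈ P := by
  rw [← hg] at hi
  obtain ⟨j, hj, rfl⟩ := hi
  change g⁻¹ • g • j ∈ P
  rwa [inv_smul_smul]

theorem smul_mem_of_image_eq {P : Set ι} {g : D.Aut} (hg : (fun i => g • i) '' P = P) {i : ι}
    (hi : i ∈ P) : g • i ∈ P := by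
  rw [← hg]
  exact ⟨i, hi, rfl⟩

theorem conjNormal_mem_parabolicWeyl_iff {P : Set ι} {g : D.Aut}
    (hg : (fun i => g • i) '' P = P) {w : D.weylGroup} :
    MulAut.conjNormal g w ∈ parabolicWeyl D P ↔ w ∈ parabolicWeyl D P := by
  refine ⟨fun h => ?_, conjNormal_mem_parabolicWeyl fun i hi => smul_mem_of_image_eq hg hi⟩
  have := conjNormal_mem_parabolicWeyl (fun i hi => inv_smul_mem hg hi) h
  rwa [← MulAut.mul_apply, ← map_mul, inv_mul_cancel, map_one, MulAut.one_apply] at this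

variable {b : D.Base} [Finite ι] [D.IsReduced]

theorem isPos_aut_smul {g : D.Aut} (hg : ∀ i ∈ b.support, g • i ∈ b.support) {i : ι}
    (hi : b.IsPos i) : b.IsPos (g • i) := by
  obtain ⟨f, hf, -, h⟩ := exists_nonneg_sum (b := b) subset_rfl hi
    (b.span_root_support ▸ Submodule.subset_span ⟨i, rfl⟩)
  have hr (j : ι) : D.root (g • j) = g • D.root j :=
    RootPairing.Equiv.root_indexEquiv_eq_smul D j g
  have h' : D.root (g • i) = ∑ k ∈ b.support, f k • D.root (g • k) := by
    rw [hr, h, Finset.smul_sum]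
    exact Finset.sum_congr rfl fun k _ => by rw [hr]; exact smul_comm g (f k) (D.root k)
  rw [RootPairing.Base.isPos_iff', height_eq_linear b _ f (fun k => g • k) h']
  exact Finset.sum_nonneg fun k hk =>
    mul_nonneg (hf k) ((RootPairing.Base.isPos_iff' _).mp (isPos_of_mem (hg k hk)))

/-- The conjugate lies in `W_P` and still makes `P` negative, which characterizes `w_P`. -/
theorem conjNormal_longest {P : Set ι} (hP : P ⊆ b.support) {g : D.Aut}
    (hb : (fun i => g • i) '' (b.support : Set ι) = b.support) (hg : (fun i => g • i) '' P = P) :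
    MulAut.conjNormal g (longest b P) = longest b P := by
  refine eq_longest hP ((conjNormal_mem_parabolicWeyl_iff hg).mpr (longest_mem P))
    fun i hi hpos => ?_
  rw [conjNormal_smul] at hpos
  have := isPos_aut_smul (fun j hj => inv_smul_mem hb hj) hpos
  rw [inv_smul_smul] at this
  exact not_isPos_longest_smul hP (inv_smul_mem hg hi) this

theorem image_support_eq {g : D.Aut} (hg : ∀ i ∈ b.support, g • i ∈ b.support) :
    (fun i => g • i) '' (b.support : Set ι) = b.support :=
  Set.eq_of_subset_of_ncard_le (by rintro _ ⟨i, hi, rfl⟩; exact hg i hi)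
    (Set.ncard_image_of_injective _ (MulAction.injective g)).ge

end Automorphism

/-! ### Subalgebras of crossed products -/

namespace Crossed

variable {A Γ : Type u} [Ring A] [Algebra ℂ A] [Group Γ] [Fintype Γ]
  {act : Γ →* (A ≃ₐ[ℂ] A)} {κ : Cocycle Γ}

/-- As `Γ'` stabilizes `B`, the coefficient condition is closed under products. It allows membership
to be tested one coefficient at a time. -/
theorem isCrossedSub_adjoin (Γ' : Subgroup Γ) (B : Subalgebra ℂ A)
    (h_act : ∀ γ ∈ Γ', ∀ a ∈ B, act γ a ∈ B) :
    FrobeniusData.IsCrossedSub Γ' B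
      (Algebra.adjoin ℂ (incl act κ '' B ∪ Ngamma act κ '' Γ')) := by
  have h_single : ∀ γ ∈ Γ', ∀ a ∈ B, ∀ δ, (single act κ γ a).coeff δ ∈ B ∧
      (δ ∉ Γ' → (single act κ γ a).coeff δ = 0) := by
    intro γ hγ a ha δ
    by_cases h : δ = γ
    · subst h
      rw [coeff_single_self]
      exact ⟨ha, fun h => absurd hγ h⟩
    · rw [coeff_single_of_ne h]
      exact ⟨zero_mem _, fun _ => rfl⟩
  have h_incl : ∀ a ∈ B, ∀ δ, (incl act κ a).coeff δ ∈ B ∧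
      (δ ∉ Γ' → (incl act κ a).coeff δ = 0) := fun a ha =>
    h_single 1 (one_mem _) _ (Subalgebra.smul_mem _ ha _)
  intro f
  constructor
  · intro hf
    induction hf using Algebra.adjoin_induction with
    | mem f hf =>
      rcases hf with ⟨a, ha, rfl⟩ | ⟨γ, hγ, rfl⟩
      · exact h_incl a ha
      · exact h_single γ hγ 1 (one_mem _)
    | algebraMap z =>
      intro δ
      have h := h_incl 1 (one_mem _) δ
      rw [Algebra.algebraMap_eq_smul_one]
      exact ⟨Subalgebra.smul_mem _ h.1 z, fun hδ => by
        rw [coeff_smul, Pi.smul_apply, one_def, h.2 hδ, smul_zero]⟩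
    | add f g _ _ hf hg =>
      exact fun δ => ⟨add_mem (hf δ).1 (hg δ).1, fun hδ => by
        rw [coeff_add, Pi.add_apply, (hf δ).2 hδ, (hg δ).2 hδ, add_zero]⟩
    | mul f g _ _ hf hg =>
      intro δ
      rw [coeff_mul]
      constructor
      · refine sum_mem fun ε _ => Subalgebra.smul_mem _ ?_ _
        by_cases hε : ε ∈ Γ'
        · exact mul_mem (hf ε).1 (h_act ε hε _ (hg _).1)
        · rw [(hf ε).2 hε, zero_mul]
          exact zero_mem _
      · refine fun hδ => Finset.sum_eq_zero fun ε _ => ?_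
        by_cases hε : ε ∈ Γ'
        · have h : ε⁻¹ * δ ∉ Γ' := fun h =>
            hδ ((Subgroup.mul_mem_cancel_left _ (inv_mem hε)).mp h)
          rw [(hg _).2 h, map_zero, mul_zero, smul_zero]
        · rw [(hf ε).2 hε, zero_mul, smul_zero]
  · intro hf
    rw [eq_sum_single f]
    refine sum_mem fun γ _ => ?_
    by_cases hγ : γ ∈ Γ'
    · rw [← incl_mul_Ngamma]
      exact mul_mem (Algebra.subset_adjoin (Or.inl ⟨_, (hf γ).1, rfl⟩))
        (Algebra.subset_adjoin (Or.inr ⟨γ, hγ, rfl⟩))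
    · rw [(hf γ).2 hγ, single_zero]
      exact zero_mem _

end Crossed

/-! ### Second adjointness -/

namespace FrobeniusData

variable {A : Type u} [Ring A] [Algebra ℂ A] {B C : Subalgebra ℂ A}

theorem nonempty_adjunctions (F : FrobeniusData B C) (F' : FrobeniusData C B)
    (h : F'.inv = F.iso) :
    Nonempty (Res.{u, v} C ⋙ pull.{u, v} F.isoEquiv ⊣ Induce.{u, v} B) ∧
      Nonempty (Res.{u, v} B ⊣ pull.{u, v} F.isoEquiv.symm ⋙ Induce.{u, v} C) :=
  ⟨F'.nonempty_adjunction_pull F.isoEquiv fun a => by rw [h, isoEquiv_apply],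
    F.nonempty_adjunction F.isoEquiv fun a => isoEquiv_apply F a⟩

end FrobeniusData

/-! ### Equivariance under `Γ_P` and the twisted extended algebra -/

section Hecke

variable {ι X Y : Type u} [AddCommGroup X] [AddCommGroup Y] {D : RootPairing ι ℤ X Y}
  [Module.Free ℤ X] [Module.Finite ℤ X] {b : D.Base} {κ : Labels D} [Finite ι] [D.IsReduced]
  {P Q : Set ι} {d : D.weylGroup}

theorem oppMap_mul (h : Opposite b P Q d) (a : Hecke b κ) {c : Hecke b κ}
    (hc : c ∈ parabolic b κ Q) : oppMap κ P d (a * c) = oppMap κ P d a * oppMap κ P d c := by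
  rw [oppMap_apply, oppMap_apply, ← mul_assoc, topCoeff_mul_right h hc, oppMap_apply]

theorem oppMap_N (h : Opposite b P Q d) {w : D.weylGroup} (hw : w ∈ parabolicWeyl D Q) :
    oppMap κ P d (N b κ w) = N b κ (d * w * d⁻¹) :=
  Subtype.ext_iff.mp (oppHom_N h hw)

theorem oppMap_theta (h : Opposite b P Q d) (x : X) :
    oppMap κ P d (theta b κ x) = theta b κ (d • x) :=
  Subtype.ext_iff.mp (oppHom_theta h x)

variable {Γ : Type u} [Group Γ] (E : Extension b κ Γ)

/-- `γ` normalizes `W_P` and fixes `d`, so it permutes, up to scalars, the basis elements with `w ∈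
W_P d`, and likewise those with `w ∉ W_P d`. -/
theorem topCoeff_act {γ : Γ} (hP : (fun i => E.toAut γ • i) '' P = P)
    (hd : MulAut.conjNormal (E.toAut γ) d = d) (a : Hecke b κ) :
    topCoeff b κ P d (E.act γ a) = E.act γ (topCoeff b κ P d a) := by
  induction a using hecke_induction with
  | zero => simp only [map_zero]
  | add a a' h h' => simp only [map_add, h, h']
  | single f w =>
    have hw : MulAut.conjNormal (E.toAut γ) w * d⁻¹ = MulAut.conjNormal (E.toAut γ) (w * d⁻¹) := by
      rw [map_mul, map_inv, hd]
    have hiff := conjNormal_mem_parabolicWeyl_iff hP (w := w * d⁻¹)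
    rw [← hw] at hiff
    induction f using lat_induction with
    | of x =>
      rw [thetaHom_lat, map_mul, E.act_theta, E.act_N, smul_mul_assoc, map_smul, ← thetaHom_lat,
        ← thetaHom_lat]
      by_cases h : w * d⁻¹ ∈ parabolicWeyl D P
      · rw [topCoeff_of_mem h, topCoeff_of_mem (hiff.mpr h), thetaHom_lat, thetaHom_lat, map_mul,
          E.act_theta, E.act_N, hw, smul_mul_assoc]
      · rw [topCoeff_of_notMem h, topCoeff_of_notMem (mt hiff.mp h), map_zero, smul_zero]
    | add f g hf hg => simp only [map_add, add_mul, hf, hg]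
    | smul z f hf => simp only [map_smul, smul_mul_assoc, hf]

theorem oppMap_act {γ : Γ} (hP : (fun i => E.toAut γ • i) '' P = P)
    (hd : MulAut.conjNormal (E.toAut γ) d = d) (a : Hecke b κ) :
    oppMap κ P d (E.act γ a) = E.act γ (oppMap κ P d a) := by
  have h : N b κ d * E.act γ a = E.act γ (N b κ d * a) := by rw [map_mul, E.act_N, hd]
  rw [oppMap_apply, h, topCoeff_act E hP hd, oppMap_apply]

theorem act_mem_parabolic {γ : Γ} (hP : P ⊆ b.support)
    (hγ : (fun i => E.toAut γ • i) '' P = P) {a : Hecke b κ} (ha : a ∈ parabolic b κ P) :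
    E.act γ a ∈ parabolic b κ P := by
  induction ha using parabolic_algebra_induction hP with
  | algebraMap z =>
    rw [AlgEquiv.commutes]
    exact algebraMap_mem _ z
  | theta x =>
    rw [E.act_theta]
    exact Subalgebra.smul_mem _ (theta_mem _) _
  | refl i hi =>
    rw [E.act_N]
    exact N_mem ((conjNormal_mem_parabolicWeyl_iff hγ).mpr (refl_mem_parabolic hi))
  | add a a' _ _ h h' => rw [map_add]; exact add_mem h h'
  | mul a a' _ _ h h' => rw [map_mul]; exact mul_mem h h'

/-- `γ` preserves `Δ` and `P`, so it fixes `w_Δ` and `w_P`, and `d` is determined by `w_P d = w_Δ`.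
-/
theorem Opposite.conjNormal_eq (h : Opposite b P Q d) {γ : Γ}
    (hP : (fun i => E.toAut γ • i) '' P = P) : MulAut.conjNormal (E.toAut γ) d = d := by
  have hb := image_support_eq (E.map_base γ)
  have h1 := congrArg (MulAut.conjNormal (E.toAut γ)) h.longest_left
  rw [map_mul, conjNormal_longest h.left_subset hb hP, conjNormal_longest subset_rfl hb hb,
    ← h.longest_left] at h1
  exact mul_left_cancel h1

variable {E} {c : Cocycle Γ} (F : ParabolicFamily E c)

/-- The conjugation axiom for `d⁻¹ ∈ W`, projected to `Γ`, where `d⁻¹` becomes trivial. -/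
theorem Opposite.sub_eq (h : Opposite b P Q d) : F.sub Q = F.sub P := by
  have himg : (fun i => E.aut (SemidirectProduct.inl d⁻¹) • i) '' P = Q := by
    have hs : ∀ i : ι, E.aut (SemidirectProduct.inl d⁻¹) • i = d⁻¹ • i := fun i => by
      change ((d⁻¹ : D.weylGroup).val * E.toAut 1) • i = d⁻¹ • i
      rw [map_one, mul_one]
      rfl
    ext i
    constructor
    · rintro ⟨j, hj, rfl⟩
      change E.aut (SemidirectProduct.inl d⁻¹) • j ∈ Q
      rw [hs]
      exact h.map_left j hj
    · exact fun hi => ⟨d • i, h.map_right i hi, (hs _).trans (inv_smul_smul d i)⟩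
  have hc := F.conj (SemidirectProduct.inl d⁻¹) P h.left_subset (himg ▸ h.right_subset)
  rw [himg] at hc
  have hr := congrArg (Subgroup.map (SemidirectProduct.rightHom : E.WGamma →* Γ)) hc
  rw [Subgroup.map_map, Subgroup.map_map, Subgroup.map_map] at hr
  have h1 : (SemidirectProduct.rightHom : E.WGamma →* Γ).comp SemidirectProduct.inr
      = MonoidHom.id Γ := SemidirectProduct.rightHom_comp_inr
  have h2 : ((SemidirectProduct.rightHom : E.WGamma →* Γ).comp
      ((MulAut.conj (SemidirectProduct.inl d⁻¹ : E.WGamma)).toMonoidHom.comp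
        SemidirectProduct.inr)) = MonoidHom.id Γ := by
    ext γ
    simp
  rw [h1, Subgroup.map_id] at hr
  rw [← hr]
  refine Eq.trans ?_ (Subgroup.map_id _)
  congr 1

variable [Fintype Γ]

theorem tN_mul_ttheta (g : E.WGamma) (x : X) :
    tN E c g * ttheta E c x
      = Crossed.single E.act c g.right (N b κ g.left * E.act g.right (theta b κ x)) := by
  rw [tN, ttheta, Crossed.incl_mul_Ngamma, Crossed.single_mul_incl]

theorem mapCoeff_oppMap_tN (h : Opposite b P Q d) {g : E.WGamma}
    (hw : g.left ∈ parabolicWeyl D Q) (hQ : (fun i => E.toAut g.right • i) '' Q = Q)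
    (hP : (fun i => E.toAut g.right • i) '' P = P) (x : X) :
    FrobeniusData.mapCoeff E.act c (oppMap κ P d) (tN E c g * ttheta E c x)
      = tN E c (SemidirectProduct.inl d * g * SemidirectProduct.inl d⁻¹) * ttheta E c (d • x) := by
  have hd := h.conjNormal_eq E hP
  have hr : (SemidirectProduct.inl d * g * SemidirectProduct.inl d⁻¹ : E.WGamma).right
      = g.right := by simp
  have hl : (SemidirectProduct.inl d * g * SemidirectProduct.inl d⁻¹ : E.WGamma).left
      = d * g.left * d⁻¹ := by
    have : E.conj g.right d⁻¹ = d⁻¹ := by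
      change MulAut.conjNormal (E.toAut g.right) d⁻¹ = d⁻¹
      rw [map_inv, hd]
    simp [this]
  rw [tN_mul_ttheta, tN_mul_ttheta, hr, hl, FrobeniusData.mapCoeff_single,
    oppMap_mul h _ (act_mem_parabolic E h.right_subset hQ (theta_mem x)), oppMap_N h hw,
    oppMap_act E hP hd, oppMap_theta h]

theorem Opposite.exists_crossed_frobeniusData (h : Opposite b P Q d) :
    ∃ G : FrobeniusData (tparabolic E F P) (tparabolic E F Q),
      G.iso = FrobeniusData.mapCoeff E.act c (oppMap κ Q d⁻¹) ∧
      G.inv = FrobeniusData.mapCoeff E.act c (oppMap κ P d) := by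
  obtain ⟨G, h1, h2, h3⟩ := exists_frobeniusData (κ := κ) h
  have hP : ∀ γ ∈ F.sub P, (fun i => E.toAut γ • i) '' P = P := fun γ hγ =>
    (F.stab P h.left_subset γ hγ).1
  have hQ : ∀ γ ∈ F.sub P, (fun i => E.toAut γ • i) '' Q = Q := fun γ hγ =>
    (F.stab Q h.right_subset γ (h.sub_eq F ▸ hγ)).1
  have hBP : FrobeniusData.IsCrossedSub (F.sub P) (parabolic b κ P) (tparabolic E F P) :=
    Crossed.isCrossedSub_adjoin _ _ fun γ hγ a ha =>
      act_mem_parabolic E h.left_subset (hP γ hγ) ha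
  have hBQ : FrobeniusData.IsCrossedSub (F.sub P) (parabolic b κ Q) (tparabolic E F Q) := by
    have := Crossed.isCrossedSub_adjoin (κ := c) (act := E.act) (F.sub P) (parabolic b κ Q)
      fun γ hγ a ha => act_mem_parabolic E h.right_subset (hQ γ hγ) ha
    rwa [← h.sub_eq F] at this ⊢
  refine ⟨G.crossed (Γ' := F.sub P) (fun γ hγ a => ?_) (fun γ hγ a => ?_) hBP hBQ
    (fun γ hγ a ha => act_mem_parabolic E h.left_subset (hP γ hγ) ha), ?_, ?_⟩
  · rw [h1]
    exact topCoeff_act E (hP γ hγ) (h.conjNormal_eq E (hP γ hγ)) a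
  · rw [h2]
    exact oppMap_act E (hQ γ hγ) (h.symm.conjNormal_eq E (hQ γ hγ)) a
  · exact congrArg (FrobeniusData.mapCoeff E.act c) h2
  · exact congrArg (FrobeniusData.mapCoeff E.act c) h3

end Hecke

end SecondAdj

end

open SecondAdj

theorem theoremC {ι X Y : Type u} [Finite ι] [AddCommGroup X] [AddCommGroup Y]
    [Module.Free ℤ X] [Module.Finite ℤ X]
    (D : RootPairing ι ℤ X Y) [D.IsReduced] (b : D.Base) (κ : Labels D) :
    (∀ P : Set ι, P ⊆ b.support →
      ∃ ψ : parabolic b κ P ≃ₐ[ℂ] parabolic b κ (opp b P),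
        (∀ (w : D.weylGroup) (hw : w ∈ parabolicWeyl D P) (x : X),
          (ψ ⟨N b κ w * theta b κ x, N_mul_theta_mem b κ hw x⟩ : Hecke b κ)
            = N b κ (longest b b.support * longest b P * w * longest b P * longest b b.support)
              * theta b κ ((longest b b.support * longest b P) • x)) ∧
        Nonempty ((Res.{u, v} (parabolic b κ (opp b P)) ⋙ pull.{u, v} ψ)
          ⊣ Induce.{u, v} (parabolic b κ P)) ∧
        Nonempty (Res.{u, v} (parabolic b κ P)
          ⊣ (pull.{u, v} ψ.symm ⋙ Induce.{u, v} (parabolic b κ (opp b P))))) ∧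
    (∀ (Γ : Type u) [Group Γ] [Fintype Γ] (E : Extension b κ Γ) (c : Cocycle Γ)
      (F : ParabolicFamily E c) (P : Set ι), P ⊆ b.support →
      ∃ ψ : tparabolic E F P ≃ₐ[ℂ] tparabolic E F (opp b P),
        (∀ (g : E.WGamma) (hw : g.left ∈ parabolicWeyl D P) (hγ : g.right ∈ F.sub P) (x : X),
          (ψ ⟨tN E c g * ttheta E c x, tN_mul_ttheta_mem E F hw hγ x⟩ : THecke E c)
            = tN E c (SemidirectProduct.inl (longest b b.support * longest b P) * g
                * SemidirectProduct.inl (longest b P * longest b b.support))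
              * ttheta E c ((longest b b.support * longest b P) • x)) ∧
        Nonempty ((Res.{u, v} (tparabolic E F (opp b P)) ⋙ pull.{u, v} ψ)
          ⊣ Induce.{u, v} (tparabolic E F P)) ∧
        Nonempty (Res.{u, v} (tparabolic E F P)
          ⊣ (pull.{u, v} ψ.symm ⋙ Induce.{u, v} (tparabolic E F (opp b P))))) := by
  refine ⟨fun P hP => ?_, fun Γ _ _ E c F P hP => ?_⟩
  · have h := opposite_opp hP
    have hd : longest b b.support * longest b P = (longest b P * longest b b.support)⁻¹ := by
      rw [mul_inv_rev, longest_inv hP, longest_inv subset_rfl]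
    obtain ⟨G, -, hG, -⟩ := exists_frobeniusData (κ := κ) h
    -- The datum for the opposite pair is what gives (a). Its inverse isomorphism is the isomorphism
    -- of `G`, so a single `ψ` serves both statements.
    obtain ⟨G', -, -, hG'⟩ := exists_frobeniusData (κ := κ) h.symm
    refine ⟨G.isoEquiv, fun w hw x => ?_, G.nonempty_adjunctions G' (hG'.trans hG.symm)⟩
    rw [FrobeniusData.isoEquiv_apply, hG, oppMap_mul h.symm _ (theta_mem x), oppMap_N h.symm hw,
      oppMap_theta h.symm, inv_inv, mul_assoc (_ * w), hd]
  · have h := opposite_opp hP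
    have hd : longest b b.support * longest b P = (longest b P * longest b b.support)⁻¹ := by
      rw [mul_inv_rev, longest_inv hP, longest_inv subset_rfl]
    obtain ⟨G, hG, -⟩ := h.exists_crossed_frobeniusData F
    obtain ⟨G', -, hG'⟩ := h.symm.exists_crossed_frobeniusData F
    refine ⟨G.isoEquiv, fun g hw hγ x => ?_, G.nonempty_adjunctions G' (hG'.trans hG.symm)⟩
    rw [FrobeniusData.isoEquiv_apply, hG, mapCoeff_oppMap_tN h.symm hw
      (F.stab P hP _ hγ).1 (F.stab _ h.right_subset _ (h.sub_eq F ▸ hγ)).1, inv_inv, hd]
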